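/- Let $d\in\mathbb N$, $p,q\in(1,\infty)$, $\alpha,\beta>0$, and let $\Omega\subset\mathbb R^d$ be closed and convex. Let $W_p(\Omega)$ be the space of probability measures on $\Omega$ with finite $p$-th moment, endowed with the $p$-Wasserstein distance. For a Lipschitz curve $\mu:[0,1]\to W_p(\Omega)$, a *velocity field* of $\mu$ is a Borel field $v$ with $v_t\in L^p(\mu_t;\mathbb R^d)$ for a.e. $t$ such that, for all $\phi\in C^1_c(\mathbb R^d)$, the function $s\mapsto\int_\Omega\nabla\phi\cdot v_s\,d\mu_s$ is integrable on $[0,1]$ and $$\int_\Omega\phi\,d\mu_{t_2}-\int_\Omega\phi\,d\mu_{t_1}=\int_{t_1}^{t_2}\!\int_\Omega\nabla\phi\cdot v_s\,d\mu_s\,ds\qquad\text{for all }0\le t_1<t_2\le 1 .$$ The *tangent field* of $\mu$ is the velocity field $v$ such that, for every velocity field $w$ of $\mu$, $\|v_t\|_{L^p(\mu_t)}\le\|w_t\|_{L^p(\mu_t)}$ for a.e. $t$. Put $V(t)=V(\mu,t)=\int_\Omega|v_t|^p\,d\mu_t$ with $v$ the tangent field, $L_q(\nu)=\int_\Omega u^q\,dx$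 if $\nu=u\,\mathcal L^d$ and $L_q(\nu)=+\infty$ otherwise, and $$\mathfrak F(\mu)=\int_0^1 L_q(\mu_t)^\alpha\,V(\mu,t)^\beta\,dt\in[0,\infty]\qquad(\text{with }\infty\cdot 0=0).$$ Let $\mu$ minimize $\mathfrak F$ among all Lipschitz curves $[0,1]\to W_p(\Omega)$ with given endpoints $\mu_0,\mu_1$, with $\mathfrak F(\mu)<\infty$, and let $v$ be its tangent field. Assume that on every interval $[a,b]\subset(0,1)$ there is $V_0>0$ with $V(t)\ge V_0$ for a.e. $t\in[a,b]$ (for instance, $V\ge V_0>0$ a.e. on $[0,1]$). Then $\mu_t=u_t\,\mathcal L^d$ is absolutely continuous for a.e. $t$, and, with $F(t)=L_q(\mu_t)$, for every $\xi\in C_c^\infty\big((0,1)\times\operatorname{int}\Omega;\mathbb R^d\big)$ $$\alpha(1-q)\int_0^1F^{\alpha-1}V^{\beta}\int_\Omega(\nabla\cdot\xi)\,u_t^q\,dx\,dt+p\beta\int_0^1F^{\alpha}V^{\beta-1}\int_\Omega u_t|v_t|^{p-2}\big(\nabla\xi\cdot v_t+\partial_t\xi\big)\cdot v_t\,dx\,dt=0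 ,$$ where the inner integrands are integrable on $\Omega$ for a.e. $t$ and the outer integrands are integrable on $[0,1]$. -/

import Mathlib

open MeasureTheory Set
open scoped NNReal ENNReal
open scoped ContDiff

namespace WGeod

noncomputable section

/-- `ℝ^d` with its Euclidean norm. -/
abbrev Space (d : ℕ) : Type := EuclideanSpace ℝ (Fin d)

variable {d : ℕ}

/-- `γ` is a transport plan (coupling) between `μ` and `ν`. -/
def IsCoupling (μ ν : Measure (Space d)) (γ : Measure (Space d × Space d)) : Prop :=
  γ.map Prod.fst = μ ∧ γ.map Prod.snd = ν

/-- The Wasserstein distance of order `p`: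
`W_p(μ,ν) = (inf_γ ∫ |x - y|^p dγ(x,y))^(1/p)` over all couplings `γ`. -/
def wassersteinDist (p : ℝ) (μ ν : Measure (Space d)) : ℝ≥0∞ :=
  (⨅ (γ : Measure (Space d × Space d)) (_ : IsCoupling μ ν γ),
    ∫⁻ z, ‖z.1 - z.2‖ₑ ^ p ∂γ) ^ (1 / p)

/-- Membership in `W_p(Ω)`: probability measures on `Ω` with finite `p`-th moment. -/
structure MemWp (p : ℝ) (Ω : Set (Space d)) (μ : Measure (Space d)) : Prop where
  isProb : IsProbabilityMeasure μ
  concentrated : μ Ωᶜ = 0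
  moment : ∫⁻ x, ‖x‖ₑ ^ p ∂μ < ⊤

/-- `μ` is a Lipschitz curve `[0,1] → W_p(Ω)` (the values `μ t` with `t ∉ [0,1]` play no role). -/
structure IsLipschitzCurve (p : ℝ) (Ω : Set (Space d)) (μ : ℝ → Measure (Space d)) : Prop where
  mem : ∀ t ∈ Icc (0 : ℝ) 1, MemWp p Ω (μ t)
  lip : ∃ C : ℝ≥0, ∀ s ∈ Icc (0 : ℝ) 1, ∀ t ∈ Icc (0 : ℝ) 1,
    wassersteinDist p (μ s) (μ t) ≤ C * ENNReal.ofReal |s - t|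

/-- `v` is a velocity field of the curve `μ`: a Borel field with `v_t ∈ L^p(μ_t)` for a.e. `t`
that solves the continuity equation, tested against all `φ ∈ C^1_c`. Since `Ω` is closed and the
measures live on `Ω`, the test functions are the restrictions to `Ω` of functions in `C^1_c(ℝ^d)`:
they need not vanish on the boundary of `Ω`. -/
structure IsVelocityField (p : ℝ) (μ : ℝ → Measure (Space d)) (v : ℝ → Space d → Space d) :
    Prop where
  measurable : Measurable (Function.uncurry v)
  memLp : ∀ᵐ t ∂(volume.restrict (Icc (0 : ℝ) 1)), MemLp (v t) (ENNReal.ofReal p) (μ t)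
  integrable : ∀ φ : Space d → ℝ, ContDiff ℝ 1 φ → HasCompactSupport φ →
    IntegrableOn (fun s => ∫ x, fderiv ℝ φ x (v s x) ∂(μ s)) (Icc (0 : ℝ) 1)
  continuity_eq : ∀ φ : Space d → ℝ, ContDiff ℝ 1 φ → HasCompactSupport φ →
    ∀ t₁ ∈ Icc (0 : ℝ) 1, ∀ t₂ ∈ Icc (0 : ℝ) 1, t₁ < t₂ →
      ∫ x, φ x ∂(μ t₂) - ∫ x, φ x ∂(μ t₁) = ∫ s in t₁..t₂, ∫ x, fderiv ℝ φ x (v s x) ∂(μ s)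

/-- `v` is the tangent field of the curve `μ`: a velocity field which, for a.e. `t`, has minimal
`L^p(μ_t)` norm among all velocity fields. -/
structure IsTangentField (p : ℝ) (μ : ℝ → Measure (Space d)) (v : ℝ → Space d → Space d) :
    Prop where
  velocity : IsVelocityField p μ v
  minimal : ∀ w : ℝ → Space d → Space d, IsVelocityField p μ w →
    ∀ᵐ t ∂(volume.restrict (Icc (0 : ℝ) 1)),
      eLpNorm (v t) (ENNReal.ofReal p) (μ t) ≤ eLpNorm (w t) (ENNReal.ofReal p) (μ t)

open Classical in
/-- `L_q(ν) = ∫_Ω u^q dx` if `ν = u · Lebesgue`, and `+∞` otherwise. -/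
def Lq (q : ℝ) (Ω : Set (Space d)) (ν : Measure (Space d)) : ℝ≥0∞ :=
  if ν ≪ volume then ∫⁻ x in Ω, (ν.rnDeriv volume x) ^ q else ⊤

/-- `∫ |v_t|^p dμ_t`, which is `V(μ,t)` when `v` is the tangent field of `μ`. -/
def kinetic (p : ℝ) (μ : ℝ → Measure (Space d)) (v : ℝ → Space d → Space d) (t : ℝ) : ℝ≥0∞ :=
  ∫⁻ x, ‖v t x‖ₑ ^ p ∂(μ t)

/-- `∫_0^1 L_q(μ_t)^α (∫ |v_t|^p dμ_t)^β dt`. -/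
def energyOf (p q α β : ℝ) (Ω : Set (Space d)) (μ : ℝ → Measure (Space d))
    (v : ℝ → Space d → Space d) : ℝ≥0∞ :=
  ∫⁻ t in Icc (0 : ℝ) 1, (Lq q Ω (μ t)) ^ α * (kinetic p μ v t) ^ β

/-- The functional `𝔉(μ) = ∫_0^1 L_q(μ_t)^α V(μ,t)^β dt` with `V(μ,t) = ∫ |v_t|^p dμ_t` and `v` the
tangent field of `μ`. The infimum only selects the tangent field: all tangent fields of `μ` give
the same value, see `energy_eq`. -/
def energy (p q α β : ℝ) (Ω : Set (Space d)) (μ : ℝ → Measure (Space d)) : ℝ≥0∞ :=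
  ⨅ (v : ℝ → Space d → Space d) (_ : IsTangentField p μ v), energyOf p q α β Ω μ v

lemma kinetic_eq {p : ℝ} (hp : 0 < p) (μ : ℝ → Measure (Space d)) (v : ℝ → Space d → Space d)
    (t : ℝ) : kinetic p μ v t = eLpNorm (v t) (ENNReal.ofReal p) (μ t) ^ p := by
  have h0 : ENNReal.ofReal p ≠ 0 := by simpa using hp
  rw [eLpNorm_eq_lintegral_rpow_enorm_toReal h0 ENNReal.ofReal_ne_top,
    ENNReal.toReal_ofReal hp.le, ← ENNReal.rpow_mul, one_div, inv_mul_cancel₀ hp.ne',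
    ENNReal.rpow_one]
  rfl

lemma energy_eq {p : ℝ} (hp : 0 < p) (q α β : ℝ) (Ω : Set (Space d))
    (μ : ℝ → Measure (Space d)) (v : ℝ → Space d → Space d) (hv : IsTangentField p μ v) :
    energy p q α β Ω μ = energyOf p q α β Ω μ v := by
  refine le_antisymm (iInf₂_le v hv) (le_iInf₂ fun w hw => le_of_eq ?_)
  refine lintegral_congr_ae ?_
  filter_upwards [hv.minimal w hw.velocity, hw.minimal v hv.velocity] with t h₁ h₂
  rw [kinetic_eq hp, kinetic_eq hp, le_antisymm h₁ h₂]

/-- `Γ(μ₀,μ₁)`: Lipschitz curves in `W_p(Ω)` from `μ₀` to `μ₁`. -/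
structure IsAdmissible (p : ℝ) (Ω : Set (Space d)) (μ₀ μ₁ : Measure (Space d))
    (μ : ℝ → Measure (Space d)) : Prop where
  curve : IsLipschitzCurve p Ω μ
  init : μ 0 = μ₀
  final : μ 1 = μ₁

/-- `μ` minimizes `𝔉` among the curves in `Γ(μ₀,μ₁)`. -/
structure IsMinimizer (p q α β : ℝ) (Ω : Set (Space d)) (μ₀ μ₁ : Measure (Space d))
    (μ : ℝ → Measure (Space d)) : Prop where
  admissible : IsAdmissible p Ω μ₀ μ₁ μ
  le : ∀ ν : ℝ → Measure (Space d), IsAdmissible p Ω μ₀ μ₁ ν →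
    energy p q α β Ω μ ≤ energy p q α β Ω ν

/-- The Lebesgue density of `ν` (relevant where `ν ≪ volume`). -/
def density (ν : Measure (Space d)) (x : Space d) : ℝ := (ν.rnDeriv volume x).toReal

/-- The divergence in space, `∇ · ξ = ∑ i, ∂ξ_i/∂x_i` at `(t, x)`. -/
def divergence (ξ : ℝ × Space d → Space d) (t : ℝ) (x : Space d) : ℝ :=
  ∑ i : Fin d, (fderiv ℝ (fun y => ξ (t, y)) x (EuclideanSpace.single i 1)) i

/-- The vector `∇ξ · w + ∂ξ/∂t` at `(t, x)`. -/
def transportDeriv (ξ : ℝ × Space d → Space d) (t : ℝ) (x w : Space d) : Space d :=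
  fderiv ℝ (fun y => ξ (t, y)) x w + deriv (fun s => ξ (s, x)) t

/-- The inner integrand `(∇ · ξ) u_t^q`. -/
def pressureIntegrand (q : ℝ) (μ : ℝ → Measure (Space d)) (ξ : ℝ × Space d → Space d)
    (t : ℝ) (x : Space d) : ℝ :=
  divergence ξ t x * density (μ t) x ^ q

/-- The inner integrand `u_t |v_t|^(p-2) (∇ξ · v_t + ∂ξ/∂t) · v_t`. -/
def momentumIntegrand (p : ℝ) (μ : ℝ → Measure (Space d)) (v : ℝ → Space d → Space d)
    (ξ : ℝ × Space d → Space d) (t : ℝ) (x : Space d) : ℝ :=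
  density (μ t) x * ‖v t x‖ ^ (p - 2) * inner ℝ (transportDeriv ξ t x (v t x)) (v t x)

/-- `t ↦ F(t)^(α-1) V(t)^β ∫_Ω (∇ · ξ) u_t^q dx`, with `F(t) = L_q(μ_t)` and
`V(t) = ∫ |v_t|^p dμ_t`. -/
def pressureTerm (p q α β : ℝ) (Ω : Set (Space d)) (μ : ℝ → Measure (Space d))
    (v : ℝ → Space d → Space d) (ξ : ℝ × Space d → Space d) (t : ℝ) : ℝ :=
  (Lq q Ω (μ t)).toReal ^ (α - 1) * (kinetic p μ v t).toReal ^ β *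
    ∫ x in Ω, pressureIntegrand q μ ξ t x

/-- `t ↦ F(t)^α V(t)^(β-1) ∫_Ω u_t |v_t|^(p-2) (∇ξ · v_t + ∂ξ/∂t) · v_t dx`, with
`F(t) = L_q(μ_t)` and `V(t) = ∫ |v_t|^p dμ_t`. -/
def momentumTerm (p q α β : ℝ) (Ω : Set (Space d)) (μ : ℝ → Measure (Space d))
    (v : ℝ → Space d → Space d) (ξ : ℝ × Space d → Space d) (t : ℝ) : ℝ :=
  (Lq q Ω (μ t)).toReal ^ α * (kinetic p μ v t).toReal ^ (β - 1) *
    ∫ x in Ω, momentumIntegrand p μ v ξ t x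

end

end WGeod

namespace WGeod

variable {d : ℕ}

/-! ### Couplings and differences of integrals -/

section Coupling

/-! The equation is the stationarity of 𝔉 under inner variations. Push each μ_t forward by x ↦ x + ε
ξ(t,x). Since ξ has compact support in (0,1) × int Ω, for small ε the image curve stays in Ω, is
Lipschitz and keeps its endpoints (`IsAdmissible.perturbCurve`), so its energy is at least that of
μ.

That energy is bounded above by an explicit function of ε. A change of variables gives L_q ≤ F_ε :=
∫ u^q det(1 + ε∇ξ)^(1-q) (`Lq_map_le`). The field v + ε(∇ξ·v + ∂_tξ), carried along by the
perturbation, is a velocity field of the image curve (`IsVelocityField.exists_perturbCurve`); the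
tangent field does no worse, so the kinetic term is at most V_ε := ∫ |v + ε(∇ξ·v + ∂_tξ)|^p dμ_t.
Hence J(ε) = ∫ F_ε^α V_ε^β dt bounds the energy of the image curve, with equality at ε = 0
(`energy_perturbCurve_le`). So J has a local minimum at 0, and J'(0) = 0 is the claim.

Three points need work. First, φ(x + ε ξ(t,x)) depends on time, so the continuity equation must be
extended to time-dependent test functions (`IsTimeTest.integrableOn_and_integral_eq`). Second,
`energy` is an infimum over tangent fields, equal to ⊤ if there are none, so the image curve must be
shown to have one (`IsVelocityField.exists_isTangentField`). Third, J must be differentiated under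
the integral with no control on F and V beyond the finiteness of the energy. This works because F_ε
and V_ε are Lipschitz in ε relative to their own size, |F_ε - F_ε'| ≤ C F_0 |ε - ε'| and likewise
for V, so F_0^α V_0^β dominates (`hasDerivAt_integral_rpow_mul_rpow`). For V the natural bound is
C(V_0 + 1), because ∂_tξ does not scale with v; the lower bound on V over the times where ξ lives
absorbs the 1. -/

lemma exists_coupling_of_wassersteinDist_lt {p : ℝ} (hp : 0 < p) {μ ν : Measure (Space d)}
    {c : ℝ≥0∞} (h : wassersteinDist p μ ν < c) :
    ∃ γ : Measure (Space d × Space d), IsCoupling μ ν γ ∧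
      ∫⁻ z, ‖z.1 - z.2‖ₑ ^ p ∂γ < c ^ p := by
  have h1 := ENNReal.rpow_lt_rpow h hp
  rw [wassersteinDist, ← ENNReal.rpow_mul, one_div, inv_mul_cancel₀ hp.ne', ENNReal.rpow_one] at h1
  simp only [iInf_lt_iff] at h1
  obtain ⟨γ, hγ, h2⟩ := h1
  exact ⟨γ, hγ, h2⟩

lemma IsCoupling.isProbabilityMeasure {μ ν : Measure (Space d)} [IsProbabilityMeasure μ]
    {γ : Measure (Space d × Space d)} (h : IsCoupling μ ν γ) : IsProbabilityMeasure γ := by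
  constructor
  have h1 : γ.map Prod.fst univ = 1 := by rw [h.1]; exact measure_univ
  rwa [Measure.map_apply measurable_fst MeasurableSet.univ, preimage_univ] at h1

/-- Integrate the pointwise bound over a nearly optimal plan, and use that the L^1 norm is at most
the L^p norm on a probability space. Allowing two functions and a defect `a` makes it possible to
compare a test function at two different times. -/
lemma abs_integral_sub_integral_le {p : ℝ} (hp : 1 < p) {μ ν : Measure (Space d)}
    [IsProbabilityMeasure μ] {G H : Space d → ℝ} (hG : Integrable G μ) (hH : Integrable H ν)
    {a b w : ℝ} (hb : 0 ≤ b) (hw : 0 ≤ w)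
    (hGH : ∀ x y, |G x - H y| ≤ a + b * ‖x - y‖)
    (hW : wassersteinDist p μ ν ≤ ENNReal.ofReal w) :
    |∫ x, G x ∂μ - ∫ y, H y ∂ν| ≤ a + b * w := by
  have key : ∀ w' : ℝ, w < w' → |∫ x, G x ∂μ - ∫ y, H y ∂ν| ≤ a + b * w' := by
    intro w' hw'
    have hw0 : 0 < w' := hw.trans_lt hw'
    obtain ⟨γ, hγ, hlt⟩ := exists_coupling_of_wassersteinDist_lt (by linarith : (0:ℝ) < p)
      (hW.trans_lt ((ENNReal.ofReal_lt_ofReal_iff hw0).2 hw'))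
    have hprob := hγ.isProbabilityMeasure
    have hp0 : ENNReal.ofReal p ≠ 0 := by simp; linarith
    have hmeas : AEStronglyMeasurable (fun z : Space d × Space d => z.1 - z.2) γ :=
      (measurable_fst.sub measurable_snd).aestronglyMeasurable
    have hnorm : eLpNorm (fun z : Space d × Space d => z.1 - z.2) (ENNReal.ofReal p) γ
        ≤ ENNReal.ofReal w' := by
      rw [eLpNorm_eq_lintegral_rpow_enorm_toReal hp0 ENNReal.ofReal_ne_top,
        ENNReal.toReal_ofReal (by linarith)]
      calc _ ≤ (ENNReal.ofReal w' ^ p) ^ (1 / p) := by gcongr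
        _ = _ := by
          rw [← ENNReal.rpow_mul, mul_one_div_cancel (by linarith), ENNReal.rpow_one]
    have hone : eLpNorm (fun z : Space d × Space d => z.1 - z.2) 1 γ ≤ ENNReal.ofReal w' :=
      (eLpNorm_le_eLpNorm_of_exponent_le (by simpa using hp.le) hmeas).trans hnorm
    have hint : Integrable (fun z : Space d × Space d => z.1 - z.2) γ :=
      memLp_one_iff_integrable.1 ⟨hmeas, hone.trans_lt ENNReal.ofReal_lt_top⟩
    have hle : ∫ z : Space d × Space d, ‖z.1 - z.2‖ ∂γ ≤ w' := by
      rw [integral_norm_eq_lintegral_enorm hmeas, ← eLpNorm_one_eq_lintegral_enorm]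
      exact ENNReal.toReal_le_of_le_ofReal hw0.le hone
    have hG' : Integrable (fun z : Space d × Space d => G z.1) γ := by
      rw [← hγ.1] at hG; exact hG.comp_measurable measurable_fst
    have hH' : Integrable (fun z : Space d × Space d => H z.2) γ := by
      rw [← hγ.2] at hH; exact hH.comp_measurable measurable_snd
    have e1 : ∫ x, G x ∂μ = ∫ z, G z.1 ∂γ := by
      rw [← hγ.1] at hG ⊢
      exact integral_map measurable_fst.aemeasurable hG.aestronglyMeasurable
    have e2 : ∫ y, H y ∂ν = ∫ z, H z.2 ∂γ := by
      rw [← hγ.2] at hH ⊢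
      exact integral_map measurable_snd.aemeasurable hH.aestronglyMeasurable
    rw [e1, e2, ← integral_sub hG' hH']
    calc |∫ z, (G z.1 - H z.2) ∂γ| ≤ ∫ z, |G z.1 - H z.2| ∂γ := abs_integral_le_integral_abs
      _ ≤ ∫ z : Space d × Space d, (a + b * ‖z.1 - z.2‖) ∂γ :=
          integral_mono (hG'.sub hH').abs ((integrable_const a).add (hint.norm.const_mul b))
            fun z => hGH _ _
      _ = a + b * ∫ z : Space d × Space d, ‖z.1 - z.2‖ ∂γ := by
          rw [integral_add (integrable_const a) (hint.norm.const_mul b), integral_const_mul]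
          simp
      _ ≤ _ := by gcongr
  -- The bound is known for every w' > w only; the increment is divided by b + 1 because b may
  -- vanish.
  refine le_of_forall_pos_le_add fun e he => ?_
  have hb1 : 0 < b + 1 := by linarith
  have := key (w + e / (b + 1)) (by have := div_pos he hb1; linarith)
  have h2 : b * (e / (b + 1)) ≤ e := by
    rw [mul_div_assoc', div_le_iff₀ hb1]; nlinarith
  nlinarith

end Coupling

/-! ### Measurable dependence of the curve on time -/

section CurveKernel

lemma IsLipschitzCurve.exists_wassersteinDist_le {p : ℝ} {Ω : Set (Space d)}
    {μ : ℝ → Measure (Space d)} (h : IsLipschitzCurve p Ω μ) :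
    ∃ C : ℝ, 0 ≤ C ∧ ∀ s ∈ Icc (0 : ℝ) 1, ∀ t ∈ Icc (0 : ℝ) 1,
      wassersteinDist p (μ s) (μ t) ≤ ENNReal.ofReal (C * |s - t|) := by
  obtain ⟨C, hC⟩ := h.lip
  refine ⟨C, C.2, fun s hs t ht => (hC s hs t ht).trans_eq ?_⟩
  rw [ENNReal.ofReal_mul (NNReal.coe_nonneg C), ENNReal.ofReal_coe_nnreal]

lemma IsLipschitzCurve.continuousOn_integral {p : ℝ} (hp : 1 < p) {Ω : Set (Space d)}
    {μ : ℝ → Measure (Space d)} (h : IsLipschitzCurve p Ω μ) {φ : Space d → ℝ} {L : ℝ≥0}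
    (hφ : LipschitzWith L φ) {B : ℝ} (hB : ∀ x, |φ x| ≤ B) :
    ContinuousOn (fun t => ∫ x, φ x ∂(μ t)) (Icc 0 1) := by
  obtain ⟨C, hC0, hC⟩ := h.exists_wassersteinDist_le
  have hint : ∀ t ∈ Icc (0:ℝ) 1, Integrable φ (μ t) := fun t ht => by
    have := (h.mem t ht).isProb
    exact Integrable.of_bound hφ.continuous.aestronglyMeasurable B (ae_of_all _ hB)
  have hL : LipschitzOnWith (L * C.toNNReal) (fun t => ∫ x, φ x ∂(μ t)) (Icc 0 1) := by
    refine LipschitzOnWith.of_dist_le_mul fun s hs t ht => ?_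
    have := (h.mem s hs).isProb
    have := abs_integral_sub_integral_le hp (hint s hs) (hint t ht) (a := 0) L.2
      (mul_nonneg hC0 (abs_nonneg (s - t)))
      (fun x y => by simpa [dist_eq_norm] using hφ.dist_le_mul x y) (hC s hs t ht)
    rw [Real.dist_eq, Real.dist_eq, NNReal.coe_mul, Real.coe_toNNReal C hC0]
    simpa [mul_assoc] using this
  exact hL.continuousOn

/-- Indicators of closed sets are limits of Lipschitz thickened indicators, whose integrals are
continuous in t, and closed sets form a π-system generating the Borel sets. Times outside [0,1] are
clamped to it so that every slice is a probability measure. -/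
lemma IsLipschitzCurve.exists_kernel {p : ℝ} (hp : 1 < p) {Ω : Set (Space d)}
    {μ : ℝ → Measure (Space d)} (h : IsLipschitzCurve p Ω μ) :
    ∃ κ : ProbabilityTheory.Kernel ℝ (Space d), ProbabilityTheory.IsMarkovKernel κ ∧
      ∀ t ∈ Icc (0 : ℝ) 1, κ t = μ t := by
  have h01 : (0:ℝ) ≤ 1 := zero_le_one
  let c : ℝ → ℝ := fun t => projIcc 0 1 h01 t
  have hc : ∀ t, c t ∈ Icc (0:ℝ) 1 := fun t => (projIcc 0 1 h01 t).2
  have hprob : ∀ t, IsProbabilityMeasure (μ (c t)) := fun t => (h.mem _ (hc t)).isProb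
  have hm : Measurable (fun t => μ (c t)) := by
    refine Measurable.measure_of_isPiSystem_of_isProbabilityMeasure
      (S := {s : Set (Space d) | IsClosed s})
      (by rw [← borel_eq_generateFrom_isClosed]; exact BorelSpace.measurable_eq)
      isPiSystem_isClosed fun F hF => ?_
    obtain ⟨δ, -, hδ, hδ0⟩ := exists_seq_strictAnti_tendsto (0:ℝ)
    have key := fun t => tendsto_lintegral_thickenedIndicator_of_isClosed (μ (c t)) hF hδ hδ0
    refine measurable_of_tendsto_metrizable (fun n => ?_) (tendsto_pi_nhds.2 key)
    have hb : ∀ x, |((thickenedIndicator (hδ n) F x : ℝ≥0) : ℝ)| ≤ 1 := fun x => by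
      rw [abs_of_nonneg (NNReal.coe_nonneg _)]
      exact_mod_cast thickenedIndicator_le_one (hδ n) F x
    have hl := lipschitzWith_thickenedIndicator (hδ n) F
    have hl2 : LipschitzWith (δ n).toNNReal⁻¹
        (fun x => ((thickenedIndicator (hδ n) F x : ℝ≥0) : ℝ)) := fun x y => hl x y
    have hcont := h.continuousOn_integral hp hl2 hb
    have hcont2 : Continuous (fun t => ∫ x, ((thickenedIndicator (hδ n) F x : ℝ≥0) : ℝ) ∂(μ (c t))) :=
      hcont.comp_continuous (continuous_subtype_val.comp continuous_projIcc) hc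
    have heq : (fun t => ∫⁻ x, (thickenedIndicator (hδ n) F x : ℝ≥0∞) ∂(μ (c t)))
        = fun t => ENNReal.ofReal
          (∫ x, ((thickenedIndicator (hδ n) F x : ℝ≥0) : ℝ) ∂(μ (c t))) := by
      funext t
      rw [ofReal_integral_eq_lintegral_ofReal]
      · simp
      · exact Integrable.of_bound hl2.continuous.aestronglyMeasurable 1 (ae_of_all _ hb)
      · exact ae_of_all _ fun x => NNReal.coe_nonneg _
    rw [heq]
    exact hcont2.measurable.ennreal_ofReal
  refine ⟨⟨fun t => μ (c t), hm⟩, ⟨fun t => hprob t⟩, fun t ht => ?_⟩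
  change μ (c t) = μ t
  simp only [c, projIcc_of_mem h01 ht]

end CurveKernel

/-! ### The continuity equation for time-dependent test functions -/

section TimeDependent

open Filter Topology

/-- The comparison function m' may change with ε. Here m' will be the integral of a test function
frozen at a time near t, and c the contribution of its explicit time derivative. -/
lemma hasDerivAt_of_forall_approx {m : ℝ → ℝ} {f c t : ℝ}
    (h : ∀ ε > 0, ∃ (m' : ℝ → ℝ) (f' : ℝ), HasDerivAt m' f' t ∧ |f - f' - c| ≤ ε ∧
      ∀ᶠ s in 𝓝 t, |m s - m' s - (m t - m' t) - (s - t) * c| ≤ ε * |s - t|) :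
    HasDerivAt m f t := by
  rw [hasDerivAt_iff_isLittleO, Asymptotics.isLittleO_iff]
  intro ε hε
  obtain ⟨m', f', hm', hf, hs⟩ := h (ε / 3) (by positivity)
  rw [hasDerivAt_iff_isLittleO, Asymptotics.isLittleO_iff] at hm'
  filter_upwards [hs, hm' (by positivity : (0:ℝ) < ε / 3)] with s h1 h2
  simp only [smul_eq_mul, Real.norm_eq_abs] at h2 ⊢
  have h3 : |(s - t) * (f - f' - c)| ≤ |s - t| * (ε / 3) := by rw [abs_mul]; gcongr
  calc |m s - m t - (s - t) * f| = |(m s - m' s - (m t - m' t) - (s - t) * c)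
        + (m' s - m' t - (s - t) * f') - (s - t) * (f - f' - c)| := by congr 1; ring
    _ ≤ |m s - m' s - (m t - m' t) - (s - t) * c| + |m' s - m' t - (s - t) * f'|
        + |(s - t) * (f - f' - c)| := by
        refine (abs_sub _ _).trans ?_
        gcongr
        exact abs_add_le _ _
    _ ≤ ε / 3 * |s - t| + ε / 3 * |s - t| + |s - t| * (ε / 3) := by gcongr
    _ = ε * |s - t| := by ring

lemma IsVelocityField.ae_hasDerivAt {p : ℝ} {μ : ℝ → Measure (Space d)}
    {v : ℝ → Space d → Space d} (hv : IsVelocityField p μ v) {φ : Space d → ℝ}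
    (hφ : ContDiff ℝ 1 φ) (hc : HasCompactSupport φ) :
    ∀ᵐ t ∂(volume.restrict (Icc (0 : ℝ) 1)),
      HasDerivAt (fun s => ∫ x, φ x ∂(μ s)) (∫ x, fderiv ℝ φ x (v t x) ∂(μ t)) t := by
  have hint : IntervalIntegrable (fun s => ∫ x, fderiv ℝ φ x (v s x) ∂(μ s)) volume 0 1 := by
    rw [intervalIntegrable_iff_integrableOn_Icc_of_le zero_le_one]
    exact hv.integrable _ hφ hc
  have := hint.ae_hasDerivAt_integral
  rw [← restrict_Ioo_eq_restrict_Icc, ae_restrict_iff' measurableSet_Ioo]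
  filter_upwards [this] with t ht htI
  have h2 := ht (by rw [uIcc_of_le zero_le_one]; exact Ioo_subset_Icc_self htI) 0
    (by rw [uIcc_of_le zero_le_one]; simp)
  have h3 := h2.const_add (∫ x, φ x ∂(μ 0))
  refine h3.congr_of_eventuallyEq ?_
  filter_upwards [Ioo_mem_nhds htI.1 htI.2] with s hs
  have := hv.continuity_eq _ hφ hc 0 (by simp) s (Ioo_subset_Icc_self hs) hs.1
  linarith

/-- Test functions depending on time whose derivative is bounded and uniformly continuous. -/
structure IsTimeTest (ψ : ℝ × Space d → ℝ) : Prop where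
  contDiff : ContDiff ℝ 1 ψ
  bounded : ∃ B : ℝ, ∀ z, ‖fderiv ℝ ψ z‖ ≤ B
  uniformContinuous : UniformContinuous (fderiv ℝ ψ)
  hasCompactSupport : ∀ t, HasCompactSupport fun x => ψ (t, x)

namespace IsTimeTest

variable {ψ : ℝ × Space d → ℝ}

lemma differentiable (h : IsTimeTest ψ) : Differentiable ℝ ψ := h.contDiff.differentiable one_ne_zero

lemma slice_contDiff (h : IsTimeTest ψ) (r : ℝ) : ContDiff ℝ 1 fun x => ψ (r, x) :=
  h.contDiff.comp (contDiff_const.prodMk contDiff_id)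

lemma slice_hasFDerivAt (h : IsTimeTest ψ) (r : ℝ) (x : Space d) :
    HasFDerivAt (fun x => ψ (r, x)) ((fderiv ℝ ψ (r, x)).comp (ContinuousLinearMap.inr ℝ ℝ (Space d)))
      x :=
  (h.differentiable (r, x)).hasFDerivAt.comp x (hasFDerivAt_prodMk_right r x)

lemma fderiv_slice (h : IsTimeTest ψ) (r : ℝ) (x w : Space d) :
    fderiv ℝ (fun x => ψ (r, x)) x w = fderiv ℝ ψ (r, x) (0, w) := by
  rw [(h.slice_hasFDerivAt r x).fderiv]; simp

lemma integrable_slice (h : IsTimeTest ψ) (r : ℝ) (ν : Measure (Space d)) [IsFiniteMeasure ν] :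
    Integrable (fun x => ψ (r, x)) ν :=
  (h.slice_contDiff r).continuous.integrable_of_hasCompactSupport (h.hasCompactSupport r)

lemma continuous_fderiv (h : IsTimeTest ψ) : Continuous (fderiv ℝ ψ) :=
  h.uniformContinuous.continuous

lemma integrable_fderiv_apply (h : IsTimeTest ψ) (r : ℝ) (a : ℝ) {ν : Measure (Space d)}
    [IsFiniteMeasure ν] {w : Space d → Space d} (hw : Integrable w ν) :
    Integrable (fun x => fderiv ℝ ψ (r, x) (a, w x)) ν := by
  obtain ⟨B, hB⟩ := h.bounded
  have h1 : Continuous fun q : (ℝ × Space d →L[ℝ] ℝ) × (ℝ × Space d) => q.1 q.2 :=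
    isBoundedBilinearMap_apply.continuous
  have hc : Continuous fun x : Space d => fderiv ℝ ψ (r, x) :=
    h.continuous_fderiv.comp (Continuous.prodMk_right r)
  refine Integrable.mono' (((integrable_const |a|).add hw.norm).const_mul B)
    (h1.comp_aestronglyMeasurable (hc.aestronglyMeasurable.prodMk
      (aestronglyMeasurable_const.prodMk hw.aestronglyMeasurable))) (ae_of_all _ fun x => ?_)
  calc ‖fderiv ℝ ψ (r, x) (a, w x)‖ ≤ ‖fderiv ℝ ψ (r, x)‖ * ‖(a, w x)‖ :=
        ContinuousLinearMap.le_opNorm _ _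
    _ ≤ B * (|a| + ‖w x‖) := by
        gcongr
        · exact (norm_nonneg _).trans (hB (r, x))
        · exact hB _
        · exact max_le (by simp) (by simp)

lemma abs_sub_le (h : IsTimeTest ψ) {B : ℝ} (hB : ∀ z, ‖fderiv ℝ ψ z‖ ≤ B) (z z' : ℝ × Space d) :
    |ψ z - ψ z'| ≤ B * ‖z - z'‖ := by
  have := Convex.norm_image_sub_le_of_norm_fderiv_le (𝕜 := ℝ) (f := ψ) (s := univ) (C := B)
    (fun x _ => h.differentiable x) (fun x _ => hB x) convex_univ (mem_univ z') (mem_univ z)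
  simpa using this

lemma lipschitzOnWith_integral {p : ℝ} (hp : 1 < p) {Ω : Set (Space d)}
    {μ : ℝ → Measure (Space d)} (hμ : IsLipschitzCurve p Ω μ) (h : IsTimeTest ψ) :
    ∃ K, LipschitzOnWith K (fun t => ∫ x, ψ (t, x) ∂(μ t)) (Icc 0 1) := by
  obtain ⟨B, hB⟩ := h.bounded
  have hB0 : 0 ≤ B := (norm_nonneg _).trans (hB (0, 0))
  obtain ⟨C, hC0, hC⟩ := hμ.exists_wassersteinDist_le
  refine ⟨(B + B * C).toNNReal, LipschitzOnWith.of_dist_le_mul fun s hs t ht => ?_⟩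
  have i1 := (hμ.mem s hs).isProb
  have i2 := (hμ.mem t ht).isProb
  have := abs_integral_sub_integral_le hp (h.integrable_slice s (μ s)) (h.integrable_slice t (μ t))
    (a := B * |s - t|) hB0 (mul_nonneg hC0 (abs_nonneg (s - t)))
    (fun x y => by
      refine (h.abs_sub_le hB (s, x) (t, y)).trans ?_
      rw [← mul_add]
      gcongr
      exact max_le (by simp) (by simp)) (hC s hs t ht)
  rw [Real.dist_eq, Real.dist_eq, Real.coe_toNNReal _ (by positivity)]
  linarith

/-- Compare ψ(s,·) with ψ(r,·) for r close to t. The frozen slice is differentiable along the curve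
by `hr`. The difference ψ(t,·) - ψ(r,·) has a small spatial gradient, so moving the measure by a
distance of order |s - t| changes its integral by o(1)|s - t|, while the explicit time dependence
contributes (s - t)∫ ∂_tψ. Rational r suffice, so only countably many slices enter. -/
lemma hasDerivAt_integral {p : ℝ} (hp : 1 < p) {Ω : Set (Space d)}
    {μ : ℝ → Measure (Space d)} (hμ : IsLipschitzCurve p Ω μ) (h : IsTimeTest ψ)
    {t : ℝ} (ht : t ∈ Ioo (0:ℝ) 1) {w : Space d → Space d} (hw : Integrable w (μ t))
    (hr : ∀ r : ℚ, HasDerivAt (fun s => ∫ x, ψ ((r : ℝ), x) ∂(μ s))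
      (∫ x, fderiv ℝ (fun x => ψ ((r : ℝ), x)) x (w x) ∂(μ t)) t) :
    HasDerivAt (fun s => ∫ x, ψ (s, x) ∂(μ s)) (∫ x, fderiv ℝ ψ (t, x) (1, w x) ∂(μ t)) t := by
  obtain ⟨B, hB⟩ := h.bounded
  have hB0 : 0 ≤ B := (norm_nonneg _).trans (hB (0, 0))
  obtain ⟨C, hC0, hC⟩ := hμ.exists_wassersteinDist_le
  have htI : t ∈ Icc (0:ℝ) 1 := Ioo_subset_Icc_self ht
  have it := (hμ.mem t htI).isProb
  set N : ℝ := ∫ x, ‖w x‖ ∂(μ t)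
  have hN : 0 ≤ N := integral_nonneg fun _ => norm_nonneg _
  have hd0 : Integrable (fun y => fderiv ℝ ψ (t, y) (1, 0)) (μ t) :=
    h.integrable_fderiv_apply t 1 (w := fun _ => 0) (integrable_zero _ _ _)
  refine hasDerivAt_of_forall_approx (c := ∫ y, fderiv ℝ ψ (t, y) (1, 0) ∂(μ t)) fun ε hε => ?_
  -- In the increment, two η come from `hbound`, one from the term with K, and C η from transporting
  -- the small gradient; N η bounds the error in the derivative.
  set η : ℝ := ε / (3 + C + N)
  have hden : 0 < 3 + C + N := by positivity
  have hη : 0 < η := by positivity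
  have hηε : η * (3 + C + N) = ε := div_mul_cancel₀ _ hden.ne'
  obtain ⟨δ, hδ, hucδ⟩ := Metric.uniformContinuous_iff.1 h.uniformContinuous η hη
  have huc : ∀ z z' : ℝ × Space d, ‖z - z'‖ < δ → ‖fderiv ℝ ψ z - fderiv ℝ ψ z'‖ ≤ η :=
    fun z z' hz => by
      have := hucδ (a := z) (b := z') (by rwa [dist_eq_norm])
      rw [dist_eq_norm] at this; exact this.le
  obtain ⟨r, hr1, hr2⟩ := exists_rat_btwn (show t - δ < t by linarith)
  have hrt : ∀ x : Space d, ‖(t, x) - ((r : ℝ), x)‖ < δ := fun x => by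
    simp only [Prod.mk_sub_mk, sub_self, Prod.norm_mk, norm_zero]
    refine max_lt ?_ hδ
    rw [Real.norm_eq_abs, abs_of_pos (by linarith)]; linarith
  refine ⟨_, _, hr r, ?_, ?_⟩
  · have e : ∀ x, fderiv ℝ ψ (t, x) (1, w x) - fderiv ℝ (fun x => ψ ((r:ℝ), x)) x (w x)
        - fderiv ℝ ψ (t, x) (1, 0) = (fderiv ℝ ψ (t, x) - fderiv ℝ ψ ((r:ℝ), x)) (0, w x) := by
      intro x
      rw [h.fderiv_slice, sub_apply]
      have : ((1 : ℝ), w x) = (1, 0) + (0, w x) := by simp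
      rw [this, map_add]; ring
    have i1 := h.integrable_fderiv_apply t 1 hw
    have i2 : Integrable (fun x => fderiv ℝ (fun x => ψ ((r:ℝ), x)) x (w x)) (μ t) := by
      simp_rw [h.fderiv_slice]; exact h.integrable_fderiv_apply r 0 hw
    have i3 : Integrable (fun x => fderiv ℝ ψ (t, x) (1, w x)
        - fderiv ℝ (fun x => ψ ((r:ℝ), x)) x (w x)) (μ t) := i1.sub i2
    rw [← integral_sub i1 i2, ← integral_sub i3 hd0]
    simp_rw [e]
    calc |∫ x, (fderiv ℝ ψ (t, x) - fderiv ℝ ψ ((r:ℝ), x)) (0, w x) ∂(μ t)|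
        ≤ ∫ x, η * ‖w x‖ ∂(μ t) := by
          rw [← Real.norm_eq_abs]
          refine norm_integral_le_of_norm_le (hw.norm.const_mul η) (ae_of_all _ fun x => ?_)
          calc ‖(fderiv ℝ ψ (t, x) - fderiv ℝ ψ ((r:ℝ), x)) (0, w x)‖
              ≤ ‖fderiv ℝ ψ (t, x) - fderiv ℝ ψ ((r:ℝ), x)‖ * ‖((0 : ℝ), w x)‖ :=
                ContinuousLinearMap.le_opNorm _ _
            _ ≤ η * ‖w x‖ := by
                gcongr
                · exact huc _ _ (hrt x)
                · simp
      _ = η * N := integral_const_mul _ _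
      _ ≤ ε := by rw [← hηε]; gcongr; linarith
  -- With this K, the oscillation of the derivative between (t,x) and (t,y) is at most η + K‖x - y‖:
  -- uniform continuity covers ‖x - y‖ < δ, and otherwise K‖x - y‖ ≥ 2B. This affine bound is what
  -- integration over a plan can use.
  · set K : ℝ := 2 * B / δ
    have hK : 0 ≤ K := by positivity
    have hev : ∀ᶠ s in 𝓝 t, s ∈ Icc (0:ℝ) 1 ∧ |s - t| < δ ∧ K * (C * |s - t|) < η := by
      have c1 : ∀ᶠ s in 𝓝 t, s ∈ Icc (0:ℝ) 1 := Icc_mem_nhds ht.1 ht.2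
      have c2 : ∀ᶠ s in 𝓝 t, |s - t| < δ :=
        ContinuousAt.eventually_lt (by fun_prop) continuousAt_const (by simpa using hδ)
      have c3 : ∀ᶠ s in 𝓝 t, K * (C * |s - t|) < η :=
        ContinuousAt.eventually_lt (by fun_prop) continuousAt_const (by simpa using hη)
      exact c1.and (c2.and c3)
    filter_upwards [hev] with s ⟨hsI, hsδ, hsK⟩
    have is := (hμ.mem s hsI).isProb
    have hG : Integrable (fun x => ψ (s, x) - ψ ((r:ℝ), x)) (μ s) :=
      (h.integrable_slice s _).sub (h.integrable_slice r _)
    have hH0 : Integrable (fun y => ψ (t, y) - ψ ((r:ℝ), y)) (μ t) :=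
      (h.integrable_slice t _).sub (h.integrable_slice r _)
    have hH : Integrable (fun y => (ψ (t, y) - ψ ((r:ℝ), y)) + (s - t) * fderiv ℝ ψ (t, y) (1, 0))
        (μ t) := hH0.add (hd0.const_mul _)
    have hbound : ∀ x y, |(ψ (s, x) - ψ ((r:ℝ), x))
        - ((ψ (t, y) - ψ ((r:ℝ), y)) + (s - t) * fderiv ℝ ψ (t, y) (1, 0))|
        ≤ 2 * η * |s - t| + (|s - t| * K + η) * ‖x - y‖ := by
      intro x y
      have b1 : |ψ (s, x) - ψ (t, x) - (s - t) * fderiv ℝ ψ (t, x) (1, 0)| ≤ η * |s - t| := by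
        have := (convex_ball (t, x) δ).norm_image_sub_le_of_norm_fderiv_le' (𝕜 := ℝ) (f := ψ)
          (C := η) (φ := fderiv ℝ ψ (t, x)) (x := (t, x)) (y := (s, x))
          (fun z _ => h.differentiable z)
          (fun z hz => huc _ _ (by simpa [dist_eq_norm] using hz))
          (Metric.mem_ball_self hδ) (by simp [dist_eq_norm, Prod.norm_def, hsδ])
        have e : ((s, x) - (t, x) : ℝ × Space d) = (s - t) • (1, 0) := by simp
        rw [e, map_smul, smul_eq_mul, norm_smul] at this
        simpa [Prod.norm_def] using this
      have b2 : |(s - t) * (fderiv ℝ ψ (t, x) (1, 0) - fderiv ℝ ψ (t, y) (1, 0))|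
          ≤ |s - t| * (η + K * ‖x - y‖) := by
        rw [abs_mul]
        gcongr
        have b3 : |fderiv ℝ ψ (t, x) (1, 0) - fderiv ℝ ψ (t, y) (1, 0)|
            ≤ ‖fderiv ℝ ψ (t, x) - fderiv ℝ ψ (t, y)‖ := by
          have := (fderiv ℝ ψ (t, x) - fderiv ℝ ψ (t, y)).le_opNorm (1, 0)
          simpa [Prod.norm_def] using this
        refine b3.trans ?_
        by_cases hxy : ‖x - y‖ < δ
        · have := huc (t, x) (t, y) (by simp [Prod.norm_def, hxy])
          have := mul_nonneg hK (norm_nonneg (x - y))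
          linarith
        · have b4 : 2 * B ≤ K * ‖x - y‖ := by
            calc 2 * B = K * δ := (div_mul_cancel₀ _ hδ.ne').symm
              _ ≤ _ := by gcongr; exact not_lt.1 hxy
          have := norm_sub_le (fderiv ℝ ψ (t, x)) (fderiv ℝ ψ (t, y))
          have := hB (t, x)
          have := hB (t, y)
          linarith
      have b5 : |(ψ (t, x) - ψ ((r:ℝ), x)) - (ψ (t, y) - ψ ((r:ℝ), y))| ≤ η * ‖x - y‖ := by
        have := convex_univ.norm_image_sub_le_of_norm_hasFDerivWithin_le (𝕜 := ℝ)
          (f := fun x => ψ (t, x) - ψ ((r:ℝ), x)) (C := η) (x := y) (y := x)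
          (fun z _ => ((h.slice_hasFDerivAt t z).sub (h.slice_hasFDerivAt r z)).hasFDerivWithinAt)
          (fun z _ => by
            rw [← ContinuousLinearMap.sub_comp]
            refine (ContinuousLinearMap.opNorm_comp_le _ _).trans ?_
            have := ContinuousLinearMap.norm_inr_le_one ℝ ℝ (Space d)
            calc _ ≤ η * 1 := by
                  gcongr
                  exact huc _ _ (hrt z)
              _ = η := mul_one _) (mem_univ _) (mem_univ _)
        simpa using this
      calc |(ψ (s, x) - ψ ((r:ℝ), x))
        - ((ψ (t, y) - ψ ((r:ℝ), y)) + (s - t) * fderiv ℝ ψ (t, y) (1, 0))|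
          = |(ψ (s, x) - ψ (t, x) - (s - t) * fderiv ℝ ψ (t, x) (1, 0))
            + (s - t) * (fderiv ℝ ψ (t, x) (1, 0) - fderiv ℝ ψ (t, y) (1, 0))
            + ((ψ (t, x) - ψ ((r:ℝ), x)) - (ψ (t, y) - ψ ((r:ℝ), y)))| := by
            congr 1; ring
        _ ≤ η * |s - t| + |s - t| * (η + K * ‖x - y‖) + η * ‖x - y‖ :=
            (abs_add_three _ _ _).trans (by gcongr)
        _ = _ := by ring
    have key := abs_integral_sub_integral_le hp hG hH
      (add_nonneg (mul_nonneg (abs_nonneg (s - t)) hK) hη.le)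
      (mul_nonneg hC0 (abs_nonneg (s - t))) hbound (hC s hsI t htI)
    rw [integral_sub (h.integrable_slice s _) (h.integrable_slice r _),
      integral_add hH0 (hd0.const_mul _),
      integral_sub (h.integrable_slice t _) (h.integrable_slice r _), integral_const_mul] at key
    rw [sub_sub]
    refine key.trans ?_
    rw [← hηε]
    have : |s - t| * (K * (C * |s - t|)) ≤ |s - t| * η := by gcongr
    have : 0 ≤ η * |s - t| * N := by positivity
    nlinarith

lemma ae_hasDerivAt {p : ℝ} (hp : 1 < p) {Ω : Set (Space d)} {μ : ℝ → Measure (Space d)}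
    (hμ : IsLipschitzCurve p Ω μ) {v : ℝ → Space d → Space d} (hv : IsVelocityField p μ v)
    (h : IsTimeTest ψ) :
    ∀ᵐ t ∂(volume.restrict (Icc (0 : ℝ) 1)),
      HasDerivAt (fun s => ∫ x, ψ (s, x) ∂(μ s)) (∫ x, fderiv ℝ ψ (t, x) (1, v t x) ∂(μ t)) t := by
  -- The exceptional null set of the continuity equation depends on the test function; for countably
  -- many slices a single one serves.
  have h1 : ∀ᵐ t ∂(volume.restrict (Icc (0 : ℝ) 1)), ∀ r : ℚ,
      HasDerivAt (fun s => ∫ x, ψ ((r : ℝ), x) ∂(μ s))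
        (∫ x, fderiv ℝ (fun x => ψ ((r : ℝ), x)) x (v t x) ∂(μ t)) t := by
    rw [ae_all_iff]
    exact fun r => hv.ae_hasDerivAt (h.slice_contDiff r) (h.hasCompactSupport r)
  have hne : ∀ᵐ t ∂(volume.restrict (Icc (0 : ℝ) 1)), t ∈ Ioo (0:ℝ) 1 := by
    rw [← restrict_Ioo_eq_restrict_Icc]
    exact ae_restrict_mem measurableSet_Ioo
  filter_upwards [h1, hne, hv.memLp] with t ht htI hLp
  have := (hμ.mem t (Ioo_subset_Icc_self htI)).isProb
  exact h.hasDerivAt_integral hp hμ htI (hLp.integrable (by simpa using hp.le)) ht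

/-- The integral of ψ along the curve is Lipschitz in time, hence the integral of its a.e.
derivative, which `ae_hasDerivAt` identifies. -/
lemma integrableOn_and_integral_eq {p : ℝ} (hp : 1 < p) {Ω : Set (Space d)}
    {μ : ℝ → Measure (Space d)} (hμ : IsLipschitzCurve p Ω μ) {v : ℝ → Space d → Space d}
    (hv : IsVelocityField p μ v) (h : IsTimeTest ψ) :
    IntegrableOn (fun t => ∫ x, fderiv ℝ ψ (t, x) (1, v t x) ∂(μ t)) (Icc (0 : ℝ) 1) ∧
    ∀ t₁ ∈ Icc (0 : ℝ) 1, ∀ t₂ ∈ Icc (0 : ℝ) 1, t₁ < t₂ →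
      ∫ x, ψ (t₂, x) ∂(μ t₂) - ∫ x, ψ (t₁, x) ∂(μ t₁)
        = ∫ s in t₁..t₂, ∫ x, fderiv ℝ ψ (s, x) (1, v s x) ∂(μ s) := by
  have hae := h.ae_hasDerivAt hp hμ hv
  obtain ⟨K, hK⟩ := h.lipschitzOnWith_integral hp hμ
  set m : ℝ → ℝ := fun t => ∫ x, ψ (t, x) ∂(μ t)
  have hac : ∀ t₁ ∈ Icc (0 : ℝ) 1, ∀ t₂ ∈ Icc (0 : ℝ) 1, AbsolutelyContinuousOnInterval m t₁ t₂ :=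
    fun t₁ h₁ t₂ h₂ => (hK.mono (uIcc_subset_Icc h₁ h₂)).absolutelyContinuousOnInterval
  have heq : deriv m =ᵐ[volume.restrict (Icc (0 : ℝ) 1)]
      fun t => ∫ x, fderiv ℝ ψ (t, x) (1, v t x) ∂(μ t) := hae.mono fun t ht => ht.deriv
  constructor
  · have := (hac 0 (by simp) 1 (by simp)).intervalIntegrable_deriv
    rw [intervalIntegrable_iff_integrableOn_Icc_of_le zero_le_one] at this
    exact this.congr heq
  · intro t₁ h₁ t₂ h₂ _
    rw [← (hac t₁ h₁ t₂ h₂).integral_deriv_eq_sub]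
    refine intervalIntegral.integral_congr_ae ?_
    rw [Filter.EventuallyEq, ae_restrict_iff' measurableSet_Icc] at heq
    filter_upwards [heq] with t ht htI
    exact ht (uIcc_subset_Icc h₁ h₂ (uIoc_subset_uIcc htI))

end IsTimeTest

end TimeDependent

/-! ### Uniform convexity of L^p and elements of least norm -/

section UniformConvexity

open Filter Topology

/-- A quantitative form of uniform convexity for the `p`-th power of the norm. -/
def UniformlyConvexPow (p : ℝ) (X : Type*) [NormedAddCommGroup X] [NormedSpace ℝ X] : Prop :=
  ∀ η > 0, ∃ c : ℝ, 0 ≤ c ∧ ∀ a b : X, ‖a - b‖ ^ p ≤ η * (‖a‖ ^ p + ‖b‖ ^ p)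
    + c * ((‖a‖ ^ p + ‖b‖ ^ p) / 2 - ‖(1 / 2 : ℝ) • (a + b)‖ ^ p)

lemma norm_half_add_le {X : Type*} [NormedAddCommGroup X] [NormedSpace ℝ X] (a b : X) :
    ‖(1 / 2 : ℝ) • (a + b)‖ ≤ (1 / 2) * ‖a‖ + (1 / 2) * ‖b‖ := by
  rw [norm_smul, Real.norm_of_nonneg (by norm_num), ← mul_add]
  gcongr
  exact norm_add_le a b

lemma rpow_norm_half_add_le {p : ℝ} (hp : 1 < p) {X : Type*} [NormedAddCommGroup X]
    [NormedSpace ℝ X] (a b : X) :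
    ‖(1 / 2 : ℝ) • (a + b)‖ ^ p ≤ (‖a‖ ^ p + ‖b‖ ^ p) / 2 := by
  have h1 := (convexOn_rpow hp.le).2 (norm_nonneg a) (norm_nonneg b)
    (by norm_num : (0:ℝ) ≤ 1 / 2) (by norm_num : (0:ℝ) ≤ 1 / 2) (by norm_num)
  simp only [smul_eq_mul] at h1
  have h2 : ‖(1 / 2 : ℝ) • (a + b)‖ ^ p ≤ ((1 / 2) * ‖a‖ + (1 / 2) * ‖b‖) ^ p :=
    Real.rpow_le_rpow (norm_nonneg _) (norm_half_add_le a b) (by linarith)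
  linarith

lemma rpow_norm_half_add_lt {p : ℝ} (hp : 1 < p) {X : Type*} [NormedAddCommGroup X]
    [NormedSpace ℝ X] [StrictConvexSpace ℝ X] {a b : X} (hab : a ≠ b) :
    ‖(1 / 2 : ℝ) • (a + b)‖ ^ p < (‖a‖ ^ p + ‖b‖ ^ p) / 2 := by
  by_cases hn : ‖a‖ = ‖b‖
  · have h1 : ‖(1 / 2 : ℝ) • (a + b)‖ < ‖a‖ := (norm_midpoint_lt_iff hn).2 hab
    have h2 := Real.rpow_lt_rpow (norm_nonneg _) h1 (by linarith : 0 < p)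
    rw [← hn]; linarith
  · have h1 := (strictConvexOn_rpow hp).2 (norm_nonneg a) (norm_nonneg b) hn
      (by norm_num : (0:ℝ) < 1 / 2) (by norm_num : (0:ℝ) < 1 / 2) (by norm_num)
    simp only [smul_eq_mul] at h1
    have h2 : ‖(1 / 2 : ℝ) • (a + b)‖ ^ p ≤ ((1 / 2) * ‖a‖ + (1 / 2) * ‖b‖) ^ p :=
      Real.rpow_le_rpow (norm_nonneg _) (norm_half_add_le a b) (by linarith)
    linarith

/-- All terms are p-homogeneous, so one may take (a,b) on the unit sphere of X × X. There the pairs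
with ‖a - b‖^p ≥ η(‖a‖^p + ‖b‖^p) form a compact set on which the convexity deficit is positive by
strict convexity, hence at least some m > 0; since ‖a - b‖ ≤ 2 on the sphere, c = 2^p/m works. -/
lemma uniformlyConvexPow_of_proper {p : ℝ} (hp : 1 < p) (X : Type*) [NormedAddCommGroup X]
    [NormedSpace ℝ X] [StrictConvexSpace ℝ X] [ProperSpace X] : UniformlyConvexPow p X := by
  intro η hη
  have hp0 : 0 < p := by linarith
  let D : X × X → ℝ := fun z => (‖z.1‖ ^ p + ‖z.2‖ ^ p) / 2 - ‖(1 / 2 : ℝ) • (z.1 + z.2)‖ ^ p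
  have hcn : ∀ f : X × X → X, Continuous f → Continuous fun z => ‖f z‖ ^ p := fun f hf =>
    hf.norm.rpow_const fun _ => Or.inr hp0.le
  have hDc : Continuous D :=
    (((hcn _ continuous_fst).add (hcn _ continuous_snd)).div_const 2).sub
      (hcn _ ((continuous_fst.add continuous_snd).const_smul _))
  let T : Set (X × X) := Metric.sphere 0 1 ∩ {z | η * (‖z.1‖ ^ p + ‖z.2‖ ^ p) ≤ ‖z.1 - z.2‖ ^ p}
  have hT : IsCompact T := (isCompact_sphere 0 1).inter_right
    (isClosed_le (((hcn _ continuous_fst).add (hcn _ continuous_snd)).const_mul η)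
      (hcn _ (continuous_fst.sub continuous_snd)))
  have hpos : ∀ z ∈ T, 0 < D z := by
    rintro ⟨a, b⟩ ⟨hs, hle⟩
    have hab : a ≠ b := by
      rintro rfl
      simp only [mem_ofPred_eq, sub_self, norm_zero, Real.zero_rpow hp0.ne'] at hle
      have ha : ‖a‖ = 1 := by simpa [Prod.norm_def] using hs
      rw [ha, Real.one_rpow] at hle
      linarith
    have := rpow_norm_half_add_lt hp hab
    simp only [D]; linarith
  obtain ⟨m, hm0, hm⟩ : ∃ m > 0, ∀ z ∈ T, m ≤ D z := by
    rcases T.eq_empty_or_nonempty with h | h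
    · exact ⟨1, one_pos, by simp [h]⟩
    · obtain ⟨z, hz, hmin⟩ := hT.exists_isMinOn h hDc.continuousOn
      exact ⟨D z, hpos z hz, fun y hy => hmin hy⟩
  refine ⟨2 ^ p / m, by positivity, fun a b => ?_⟩
  have hD0 : 0 ≤ (‖a‖ ^ p + ‖b‖ ^ p) / 2 - ‖(1 / 2 : ℝ) • (a + b)‖ ^ p :=
    sub_nonneg.2 (rpow_norm_half_add_le hp a b)
  by_cases hle : η * (‖a‖ ^ p + ‖b‖ ^ p) ≤ ‖a - b‖ ^ p
  swap
  · have : 0 ≤ 2 ^ p / m * ((‖a‖ ^ p + ‖b‖ ^ p) / 2 - ‖(1 / 2 : ℝ) • (a + b)‖ ^ p) := by positivity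
    linarith [not_le.1 hle]
  by_cases hz : ((a, b) : X × X) = 0
  · obtain ⟨rfl, rfl⟩ := Prod.mk_eq_zero.1 hz
    simp [Real.zero_rpow hp0.ne']
  set r := ‖((a, b) : X × X)‖
  have hr : 0 < r := norm_pos_iff.2 hz
  have hscale : ∀ u : X, ‖r⁻¹ • u‖ ^ p = (r⁻¹) ^ p * ‖u‖ ^ p := fun u => by
    rw [norm_smul, Real.norm_of_nonneg (by positivity), Real.mul_rpow (by positivity) (norm_nonneg _)]
  have hri : 0 < (r⁻¹) ^ p := by positivity
  have hmem : (r⁻¹ • a, r⁻¹ • b) ∈ T := by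
    refine ⟨?_, ?_⟩
    · rw [← Prod.smul_mk, mem_sphere_zero_iff_norm, norm_smul, Real.norm_of_nonneg (by positivity)]
      exact inv_mul_cancel₀ hr.ne'
    · simp only [mem_ofPred_eq, ← smul_sub, hscale]
      nlinarith
  have hDm := hm _ hmem
  simp only [D, ← smul_add, smul_comm _ (r⁻¹), hscale] at hDm
  have hnorm : ‖a - b‖ ≤ 2 * r := by
    have h1 : ‖a‖ ≤ r := le_max_left _ _
    have h2 : ‖b‖ ≤ r := le_max_right _ _
    linarith [norm_sub_le a b]
  have h3 : ‖a - b‖ ^ p ≤ 2 ^ p * r ^ p := by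
    rw [← Real.mul_rpow (by norm_num) hr.le]
    exact Real.rpow_le_rpow (norm_nonneg _) hnorm hp0.le
  have h4 : m * r ^ p ≤ (‖a‖ ^ p + ‖b‖ ^ p) / 2 - ‖(1 / 2 : ℝ) • (a + b)‖ ^ p := by
    have h5 : (r⁻¹) ^ p * r ^ p = 1 := by
      rw [← Real.mul_rpow (by positivity) hr.le, inv_mul_cancel₀ hr.ne', Real.one_rpow]
    have h6 := mul_le_mul_of_nonneg_right hDm (by positivity : 0 ≤ r ^ p)
    refine h6.trans_eq ?_
    linear_combination ((‖a‖ ^ p + ‖b‖ ^ p) / 2 - ‖(1 / 2 : ℝ) • (a + b)‖ ^ p) * h5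
  have h7 : 2 ^ p * r ^ p
      ≤ 2 ^ p / m * ((‖a‖ ^ p + ‖b‖ ^ p) / 2 - ‖(1 / 2 : ℝ) • (a + b)‖ ^ p) := by
    rw [div_mul_eq_mul_div, le_div_iff₀ hm0]
    have : (0:ℝ) ≤ 2 ^ p := by positivity
    nlinarith
  have : 0 ≤ η * (‖a‖ ^ p + ‖b‖ ^ p) := by positivity
  linarith

/-- A minimizing sequence is Cauchy: midpoints stay in K, so their norms are at least the infimum
and the convexity deficit tends to zero. -/
lemma UniformlyConvexPow.exists_norm_le {p : ℝ} (hp : 1 < p) {X : Type*} [NormedAddCommGroup X]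
    [NormedSpace ℝ X] [CompleteSpace X] (h : UniformlyConvexPow p X) {K : Set X} (hK : IsClosed K)
    (hne : K.Nonempty) (hmid : ∀ a ∈ K, ∀ b ∈ K, (1 / 2 : ℝ) • (a + b) ∈ K) :
    ∃ f ∈ K, ∀ g ∈ K, ‖f‖ ≤ ‖g‖ := by
  have hp0 : 0 < p := by linarith
  let S : Set ℝ := norm '' K
  have hSb : BddBelow S := ⟨0, by rintro _ ⟨x, -, rfl⟩; exact norm_nonneg x⟩
  have hSne : S.Nonempty := hne.image _
  set m := sInf S
  have hm : ∀ g ∈ K, m ≤ ‖g‖ := fun g hg => csInf_le hSb ⟨g, hg, rfl⟩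
  have hm0 : 0 ≤ m := le_csInf hSne (by rintro _ ⟨x, -, rfl⟩; exact norm_nonneg x)
  obtain ⟨s, -, hs, hsS⟩ := exists_seq_tendsto_sInf hSne hSb
  choose f hfK hfs using hsS
  have hlim : Tendsto (fun n => ‖f n‖ ^ p) atTop (𝓝 (m ^ p)) := by
    simp_rw [hfs]
    exact hs.rpow_const (Or.inr hp0.le)
  have hcauchy : CauchySeq f := by
    refine Metric.cauchySeq_iff'.2 fun ε hε => ?_
    have hεp : 0 < ε ^ p := by positivity
    have hmp : 0 ≤ m ^ p := by positivity
    -- Late terms satisfy ‖f n‖^p ≤ m^p + 1, so this η makes the first term at most ε^p/2; the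
    -- threshold chosen next makes the deficit term at most ε^p/4.
    obtain ⟨c, hc0, hc⟩ := h (ε ^ p / (4 * (m ^ p + 1))) (by positivity)
    have hev : ∀ᶠ n in atTop, ‖f n‖ ^ p < m ^ p + min 1 (ε ^ p / (4 * (c + 1))) :=
      hlim.eventually_lt_const (by have : 0 < min 1 (ε ^ p / (4 * (c + 1))) := by positivity
                                   linarith)
    obtain ⟨N, hN⟩ := eventually_atTop.1 hev
    refine ⟨N, fun n hn => ?_⟩
    have h1 := hN n hn
    have h2 := hN N le_rfl
    have h3 : m ^ p ≤ ‖(1 / 2 : ℝ) • (f n + f N)‖ ^ p :=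
      Real.rpow_le_rpow hm0 (hm _ (hmid _ (hfK n) _ (hfK N))) hp0.le
    have h4 := hc (f n) (f N)
    have h5 := min_le_left 1 (ε ^ p / (4 * (c + 1)))
    have h6 := min_le_right 1 (ε ^ p / (4 * (c + 1)))
    have h7 : ε ^ p / (4 * (m ^ p + 1)) * (‖f n‖ ^ p + ‖f N‖ ^ p) ≤ ε ^ p / 2 := by
      calc _ ≤ ε ^ p / (4 * (m ^ p + 1)) * (2 * (m ^ p + 1)) := by gcongr; linarith
        _ = ε ^ p / 2 := by field_simp; ring
    have h8 : c * ((‖f n‖ ^ p + ‖f N‖ ^ p) / 2 - ‖(1 / 2 : ℝ) • (f n + f N)‖ ^ p) ≤ ε ^ p / 4 := by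
      calc _ ≤ c * (ε ^ p / (4 * (c + 1))) := by gcongr; linarith
        _ ≤ (c + 1) * (ε ^ p / (4 * (c + 1))) := by gcongr; linarith
        _ = ε ^ p / 4 := by field_simp
    rw [dist_eq_norm]
    refine lt_of_not_ge fun hge => ?_
    have := Real.rpow_le_rpow hε.le hge hp0.le
    linarith
  obtain ⟨f₀, hf₀⟩ := cauchySeq_tendsto_of_complete hcauchy
  refine ⟨f₀, hK.mem_of_tendsto hf₀ (Eventually.of_forall hfK), fun g hg => ?_⟩
  have : ‖f₀‖ = m := tendsto_nhds_unique hf₀.norm (by simpa [hfs] using hs)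
  rw [this]
  exact hm g hg

lemma norm_rpow_eq_integral {p : ℝ} (hp : 1 < p) {α : Type*} [MeasurableSpace α] {M : Measure α}
    {E : Type*} [NormedAddCommGroup E] (f : Lp E (ENNReal.ofReal p) M) :
    ‖f‖ ^ p = ∫ z, ‖f z‖ ^ p ∂M := by
  have hp0 : 0 < p := by linarith
  have h0 : ENNReal.ofReal p ≠ 0 := by simpa using hp0
  have hnn : 0 ≤ ∫ z, ‖f z‖ ^ p ∂M := integral_nonneg fun _ => by positivity
  rw [Lp.norm_def, (Lp.memLp f).eLpNorm_eq_integral_rpow_norm h0 ENNReal.ofReal_ne_top,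
    ENNReal.toReal_ofReal hp0.le, ENNReal.toReal_ofReal (by positivity), ← Real.rpow_mul hnn,
    inv_mul_cancel₀ hp0.ne', Real.rpow_one]

lemma integrable_norm_rpow_Lp {p : ℝ} (hp : 1 < p) {α : Type*} [MeasurableSpace α] {M : Measure α}
    {E : Type*} [NormedAddCommGroup E] (f : Lp E (ENNReal.ofReal p) M) :
    Integrable (fun z => ‖f z‖ ^ p) M := by
  have hp0 : 0 < p := by linarith
  have := (Lp.memLp f).integrable_norm_rpow (by simpa using hp0) ENNReal.ofReal_ne_top
  rwa [ENNReal.toReal_ofReal hp0.le] at this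

/-- The inequality is additive in p-th powers, so integrating it pointwise keeps the same η and c.
-/
lemma UniformlyConvexPow.lp {p : ℝ} (hp : 1 < p) {α : Type*} [MeasurableSpace α] (M : Measure α)
    {E : Type*} [NormedAddCommGroup E] [NormedSpace ℝ E] (h : UniformlyConvexPow p E)
    [Fact (1 ≤ ENNReal.ofReal p)] : UniformlyConvexPow p (Lp E (ENNReal.ofReal p) M) := by
  intro η hη
  obtain ⟨c, hc0, hc⟩ := h η hη
  refine ⟨c, hc0, fun f g => ?_⟩
  have If := integrable_norm_rpow_Lp hp f
  have Ig := integrable_norm_rpow_Lp hp g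
  have I1 := integrable_norm_rpow_Lp hp (f - g)
  have I2 := integrable_norm_rpow_Lp hp ((1 / 2 : ℝ) • (f + g))
  have I3 : Integrable (fun z => ‖f z‖ ^ p + ‖g z‖ ^ p) M := If.add Ig
  have I4 : Integrable (fun z => (‖f z‖ ^ p + ‖g z‖ ^ p) / 2) M := I3.div_const 2
  have I5 : Integrable (fun z => (‖f z‖ ^ p + ‖g z‖ ^ p) / 2
    - ‖((1 / 2 : ℝ) • (f + g)) z‖ ^ p) M := I4.sub I2
  rw [norm_rpow_eq_integral hp f, norm_rpow_eq_integral hp g, norm_rpow_eq_integral hp (f - g),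
    norm_rpow_eq_integral hp ((1 / 2 : ℝ) • (f + g)), ← integral_add If Ig, ← integral_const_mul,
    ← integral_div, ← integral_sub I4 I2, ← integral_const_mul,
    ← integral_add (I3.const_mul η) (I5.const_mul c)]
  refine integral_mono_ae I1 ((I3.const_mul η).add (I5.const_mul c)) ?_
  filter_upwards [Lp.coeFn_sub f g, Lp.coeFn_add f g, Lp.coeFn_smul (1 / 2 : ℝ) (f + g)]
    with z h1 h2 h3
  simp only [h1, h3, h2, Pi.sub_apply, Pi.smul_apply, Pi.add_apply]
  exact hc _ _

end UniformConvexity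

/-! ### Bounded linear pairings on L^p -/

section PairingFunctional

variable {α : Type*} [MeasurableSpace α] {E : Type*} [NormedAddCommGroup E] [NormedSpace ℝ E]

lemma integrable_clm_apply {M : Measure α} {L : α → E →L[ℝ] ℝ} (hL : StronglyMeasurable L) {B : ℝ}
    (hB : ∀ z, ‖L z‖ ≤ B) {f : α → E} (hf : Integrable f M) :
    Integrable (fun z => L z (f z)) M := by
  have h1 : Continuous fun q : (E →L[ℝ] ℝ) × E => q.1 q.2 :=
    isBoundedBilinearMap_apply.continuous
  refine Integrable.mono' (hf.norm.const_mul B)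
    (h1.comp_aestronglyMeasurable (hL.aestronglyMeasurable.prodMk hf.aestronglyMeasurable))
    (ae_of_all _ fun x => ?_)
  exact (ContinuousLinearMap.le_opNorm _ _).trans (by gcongr; exact hB _)

/-- Integration against a bounded field of linear forms, as a continuous functional on `L^p`. -/
lemma exists_pairing (M : Measure α) [IsFiniteMeasure M] (P : ℝ≥0∞) [hP : Fact (1 ≤ P)]
    {L : α → E →L[ℝ] ℝ} (hL : StronglyMeasurable L) {B : ℝ} (hB : ∀ z, ‖L z‖ ≤ B) (s : Set α) :
    ∃ T : Lp E P M →L[ℝ] ℝ, ∀ f, T f = ∫ z in s, L z (f z) ∂M := by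
  have hint : ∀ f : Lp E P M, Integrable (fun z => L z (f z)) (M.restrict s) := fun f =>
    (integrable_clm_apply hL hB ((Lp.memLp f).integrable hP.out)).restrict
  let T : Lp E P M →ₗ[ℝ] ℝ :=
    { toFun := fun f => ∫ z in s, L z (f z) ∂M
      map_add' := fun f g => by
        rw [← integral_add (hint f) (hint g)]
        refine integral_congr_ae (ae_restrict_of_ae ?_)
        filter_upwards [Lp.coeFn_add f g] with z hz
        rw [hz, Pi.add_apply, map_add]
      map_smul' := fun c f => by
        rw [RingHom.id_apply, smul_eq_mul, ← integral_const_mul]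
        refine integral_congr_ae (ae_restrict_of_ae ?_)
        filter_upwards [Lp.coeFn_smul c f] with z hz
        rw [hz, Pi.smul_apply, map_smul, smul_eq_mul] }
  set A : ℝ≥0∞ := M univ ^ (1 / (1 : ℝ≥0∞).toReal - 1 / P.toReal)
  have hA : A ≠ ⊤ := by
    refine ENNReal.rpow_ne_top_of_nonneg ?_ (measure_ne_top _ _)
    rcases eq_or_ne P ⊤ with rfl | hPt
    · simp
    · have : 1 ≤ P.toReal := by
        have := ENNReal.toReal_mono hPt hP.out
        simpa using this
      simp only [ENNReal.toReal_one, div_one, one_div, sub_nonneg]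
      exact inv_le_one_of_one_le₀ this
  have hbound : ∀ f : Lp E P M, ‖T f‖ ≤ |B| * A.toReal * ‖f‖ := by
    intro f
    have hf1 := (Lp.memLp f).integrable hP.out
    have h1 : eLpNorm f 1 M ≤ eLpNorm f P M * A :=
      eLpNorm_le_eLpNorm_mul_rpow_measure_univ hP.out (Lp.aestronglyMeasurable f)
    calc ‖T f‖ ≤ ∫ z in s, |B| * ‖f z‖ ∂M := by
          refine norm_integral_le_of_norm_le (hf1.norm.const_mul _).restrict
            (ae_of_all _ fun z => (ContinuousLinearMap.le_opNorm _ _).trans ?_)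
          gcongr
          exact (hB z).trans (le_abs_self B)
      _ ≤ ∫ z, |B| * ‖f z‖ ∂M :=
          setIntegral_le_integral (hf1.norm.const_mul _) (ae_of_all _ fun z => by positivity)
      _ = |B| * (eLpNorm f 1 M).toReal := by
          rw [integral_const_mul, integral_norm_eq_lintegral_enorm hf1.aestronglyMeasurable,
            eLpNorm_one_eq_lintegral_enorm]
      _ ≤ |B| * (eLpNorm f P M * A).toReal := by
          gcongr
          exact ENNReal.mul_ne_top (Lp.eLpNorm_ne_top f) hA
      _ = _ := by rw [ENNReal.toReal_mul, Lp.norm_def]; ring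
  exact ⟨T.mkContinuous _ hbound, fun f => rfl⟩

end PairingFunctional

/-! ### Existence of the tangent field -/

section TangentExistence

open ProbabilityTheory

variable {p : ℝ} {μ : ℝ → Measure (Space d)}

lemma IsVelocityField.congr {w v : ℝ → Space d → Space d} (hw : IsVelocityField p μ w)
    (hm : Measurable (Function.uncurry v))
    (hLp : ∀ᵐ t ∂(volume.restrict (Icc (0 : ℝ) 1)), MemLp (v t) (ENNReal.ofReal p) (μ t))
    (h : ∀ φ : Space d → ℝ, ContDiff ℝ 1 φ → HasCompactSupport φ →
      ∀ᵐ t ∂(volume.restrict (Icc (0 : ℝ) 1)),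
        ∫ x, fderiv ℝ φ x (w t x) ∂(μ t) = ∫ x, fderiv ℝ φ x (v t x) ∂(μ t)) :
    IsVelocityField p μ v where
  measurable := hm
  memLp := hLp
  integrable φ hφ hc := (hw.integrable φ hφ hc).congr (h φ hφ hc)
  continuity_eq φ hφ hc t₁ h₁ t₂ h₂ hlt := by
    rw [hw.continuity_eq φ hφ hc t₁ h₁ t₂ h₂ hlt]
    refine intervalIntegral.integral_congr_ae ?_
    have := h φ hφ hc
    rw [ae_restrict_iff' measurableSet_Icc] at this
    filter_upwards [this] with t ht htI
    exact ht (uIcc_subset_Icc h₁ h₂ (uIoc_subset_uIcc htI))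

lemma IsVelocityField.ae_integral_eq {w v : ℝ → Space d → Space d} (hw : IsVelocityField p μ w)
    (hv : IsVelocityField p μ v) {φ : Space d → ℝ} (hφ : ContDiff ℝ 1 φ)
    (hc : HasCompactSupport φ) :
    ∀ᵐ t ∂(volume.restrict (Icc (0 : ℝ) 1)),
      ∫ x, fderiv ℝ φ x (w t x) ∂(μ t) = ∫ x, fderiv ℝ φ x (v t x) ∂(μ t) := by
  filter_upwards [hw.ae_hasDerivAt hφ hc, hv.ae_hasDerivAt hφ hc] with t h1 h2
  exact h1.unique h2

lemma memLp_iff_kinetic_lt_top (hp : 1 < p) {v : ℝ → Space d → Space d}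
    (hm : Measurable (Function.uncurry v)) (t : ℝ) :
    MemLp (v t) (ENNReal.ofReal p) (μ t) ↔ kinetic p μ v t < ⊤ := by
  have hp0 : 0 < p := by linarith
  rw [kinetic_eq hp0, ENNReal.rpow_lt_top_iff_of_pos hp0]
  exact ⟨fun h => h.2, fun h => ⟨(hm.comp measurable_prodMk_left).aestronglyMeasurable, h⟩⟩

lemma measurable_kinetic_kernel (κ : Kernel ℝ (Space d)) [IsSFiniteKernel κ] (p : ℝ)
    {v : ℝ → Space d → Space d} (hm : Measurable (Function.uncurry v)) :
    Measurable (kinetic p κ v) := by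
  have : Measurable (Function.uncurry fun t x => ‖v t x‖ₑ ^ p) := (hm.enorm).pow_const p
  exact Measurable.lintegral_kernel_prod_right this

/-- Take the element of least norm in a closed affine set of fields in L^p(τ ⊗ κ), where τ has a
density in time that is positive a.e. and makes w integrable to the power p. Least norm in
space-time implies least norm at a.e. time: a competitor that is better on a set S of times could be
glued in on S alone. Since τ and Lebesgue measure on [0,1] have the same null sets, a.e. statements
pass between them. -/
theorem IsVelocityField.exists_isTangentField (hp : 1 < p) {w : ℝ → Space d → Space d}
    (hw : IsVelocityField p μ w) {κ : Kernel ℝ (Space d)} [IsMarkovKernel κ]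
    (hκ : ∀ t ∈ Icc (0 : ℝ) 1, κ t = μ t) : ∃ v, IsTangentField p μ v := by
  have hp0 : 0 < p := by linarith
  have hP0 : ENNReal.ofReal p ≠ 0 := by simpa using hp0
  have hP1 : 1 ≤ ENNReal.ofReal p := by simpa using hp.le
  have hfact : Fact (1 ≤ ENNReal.ofReal p) := ⟨hP1⟩
  set I : Measure ℝ := volume.restrict (Icc (0 : ℝ) 1)
  have hI : ∀ᵐ t ∂I, κ t = μ t := (ae_restrict_mem measurableSet_Icc).mono hκ
  have hkin : ∀ u : ℝ → Space d → Space d, ∀ᵐ t ∂I, kinetic p κ u t = kinetic p μ u t := fun u =>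
    hI.mono fun t ht => by simp only [kinetic, ht]
  have hkm := fun (u : ℝ → Space d → Space d) (hu : Measurable (Function.uncurry u)) =>
    measurable_kinetic_kernel κ p hu
  -- the weight makes the given velocity field `p`-integrable in space-time
  let g : ℝ → ℝ≥0∞ := fun t => (1 + kinetic p κ w t)⁻¹
  have hg : Measurable g := (measurable_const.add (hkm w hw.measurable)).inv
  have hg1 : ∀ t, g t ≤ 1 := fun t => ENNReal.inv_le_one.2 le_self_add
  have hg0 : ∀ᵐ t ∂I, g t ≠ 0 := by
    filter_upwards [hw.memLp, hkin w] with t h1 h2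
    rw [memLp_iff_kinetic_lt_top hp hw.measurable, ← h2] at h1
    exact ENNReal.inv_ne_zero.2 (ENNReal.add_ne_top.2 ⟨ENNReal.one_ne_top, h1.ne⟩)
  set τ : Measure ℝ := I.withDensity g
  have hτI : τ ≪ I := withDensity_absolutelyContinuous I g
  have hIτ : I ≪ τ := withDensity_absolutelyContinuous' hg.aemeasurable hg0
  have hτfin : IsFiniteMeasure τ := by
    refine isFiniteMeasure_withDensity ((lintegral_mono hg1).trans_lt ?_).ne
    simp [I]
  set M : Measure (ℝ × Space d) := τ ⊗ₘ κ
  have hlint : ∀ u : ℝ → Space d → Space d, Measurable (Function.uncurry u) →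
      ∫⁻ z, ‖Function.uncurry u z‖ₑ ^ p ∂M = ∫⁻ t, kinetic p κ u t ∂τ := fun u hu =>
    Measure.lintegral_compProd (hu.enorm.pow_const p)
  have hmem : ∀ u : ℝ → Space d → Space d, Measurable (Function.uncurry u) →
      ∫⁻ t, kinetic p κ u t ∂τ < ⊤ → MemLp (Function.uncurry u) (ENNReal.ofReal p) M :=
    fun u hu h => by
      refine ⟨hu.aestronglyMeasurable, ?_⟩
      rw [eLpNorm_lt_top_iff_lintegral_rpow_enorm_lt_top hP0 ENNReal.ofReal_ne_top,
        ENNReal.toReal_ofReal hp0.le, hlint u hu]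
      exact h
  have hwM : MemLp (Function.uncurry w) (ENNReal.ofReal p) M := by
    refine hmem w hw.measurable ?_
    rw [lintegral_withDensity_eq_lintegral_mul _ hg (hkm w hw.measurable)]
    refine (lintegral_mono (g := fun _ => (1 : ℝ≥0∞)) fun t => ?_).trans_lt (by simp [I])
    simp only [Pi.mul_apply, g]
    rw [mul_comm, ← div_eq_mul_inv]
    exact ENNReal.div_le_of_le_mul (by rw [one_mul]; exact le_add_self)
  -- admissible fields
  let L : (Space d → ℝ) → ℝ × Space d → Space d →L[ℝ] ℝ := fun φ z => fderiv ℝ φ z.2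
  have hLm : ∀ φ : Space d → ℝ, ContDiff ℝ 1 φ → StronglyMeasurable (L φ) := fun φ hφ =>
    ((hφ.continuous_fderiv one_ne_zero).comp continuous_snd).stronglyMeasurable
  have hLb : ∀ φ : Space d → ℝ, ContDiff ℝ 1 φ → HasCompactSupport φ → ∃ B, ∀ z, ‖L φ z‖ ≤ B :=
    fun φ hφ hc => by
      obtain ⟨B, hB⟩ := (hc.fderiv ℝ).exists_bound_of_continuous
        (hφ.continuous_fderiv one_ne_zero)
      exact ⟨B, fun z => hB z.2⟩
  set w₀ : Lp (Space d) (ENNReal.ofReal p) M := hwM.toLp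
  -- Testing on A × univ for every measurable set A of times localizes the constraint: it becomes
  -- equality of the spatial pairings at a.e. time, for each φ. Each constraint is a continuous
  -- linear equation, so the set is closed and stable under midpoints.
  let K : Set (Lp (Space d) (ENNReal.ofReal p) M) := {f | ∀ φ : Space d → ℝ, ContDiff ℝ 1 φ →
    HasCompactSupport φ → ∀ A : Set ℝ, MeasurableSet A →
    ∫ z in A ×ˢ univ, L φ z (f z) ∂M = ∫ z in A ×ˢ univ, L φ z (w₀ z) ∂M}
  have hKT : ∀ φ : Space d → ℝ, ContDiff ℝ 1 φ → HasCompactSupport φ → ∀ A : Set ℝ,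
      ∃ T : Lp (Space d) (ENNReal.ofReal p) M →L[ℝ] ℝ,
        ∀ f, T f = ∫ z in A ×ˢ univ, L φ z (f z) ∂M := fun φ hφ hc A => by
    obtain ⟨B, hB⟩ := hLb φ hφ hc
    exact exists_pairing M _ (hLm φ hφ) hB _
  have hKclosed : IsClosed K := by
    simp only [K, ofPred_forall]
    refine isClosed_iInter fun φ => isClosed_iInter fun hφ => isClosed_iInter fun hc =>
      isClosed_iInter fun A => isClosed_iInter fun _ => ?_
    obtain ⟨T, hT⟩ := hKT φ hφ hc A
    simp_rw [← hT]
    exact isClosed_eq T.continuous continuous_const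
  have hKmid : ∀ a ∈ K, ∀ b ∈ K, (1 / 2 : ℝ) • (a + b) ∈ K := by
    intro a ha b hb φ hφ hc A hA
    obtain ⟨T, hT⟩ := hKT φ hφ hc A
    have h1 := ha φ hφ hc A hA
    have h2 := hb φ hφ hc A hA
    simp only [← hT] at h1 h2 ⊢
    rw [map_smul, map_add, h1, h2, smul_eq_mul]; ring
  obtain ⟨f, hfK, hfmin⟩ := ((uniformlyConvexPow_of_proper hp (Space d)).lp hp M).exists_norm_le hp
    hKclosed ⟨w₀, fun _ _ _ _ _ => rfl⟩ hKmid
  let v : ℝ → Space d → Space d := fun t x => f (t, x)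
  have hvm : Measurable (Function.uncurry v) := (Lp.stronglyMeasurable f).measurable
  have hvu : Function.uncurry v = f := rfl
  have hvfin : ∫⁻ t, kinetic p κ v t ∂τ < ⊤ := by
    rw [← hlint v hvm]
    have := (Lp.memLp f).2
    rwa [eLpNorm_lt_top_iff_lintegral_rpow_enorm_lt_top hP0 ENNReal.ofReal_ne_top,
        ENNReal.toReal_ofReal hp0.le] at this
  have hvLp : ∀ᵐ t ∂I, MemLp (v t) (ENNReal.ofReal p) (μ t) := by
    filter_upwards [hIτ.ae_le (ae_lt_top (hkm v hvm) hvfin.ne), hkin v] with t h1 h2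
    rw [memLp_iff_kinetic_lt_top hp hvm, ← h2]
    exact h1
  -- fields agreeing on almost all slices
  have hslice : ∀ (u : ℝ → Space d → Space d) (φ : Space d → ℝ), ContDiff ℝ 1 φ →
      HasCompactSupport φ → MemLp (Function.uncurry u) (ENNReal.ofReal p) M →
      Integrable (fun t => ∫ x, L φ (t, x) (u t x) ∂(κ t)) τ ∧ ∀ A : Set ℝ, MeasurableSet A →
      ∫ z in A ×ˢ univ, L φ z (Function.uncurry u z) ∂M
        = ∫ t in A, ∫ x, L φ (t, x) (u t x) ∂(κ t) ∂τ := by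
    intro u φ hφ hc hu
    obtain ⟨B, hB⟩ := hLb φ hφ hc
    have hint := integrable_clm_apply (hLm φ hφ) hB (hu.integrable hP1)
    refine ⟨hint.integral_compProd, fun A hA => ?_⟩
    rw [Measure.setIntegral_compProd hA MeasurableSet.univ hint.integrableOn]
    simp [Function.uncurry]
  have hvel : IsVelocityField p μ v := by
    refine hw.congr hvm hvLp fun φ hφ hc => ?_
    obtain ⟨i1, e1⟩ := hslice w φ hφ hc hwM
    obtain ⟨i2, e2⟩ := hslice v φ hφ hc (Lp.memLp f)
    have := Integrable.ae_eq_of_forall_setIntegral_eq _ _ i1 i2 fun A hA _ => by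
      rw [← e1 A hA, ← e2 A hA, hvu, hfK φ hφ hc A hA]
      refine setIntegral_congr_ae (hA.prod MeasurableSet.univ) ?_
      filter_upwards [hwM.coeFn_toLp] with z hz _
      rw [hz]
    filter_upwards [hIτ.ae_le this, hI] with t h1 h2
    rw [← h2]; exact h1
  refine ⟨v, hvel, fun u hu => ?_⟩
  let S : Set ℝ := {t | kinetic p κ u t < kinetic p κ v t}
  have hS : MeasurableSet S := measurableSet_lt (hkm u hu.measurable) (hkm v hvm)
  classical
  -- The better of u and v at each time. It lies in L^p(τ ⊗ κ) even if u does not, because its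
  -- kinetic energy is at most that of v.
  let h : ℝ → Space d → Space d := fun t x => if t ∈ S then u t x else v t x
  have hh : Measurable (Function.uncurry h) :=
    Measurable.ite (measurable_fst hS) hu.measurable hvm
  have hhk : ∀ t, kinetic p κ h t = min (kinetic p κ v t) (kinetic p κ u t) := fun t => by
    by_cases ht : t ∈ S
    · have : kinetic p κ h t = kinetic p κ u t := by simp only [kinetic, h, if_pos ht]
      rw [this, min_eq_right (le_of_lt ht)]
    · have : kinetic p κ h t = kinetic p κ v t := by simp only [kinetic, h, if_neg ht]
      rw [this, min_eq_left (not_lt.1 ht)]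
  have hhM : MemLp (Function.uncurry h) (ENNReal.ofReal p) M := by
    refine hmem h hh ((lintegral_mono fun t => ?_).trans_lt hvfin)
    rw [hhk]; exact min_le_left _ _
  have hhK : hhM.toLp ∈ K := by
    intro φ hφ hc A hA
    rw [← hfK φ hφ hc A hA, ← hvu, (hslice v φ hφ hc (Lp.memLp f)).2 A hA]
    have e : ∫ z in A ×ˢ univ, L φ z ((hhM.toLp : Lp (Space d) (ENNReal.ofReal p) M) z) ∂M
        = ∫ z in A ×ˢ univ, L φ z (Function.uncurry h z) ∂M := by
      refine setIntegral_congr_ae (hA.prod MeasurableSet.univ) ?_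
      filter_upwards [hhM.coeFn_toLp] with z hz _
      rw [hz]
    rw [e, (hslice h φ hφ hc hhM).2 A hA]
    refine setIntegral_congr_ae hA ?_
    filter_upwards [hτI.ae_le (hu.ae_integral_eq hvel hφ hc), hτI.ae_le hI] with t h1 h2 _
    by_cases ht : t ∈ S
    · simp only [h, if_pos ht, h2]; exact h1
    · simp only [h, if_neg ht]
  -- Comparing norms with the glued field gives ∫ V(v) ≤ ∫ min(V(v), V(u)); the integrals are
  -- finite, so the integrands agree a.e.
  have hle : ∫⁻ t, kinetic p κ v t ∂τ ≤ ∫⁻ t, min (kinetic p κ v t) (kinetic p κ u t) ∂τ := by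
    have h1 := hfmin _ hhK
    rw [Lp.norm_def, Lp.norm_def, ENNReal.toReal_le_toReal (Lp.eLpNorm_ne_top _)
      (Lp.eLpNorm_ne_top _), eLpNorm_congr_ae hhM.coeFn_toLp, ← hvu,
      eLpNorm_eq_lintegral_rpow_enorm_toReal hP0 ENNReal.ofReal_ne_top,
      eLpNorm_eq_lintegral_rpow_enorm_toReal hP0 ENNReal.ofReal_ne_top,
      ENNReal.toReal_ofReal hp0.le, ENNReal.rpow_le_rpow_iff (by positivity),
      hlint v hvm, hlint h hh] at h1
    simpa only [hhk] using h1
  have hae := ae_eq_of_ae_le_of_lintegral_le (ae_of_all τ fun t => min_le_left _ _)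
    ((lintegral_mono fun t => min_le_left _ _).trans_lt hvfin).ne (hkm v hvm).aemeasurable hle
  filter_upwards [hIτ.ae_le hae, hkin v, hkin u] with t h1 h2 h3
  rw [← ENNReal.rpow_le_rpow_iff hp0, ← kinetic_eq hp0, ← kinetic_eq hp0, ← h2, ← h3]
  exact min_eq_left_iff.1 h1

end TangentExistence

/-! ### Perturbed curves and their velocity fields -/

section Perturbation

open Filter Topology

/-- The perturbed identity `x ↦ x + ε ξ(t,x)`. -/
def perturb (ξ : ℝ × Space d → Space d) (ε t : ℝ) (x : Space d) : Space d := x + ε • ξ (t, x)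

/-- The image of a curve of measures under the perturbed identity. -/
noncomputable def perturbCurve (ξ : ℝ × Space d → Space d) (ε : ℝ) (μ : ℝ → Measure (Space d))
    (t : ℝ) : Measure (Space d) :=
  (μ t).map (perturb ξ ε t)

/-- The velocity of the perturbed curve in Lagrangian coordinates. -/
noncomputable def perturbField (ξ : ℝ × Space d → Space d) (ε : ℝ) (v : ℝ → Space d → Space d)
    (t : ℝ) (x : Space d) : Space d :=
  v t x + ε • transportDeriv ξ t x (v t x)

variable {ξ : ℝ × Space d → Space d}

lemma hasFDerivAt_slice (hξ : Differentiable ℝ ξ) (t : ℝ) (x : Space d) :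
    HasFDerivAt (fun y => ξ (t, y)) ((fderiv ℝ ξ (t, x)).comp (ContinuousLinearMap.inr ℝ ℝ (Space d)))
      x :=
  (hξ (t, x)).hasFDerivAt.comp x (hasFDerivAt_prodMk_right t x)

lemma transportDeriv_eq (hξ : Differentiable ℝ ξ) (t : ℝ) (x w : Space d) :
    transportDeriv ξ t x w = fderiv ℝ ξ (t, x) (1, w) := by
  have h1 : HasDerivAt (fun s => ξ (s, x)) (fderiv ℝ ξ (t, x) (1, 0)) t := by
    have := (hξ (t, x)).hasFDerivAt.comp_hasDerivAt t
      ((hasDerivAt_id t).prodMk (hasDerivAt_const t x))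
    exact this
  rw [transportDeriv, (hasFDerivAt_slice hξ t x).fderiv, h1.deriv]
  have : ((1 : ℝ), w) = (0, w) + (1, 0) := by simp
  rw [this, map_add]; simp

lemma norm_transportDeriv_le (hξ : Differentiable ℝ ξ) {B : ℝ} (hB : ∀ z, ‖fderiv ℝ ξ z‖ ≤ B)
    (t : ℝ) (x w : Space d) : ‖transportDeriv ξ t x w‖ ≤ B * (1 + ‖w‖) := by
  rw [transportDeriv_eq hξ]
  have hB0 : 0 ≤ B := (norm_nonneg _).trans (hB (0, 0))
  refine (ContinuousLinearMap.le_opNorm _ _).trans ?_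
  gcongr
  · exact hB _
  · exact max_le (by simp) (by simp)

lemma measurable_transportDeriv (hξ : ContDiff ℝ ∞ ξ) {v : ℝ → Space d → Space d}
    (hv : Measurable (Function.uncurry v)) :
    Measurable (Function.uncurry fun t x => transportDeriv ξ t x (v t x)) := by
  have h1 : Continuous fun q : (ℝ × Space d →L[ℝ] Space d) × (ℝ × Space d) => q.1 q.2 :=
    isBoundedBilinearMap_apply.continuous
  have h2 : Measurable fun z : ℝ × Space d => fderiv ℝ ξ z (1, v z.1 z.2) :=
    h1.measurable.comp ((hξ.continuous_fderiv (by simp)).measurable.prodMk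
      (measurable_const.prodMk hv))
  simpa only [Function.uncurry_def, transportDeriv_eq (hξ.differentiable (by simp))] using h2

lemma measurable_perturbField (hξ : ContDiff ℝ ∞ ξ) (ε : ℝ) {v : ℝ → Space d → Space d}
    (hv : Measurable (Function.uncurry v)) :
    Measurable (Function.uncurry (perturbField ξ ε v)) :=
  hv.add ((measurable_transportDeriv hξ hv).const_smul ε)

lemma norm_sub_le_of_fderiv_bound (hξ : Differentiable ℝ ξ) {B : ℝ} (hB : ∀ z, ‖fderiv ℝ ξ z‖ ≤ B)
    (z z' : ℝ × Space d) : ‖ξ z - ξ z'‖ ≤ B * ‖z - z'‖ :=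
  convex_univ.norm_image_sub_le_of_norm_fderiv_le (𝕜 := ℝ)
    (fun x _ => hξ x) (fun x _ => hB x) (mem_univ z') (mem_univ z)

/-- A perturbation of the identity with Lipschitz constant below 1 is a homeomorphism. Working in
space-time rather than slice by slice makes the inverse jointly continuous in (t,x), as a Borel
velocity field of the image curve requires. -/
lemma exists_perturb_homeomorph (hξ : Differentiable ℝ ξ) {B : ℝ} (hB : ∀ z, ‖fderiv ℝ ξ z‖ ≤ B)
    {ε : ℝ} (hε : |ε| * B < 1) :
    ∃ h : (ℝ × Space d) ≃ₜ (ℝ × Space d), ∀ t x, h (t, x) = (t, perturb ξ ε t x) := by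
  have hB0 : 0 ≤ B := (norm_nonneg _).trans (hB (0, 0))
  have happ : ApproximatesLinearOn (fun z : ℝ × Space d => (z.1, perturb ξ ε z.1 z.2))
      ((ContinuousLinearEquiv.refl ℝ (ℝ × Space d) : (ℝ × Space d) ≃L[ℝ] (ℝ × Space d)) :
        (ℝ × Space d) →L[ℝ] (ℝ × Space d)) univ (|ε| * B).toNNReal := by
    intro z _ z' _
    have e : ((z.1, perturb ξ ε z.1 z.2) - (z'.1, perturb ξ ε z'.1 z'.2)
        - ((ContinuousLinearEquiv.refl ℝ (ℝ × Space d) : (ℝ × Space d) →L[ℝ] (ℝ × Space d)))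
          (z - z') : ℝ × Space d) = (0, ε • (ξ z - ξ z')) := by
      ext1
      · simp
      · simp only [perturb, Prod.mk_sub_mk, ContinuousLinearEquiv.coe_refl,
          ContinuousLinearMap.coe_id', id_eq, Prod.snd_sub, smul_sub]
        abel
    simp only [e]
    rw [Real.coe_toNNReal _ (by positivity), Prod.norm_mk, norm_zero, norm_smul, Real.norm_eq_abs,
      mul_assoc]
    refine max_le (by positivity) ?_
    gcongr
    exact norm_sub_le_of_fderiv_bound hξ hB z z'
  refine ⟨happ.toHomeomorph _ (Or.inr ?_), fun t x => rfl⟩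
  have : ‖((ContinuousLinearEquiv.refl ℝ (ℝ × Space d)).symm :
      (ℝ × Space d) →L[ℝ] (ℝ × Space d))‖₊ = 1 := by
    rw [← NNReal.coe_inj]
    exact ContinuousLinearMap.norm_id
  rw [this, inv_one, Real.toNNReal_lt_one]
  exact hε

lemma continuous_perturb (hξ : Continuous ξ) (ε t : ℝ) : Continuous (perturb ξ ε t) :=
  continuous_id.add ((hξ.comp (Continuous.prodMk_right t)).const_smul ε)

/-- Only points in the spatial projection of the support move, a compact subset of int Ω, and they
move by at most |ε| sup‖ξ‖. -/
lemma eventually_perturb_mem (hξ : Continuous ξ) (hc : HasCompactSupport ξ) {Ω : Set (Space d)}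
    (hsub : tsupport ξ ⊆ Ioo (0 : ℝ) 1 ×ˢ interior Ω) :
    ∀ᶠ ε in 𝓝 (0 : ℝ), ∀ t, ∀ x ∈ Ω, perturb ξ ε t x ∈ Ω := by
  obtain ⟨A, hA⟩ := hc.exists_bound_of_continuous hξ
  have hK : IsCompact (Prod.snd '' tsupport ξ) := hc.isCompact.image continuous_snd
  have hKΩ : Prod.snd '' tsupport ξ ⊆ interior Ω := by
    rintro _ ⟨z, hz, rfl⟩; exact (hsub hz).2
  obtain ⟨δ, hδ, hδΩ⟩ := hK.exists_thickening_subset_open isOpen_interior hKΩ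
  have hev : ∀ᶠ ε in 𝓝 (0:ℝ), |ε| * A < δ :=
    ContinuousAt.eventually_lt (by fun_prop) continuousAt_const (by simpa using hδ)
  filter_upwards [hev] with ε hε t x hx
  by_cases hz : (t, x) ∈ tsupport ξ
  · refine interior_subset (hδΩ (Metric.mem_thickening_iff.2 ⟨x, ⟨_, hz, rfl⟩, ?_⟩))
    rw [perturb, dist_eq_norm, add_sub_cancel_left, norm_smul, Real.norm_eq_abs]
    exact (by gcongr; exact hA _ : |ε| * ‖ξ (t, x)‖ ≤ |ε| * A).trans_lt hε
  · rw [perturb, image_eq_zero_of_notMem_tsupport hz, smul_zero, add_zero]; exact hx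

lemma wassersteinDist_le_of_isCoupling {p : ℝ} (hp : 0 < p) {μ ν : Measure (Space d)}
    {γ : Measure (Space d × Space d)} (hγ : IsCoupling μ ν γ) :
    wassersteinDist p μ ν
      ≤ eLpNorm (fun z : Space d × Space d => z.1 - z.2) (ENNReal.ofReal p) γ := by
  rw [eLpNorm_eq_lintegral_rpow_enorm_toReal (by simpa using hp) ENNReal.ofReal_ne_top,
    ENNReal.toReal_ofReal hp.le, wassersteinDist]
  gcongr
  exact iInf₂_le γ hγ

/-- Push a nearly optimal plan forward by (f, g) and apply Minkowski's inequality to a + b‖x - y‖.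
-/
lemma wassersteinDist_map_le {p : ℝ} (hp : 1 < p) {μ ν : Measure (Space d)} [IsProbabilityMeasure μ]
    {f g : Space d → Space d} (hf : Measurable f) (hg : Measurable g) {a b w : ℝ} (ha : 0 ≤ a)
    (hb : 0 ≤ b) (hw : 0 ≤ w) (hfg : ∀ x y, ‖f x - g y‖ ≤ a + b * ‖x - y‖)
    (hW : wassersteinDist p μ ν ≤ ENNReal.ofReal w) :
    wassersteinDist p (μ.map f) (ν.map g) ≤ ENNReal.ofReal (a + b * w) := by
  have hp0 : 0 < p := by linarith
  have key : ∀ w' > w, wassersteinDist p (μ.map f) (ν.map g) ≤ ENNReal.ofReal (a + b * w') := by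
    intro w' hw'
    have hw0 : 0 < w' := hw.trans_lt hw'
    obtain ⟨γ, hγ, hlt⟩ := exists_coupling_of_wassersteinDist_lt hp0
      (hW.trans_lt ((ENNReal.ofReal_lt_ofReal_iff hw0).2 hw'))
    have hprob := hγ.isProbabilityMeasure
    have hmeas : AEStronglyMeasurable (fun z : Space d × Space d => z.1 - z.2) γ :=
      (measurable_fst.sub measurable_snd).aestronglyMeasurable
    have hnorm : eLpNorm (fun z : Space d × Space d => z.1 - z.2) (ENNReal.ofReal p) γ
        ≤ ENNReal.ofReal w' := by
      rw [eLpNorm_eq_lintegral_rpow_enorm_toReal (by simpa using hp0) ENNReal.ofReal_ne_top,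
        ENNReal.toReal_ofReal hp0.le]
      calc _ ≤ (ENNReal.ofReal w' ^ p) ^ (1 / p) := by gcongr
        _ = _ := by
          rw [← ENNReal.rpow_mul, mul_one_div_cancel hp0.ne', ENNReal.rpow_one]
    have hF : Measurable (Prod.map f g) := hf.prodMap hg
    have hcoup : IsCoupling (μ.map f) (ν.map g) (γ.map (Prod.map f g)) := by
      constructor
      · rw [Measure.map_map measurable_fst hF, ← hγ.1, Measure.map_map hf measurable_fst]; rfl
      · rw [Measure.map_map measurable_snd hF, ← hγ.2, Measure.map_map hg measurable_snd]; rfl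
    refine (wassersteinDist_le_of_isCoupling hp0 hcoup).trans ?_
    have hsub : Measurable fun z : Space d × Space d => z.1 - z.2 :=
      measurable_fst.sub measurable_snd
    rw [eLpNorm_map_measure hsub.aestronglyMeasurable hF.aemeasurable]
    have hconst : eLpNorm (fun _ : Space d × Space d => a) (ENNReal.ofReal p) γ
        = ENNReal.ofReal a := by
      rw [eLpNorm_const _ (by simpa using hp0) (NeZero.ne _)]
      simp [Real.enorm_of_nonneg ha]
    calc eLpNorm ((fun z : Space d × Space d => z.1 - z.2) ∘ Prod.map f g) (ENNReal.ofReal p) γ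
        ≤ eLpNorm ((fun _ => a) + b • fun z : Space d × Space d => ‖z.1 - z.2‖)
            (ENNReal.ofReal p) γ :=
          eLpNorm_mono_real fun z => hfg z.1 z.2
      _ ≤ eLpNorm (fun _ : Space d × Space d => a) (ENNReal.ofReal p) γ
          + eLpNorm (b • fun z : Space d × Space d => ‖z.1 - z.2‖) (ENNReal.ofReal p) γ :=
          eLpNorm_add_le aestronglyMeasurable_const (hmeas.norm.const_smul b)
            (by simpa using hp.le)
      _ ≤ ENNReal.ofReal a + ENNReal.ofReal b * ENNReal.ofReal w' := by
          rw [hconst, eLpNorm_const_smul, eLpNorm_norm, Real.enorm_of_nonneg hb]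
          gcongr
      _ = _ := by rw [← ENNReal.ofReal_mul hb, ← ENNReal.ofReal_add ha (by positivity)]
  have hlim : Tendsto (fun w' => ENNReal.ofReal (a + b * w')) (𝓝[>] w)
      (𝓝 (ENNReal.ofReal (a + b * w))) :=
    ((ENNReal.continuous_ofReal.comp (by fun_prop : Continuous fun w' : ℝ => a + b * w')).tendsto
      w).mono_left nhdsWithin_le_nhds
  exact ge_of_tendsto hlim (eventually_nhdsWithin_of_forall key)

lemma norm_perturb_sub_le (hξ : Differentiable ℝ ξ) {B : ℝ} (hB : ∀ z, ‖fderiv ℝ ξ z‖ ≤ B) {ε : ℝ}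
    (hε : |ε| ≤ 1) (s t : ℝ) (x y : Space d) :
    ‖perturb ξ ε s x - perturb ξ ε t y‖ ≤ B * |s - t| + (1 + B) * ‖x - y‖ := by
  have hB0 : 0 ≤ B := (norm_nonneg _).trans (hB (0, 0))
  have h1 := norm_sub_le_of_fderiv_bound hξ hB (s, x) (t, y)
  have h2 : ‖((s, x) - (t, y) : ℝ × Space d)‖ ≤ |s - t| + ‖x - y‖ := max_le (by simp) (by simp)
  have e : perturb ξ ε s x - perturb ξ ε t y = (x - y) + ε • (ξ (s, x) - ξ (t, y)) := by
    simp only [perturb, smul_sub]; abel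
  rw [e]
  calc _ ≤ ‖x - y‖ + |ε| * ‖ξ (s, x) - ξ (t, y)‖ := by
        refine (norm_add_le _ _).trans ?_
        rw [norm_smul, Real.norm_eq_abs]
    _ ≤ ‖x - y‖ + 1 * (B * (|s - t| + ‖x - y‖)) := by
        gcongr
        exact h1.trans (by gcongr)
    _ = _ := by ring

lemma IsLipschitzCurve.perturbCurve {p : ℝ} (hp : 1 < p) {Ω : Set (Space d)}
    {μ : ℝ → Measure (Space d)} (hμ : IsLipschitzCurve p Ω μ) (hξ : Differentiable ℝ ξ)
    (hc : HasCompactSupport ξ) {B : ℝ} (hB : ∀ z, ‖fderiv ℝ ξ z‖ ≤ B) {ε : ℝ} (hε : |ε| ≤ 1)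
    (hΩ : ∀ t, ∀ x ∈ Ω, perturb ξ ε t x ∈ Ω) (hΩm : MeasurableSet Ω) :
    IsLipschitzCurve p Ω (perturbCurve ξ ε μ) := by
  have hp0 : 0 < p := by linarith
  have hB0 : 0 ≤ B := (norm_nonneg _).trans (hB (0, 0))
  have hm : ∀ t, Measurable (perturb ξ ε t) := fun t => (continuous_perturb hξ.continuous ε t).measurable
  refine ⟨fun t ht => ?_, ?_⟩
  · obtain ⟨h1, h2, h3⟩ := hμ.mem t ht
    refine ⟨Measure.isProbabilityMeasure_map (hm t).aemeasurable, ?_, ?_⟩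
    · rw [WGeod.perturbCurve, Measure.map_apply (hm t) hΩm.compl]
      exact measure_mono_null (fun x hx hxΩ => hx (hΩ t x hxΩ)) h2
    · obtain ⟨A, hA⟩ := hc.exists_bound_of_continuous hξ.continuous
      rw [WGeod.perturbCurve, lintegral_map (by fun_prop) (hm t)]
      have hid : MemLp (fun x : Space d => x) (ENNReal.ofReal p) (μ t) := by
        refine ⟨measurable_id.aestronglyMeasurable, ?_⟩
        rw [eLpNorm_lt_top_iff_lintegral_rpow_enorm_lt_top (by simpa using hp0)
          ENNReal.ofReal_ne_top, ENNReal.toReal_ofReal hp0.le]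
        exact h3
      have hb : MemLp (fun x : Space d => ε • ξ (t, x)) (ENNReal.ofReal p) (μ t) :=
        (MemLp.of_bound (hξ.continuous.comp (Continuous.prodMk_right t)).aestronglyMeasurable A
          (ae_of_all _ fun x => hA _)).const_smul ε
      have := (hid.add hb).2
      rw [eLpNorm_lt_top_iff_lintegral_rpow_enorm_lt_top (by simpa using hp0)
          ENNReal.ofReal_ne_top, ENNReal.toReal_ofReal hp0.le] at this
      exact this
  · obtain ⟨C, hC0, hC⟩ := hμ.exists_wassersteinDist_le
    refine ⟨(B + (1 + B) * C).toNNReal, fun s hs t ht => ?_⟩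
    have := (hμ.mem s hs).isProb
    refine (wassersteinDist_map_le hp (hm s) (hm t) (mul_nonneg hB0 (abs_nonneg (s - t)))
      (by linarith) (mul_nonneg hC0 (abs_nonneg (s - t)))
      (norm_perturb_sub_le hξ hB hε s t) (hC s hs t ht)).trans_eq ?_
    rw [ENNReal.coe_nnreal_eq, Real.coe_toNNReal _ (by positivity),
      ← ENNReal.ofReal_mul (by positivity)]
    congr 1; ring

/-- The composite is φ(x) plus a function χ of compact support in space-time. It need not have
compact support in time itself, which is why `IsTimeTest` asks only for a bounded, uniformly
continuous derivative and compactly supported slices. -/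
lemma isTimeTest_comp_perturb (hξ : ContDiff ℝ ∞ ξ) (hc : HasCompactSupport ξ) (ε : ℝ)
    {φ : Space d → ℝ} (hφ : ContDiff ℝ 1 φ) (hφc : HasCompactSupport φ) :
    IsTimeTest fun z : ℝ × Space d => φ (perturb ξ ε z.1 z.2) := by
  have hξ1 : ContDiff ℝ 1 ξ := hξ.of_le (by exact_mod_cast le_top)
  have hψ : ContDiff ℝ 1 fun z : ℝ × Space d => φ (perturb ξ ε z.1 z.2) :=
    hφ.comp (contDiff_snd.add (hξ1.const_smul ε))
  have hφs : ContDiff ℝ 1 fun z : ℝ × Space d => φ z.2 := hφ.comp contDiff_snd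
  let χ : ℝ × Space d → ℝ := fun z => φ (perturb ξ ε z.1 z.2) - φ z.2
  have hχ : ContDiff ℝ 1 χ := hψ.sub hφs
  have hχc : HasCompactSupport χ := by
    refine hc.mono' fun z hz => ?_
    by_contra hn
    exact hz (by simp [χ, perturb, image_eq_zero_of_notMem_tsupport hn])
  have e : ∀ z, fderiv ℝ (fun z : ℝ × Space d => φ (perturb ξ ε z.1 z.2)) z
      = fderiv ℝ χ z + (fderiv ℝ φ z.2).comp (ContinuousLinearMap.snd ℝ ℝ (Space d)) := by
    intro z
    have h1 := ((hφ.differentiable one_ne_zero z.2).hasFDerivAt.comp z hasFDerivAt_snd)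
    have h2 := (hχ.differentiable one_ne_zero z).hasFDerivAt.add h1
    have h3 : χ + φ ∘ Prod.snd = fun z : ℝ × Space d => φ (perturb ξ ε z.1 z.2) := by
      funext z; simp [χ]
    rw [h3] at h2
    exact h2.fderiv
  have hc1 := hχ.continuous_fderiv one_ne_zero
  have hc2 := hφ.continuous_fderiv one_ne_zero
  have hs1 : HasCompactSupport (fderiv ℝ χ) := hχc.fderiv ℝ
  have hs2 : HasCompactSupport (fderiv ℝ φ) := hφc.fderiv ℝ
  obtain ⟨B1, hB1⟩ := hs1.exists_bound_of_continuous hc1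
  obtain ⟨B2, hB2⟩ := hs2.exists_bound_of_continuous hc2
  refine ⟨hψ, ⟨B1 + B2, fun z => ?_⟩, ?_, fun t => ?_⟩
  · rw [e]
    refine (norm_add_le _ _).trans (add_le_add (hB1 z) ?_)
    refine (ContinuousLinearMap.opNorm_comp_le _ _).trans ?_
    have h1 := ContinuousLinearMap.norm_snd_le ℝ ℝ (Space d)
    have h2 := hB2 z.2
    nlinarith [norm_nonneg (fderiv ℝ φ z.2)]
  · have u1 := hs1.uniformContinuous_of_continuous hc1
    have u2 := hs2.uniformContinuous_of_continuous hc2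
    have u3 : UniformContinuous fun z : ℝ × Space d =>
        (fderiv ℝ φ z.2).comp (ContinuousLinearMap.snd ℝ ℝ (Space d)) :=
      ((ContinuousLinearMap.compL ℝ (ℝ × Space d) (Space d) ℝ).flip
        (ContinuousLinearMap.snd ℝ ℝ (Space d))).uniformContinuous.comp
        (u2.comp uniformContinuous_snd)
    have := u1.add u3
    rwa [show fderiv ℝ (fun z : ℝ × Space d => φ (perturb ξ ε z.1 z.2)) = _ from funext e]
  · refine HasCompactSupport.intro
      (hφc.isCompact.union (hc.isCompact.image continuous_snd)) fun x hx => ?_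
    simp only [mem_union, not_or] at hx
    have h1 : (t, x) ∉ tsupport ξ := fun h => hx.2 ⟨_, h, rfl⟩
    simp only [perturb, image_eq_zero_of_notMem_tsupport h1, smul_zero, add_zero]
    exact image_eq_zero_of_notMem_tsupport hx.1

lemma fderiv_comp_perturb_apply (hξ : Differentiable ℝ ξ) (ε : ℝ)
    {φ : Space d → ℝ} (hφ : Differentiable ℝ φ) (t : ℝ) (x w : Space d) :
    fderiv ℝ (fun z : ℝ × Space d => φ (perturb ξ ε z.1 z.2)) (t, x) (1, w)
      = fderiv ℝ φ (perturb ξ ε t x) (w + ε • transportDeriv ξ t x w) := by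
  have h1 : HasFDerivAt (fun z : ℝ × Space d => perturb ξ ε z.1 z.2)
      (ContinuousLinearMap.snd ℝ ℝ (Space d) + ε • fderiv ℝ ξ (t, x)) (t, x) :=
    hasFDerivAt_snd.add ((hξ (t, x)).hasFDerivAt.const_smul ε)
  have h2 := (hφ (perturb ξ ε t x)).hasFDerivAt.comp (t, x) h1
  have h3 : fderiv ℝ (fun z : ℝ × Space d => φ (perturb ξ ε z.1 z.2)) (t, x) = _ := h2.fderiv
  rw [h3, transportDeriv_eq hξ]
  simp

lemma memLp_perturbField {p : ℝ} {ν : Measure (Space d)} [IsFiniteMeasure ν]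
    (hξ : ContDiff ℝ ∞ ξ) {B : ℝ} (hB : ∀ z, ‖fderiv ℝ ξ z‖ ≤ B) (ε : ℝ)
    {v : ℝ → Space d → Space d} (hv : Measurable (Function.uncurry v)) {t : ℝ}
    (ht : MemLp (v t) (ENNReal.ofReal p) ν) :
    MemLp (perturbField ξ ε v t) (ENNReal.ofReal p) ν := by
  have hmeas : AEStronglyMeasurable (perturbField ξ ε v t) ν :=
    ((measurable_perturbField hξ ε hv).comp measurable_prodMk_left).aestronglyMeasurable
  have hbd : MemLp (fun x => ‖v t x‖ + |ε| * (B * (1 + ‖v t x‖))) (ENNReal.ofReal p) ν :=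
    ht.norm.add ((((memLp_const (1:ℝ)).add ht.norm).const_mul B).const_mul |ε|)
  refine hbd.mono' hmeas (ae_of_all _ fun x => ?_)
  refine (norm_add_le _ _).trans ?_
  rw [norm_smul, Real.norm_eq_abs]
  gcongr
  exact norm_transportDeriv_le (hξ.differentiable (by simp)) hB _ _ _

/-- Testing the image curve against φ is testing μ against φ(x + ε ξ(t,x)), and the chain rule turns
v into `perturbField`. The field w is `perturbField` read through the inverse map, so its kinetic
energy is computed exactly by change of variables. -/
lemma IsVelocityField.exists_perturbCurve {p : ℝ} (hp : 1 < p) {Ω : Set (Space d)}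
    {μ : ℝ → Measure (Space d)} (hμ : IsLipschitzCurve p Ω μ) {v : ℝ → Space d → Space d}
    (hv : IsVelocityField p μ v) (hξ : ContDiff ℝ ∞ ξ) (hc : HasCompactSupport ξ) {B : ℝ}
    (hB : ∀ z, ‖fderiv ℝ ξ z‖ ≤ B) {ε : ℝ} (hε : |ε| * B < 1) :
    ∃ w, IsVelocityField p (perturbCurve ξ ε μ) w ∧
      ∀ t, kinetic p (perturbCurve ξ ε μ) w t = kinetic p μ (perturbField ξ ε v) t := by
  have hξd : Differentiable ℝ ξ := hξ.differentiable (by simp)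
  obtain ⟨h, hh⟩ := exists_perturb_homeomorph hξd hB hε
  have hsymm : ∀ t x, h.symm (t, perturb ξ ε t x) = (t, x) := fun t x => by
    rw [← hh, h.symm_apply_apply]
  have hWm := measurable_perturbField hξ ε hv.measurable
  let w : ℝ → Space d → Space d := fun t y => Function.uncurry (perturbField ξ ε v) (h.symm (t, y))
  have hwm : Measurable (Function.uncurry w) := hWm.comp h.symm.continuous.measurable
  have hw : ∀ t x, w t (perturb ξ ε t x) = perturbField ξ ε v t x := fun t x => by
    simp only [w, hsymm]; rfl
  have hm : ∀ t, Measurable (perturb ξ ε t) :=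
    fun t => (continuous_perturb hξd.continuous ε t).measurable
  have hwt : ∀ t, Measurable (w t) := fun t => hwm.comp measurable_prodMk_left
  have hint : ∀ (φ : Space d → ℝ), ContDiff ℝ 1 φ → ∀ t,
      ∫ x, fderiv ℝ φ x (w t x) ∂(perturbCurve ξ ε μ t)
        = ∫ x, fderiv ℝ (fun z : ℝ × Space d => φ (perturb ξ ε z.1 z.2)) (t, x) (1, v t x) ∂(μ t) := by
    intro φ hφ t
    have h1 : Continuous fun q : (Space d →L[ℝ] ℝ) × Space d => q.1 q.2 :=
      isBoundedBilinearMap_apply.continuous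
    have h2 : Measurable fun x => fderiv ℝ φ x (w t x) :=
      h1.measurable.comp ((hφ.continuous_fderiv one_ne_zero).measurable.prodMk (hwt t))
    rw [WGeod.perturbCurve, integral_map (hm t).aemeasurable h2.aestronglyMeasurable]
    refine integral_congr_ae (ae_of_all _ fun x => ?_)
    simp only [hw, fderiv_comp_perturb_apply hξd ε (hφ.differentiable one_ne_zero)]
    rfl
  have hint0 : ∀ (φ : Space d → ℝ), ContDiff ℝ 1 φ → ∀ t,
      ∫ x, φ x ∂(perturbCurve ξ ε μ t) = ∫ x, φ (perturb ξ ε t x) ∂(μ t) := fun φ hφ t =>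
    integral_map (hm t).aemeasurable hφ.continuous.aestronglyMeasurable
  refine ⟨w, ⟨hwm, ?_, fun φ hφ hφc => ?_, fun φ hφ hφc t₁ h₁ t₂ h₂ hlt => ?_⟩, fun t => ?_⟩
  · filter_upwards [hv.memLp, ae_restrict_mem measurableSet_Icc] with t ht htI
    have := (hμ.mem t htI).isProb
    rw [WGeod.perturbCurve, memLp_map_measure_iff (hwt t).aestronglyMeasurable (hm t).aemeasurable]
    exact (memLp_perturbField hξ hB ε hv.measurable ht).congr_norm
      ((hwt t).comp (hm t)).aestronglyMeasurable (ae_of_all _ fun x => by simp [hw])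
  · simp_rw [hint φ hφ]
    exact ((isTimeTest_comp_perturb hξ hc ε hφ hφc).integrableOn_and_integral_eq hp hμ hv).1
  · simp_rw [hint φ hφ, hint0 φ hφ]
    exact ((isTimeTest_comp_perturb hξ hc ε hφ hφc).integrableOn_and_integral_eq hp hμ hv).2
      t₁ h₁ t₂ h₂ hlt
  · rw [kinetic, WGeod.perturbCurve, lintegral_map ((hwt t).enorm.pow_const p) (hm t)]
    simp only [hw, kinetic]

end Perturbation

/-! ### Internal energy under a diffeomorphism -/

section InternalEnergy

lemma map_eq_withDensity {f g : Space d → Space d} {f' : Space d → Space d →L[ℝ] Space d}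
    (hf : ∀ x, HasFDerivAt f (f' x) x) (hdet : ∀ x, (f' x).det ≠ 0)
    (hgf : ∀ x, g (f x) = x) (hfg : ∀ y, f (g y) = y) (u : Space d → ℝ≥0∞) :
    (volume.withDensity u).map f
      = volume.withDensity fun y => u (g y) / ENNReal.ofReal |(f' (g y)).det| := by
  have hfm : Measurable f :=
    (continuous_iff_continuousAt.2 fun x => (hf x).continuousAt).measurable
  have hinj : InjOn f univ := fun x _ y _ h => by rw [← hgf x, h, hgf]
  have himg : f '' univ = univ := image_univ_of_surjective fun y => ⟨g y, hfg y⟩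
  ext A hA
  rw [Measure.map_apply hfm hA, withDensity_apply _ (hfm hA), withDensity_apply _ hA,
    ← lintegral_indicator hA, ← lintegral_indicator (hfm hA)]
  have := lintegral_image_eq_lintegral_abs_det_fderiv_mul volume MeasurableSet.univ
    (fun x _ => (hf x).hasFDerivWithinAt) hinj
    (A.indicator fun y => u (g y) / ENNReal.ofReal |(f' (g y)).det|)
  rw [himg, Measure.restrict_univ] at this
  rw [this]
  refine lintegral_congr fun x => ?_
  have h0 : ENNReal.ofReal |(f' x).det| ≠ 0 := by simpa using hdet x
  by_cases hx : f x ∈ A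
  · rw [indicator_of_mem (show x ∈ f ⁻¹' A from hx), indicator_of_mem hx, hgf,
      ENNReal.mul_div_cancel h0 ENNReal.ofReal_ne_top]
  · rw [indicator_of_notMem (show x ∉ f ⁻¹' A from hx), indicator_of_notMem hx, mul_zero]

/-- In the change of variables y = f(x), the density contributes |det|^(-q) and the volume element
|det|. Only an inequality is claimed, since `Lq` ignores whatever part of the image lies outside Ω;
an upper bound is all that the comparison needs. -/
lemma Lq_map_le {q : ℝ} (hq : 0 < q) {Ω : Set (Space d)} (hΩ : MeasurableSet Ω)
    {ν : Measure (Space d)} [IsFiniteMeasure ν] (hν : ν ≪ volume) (hνΩ : ν Ωᶜ = 0)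
    {f g : Space d → Space d} {f' : Space d → Space d →L[ℝ] Space d}
    (hf : ∀ x, HasFDerivAt f (f' x) x) (hdet : ∀ x, (f' x).det ≠ 0)
    (hdetm : Measurable fun x => (f' x).det) (hg : Measurable g) (hgf : ∀ x, g (f x) = x)
    (hfg : ∀ y, f (g y) = y) :
    Lq q Ω (ν.map f)
      ≤ ∫⁻ x in Ω, ν.rnDeriv volume x ^ q * ENNReal.ofReal |(f' x).det| ^ (1 - q) := by
  set u := ν.rnDeriv volume
  have hu : Measurable u := Measure.measurable_rnDeriv _ _
  have hνu : ν = volume.withDensity u := (Measure.withDensity_rnDeriv_eq _ _ hν).symm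
  set h : Space d → ℝ≥0∞ := fun y => u (g y) / ENNReal.ofReal |(f' (g y)).det|
  have hh : Measurable h :=
    (hu.comp hg).div ((hdetm.comp hg).abs.ennreal_ofReal)
  have hmap : ν.map f = volume.withDensity h := by
    conv_lhs => rw [hνu]
    exact map_eq_withDensity hf hdet hgf hfg u
  have hac : ν.map f ≪ volume := by
    rw [hmap]; exact withDensity_absolutelyContinuous _ _
  have hrn : (ν.map f).rnDeriv volume =ᵐ[volume] h := by
    rw [hmap]; exact Measure.rnDeriv_withDensity _ hh
  have hinj : InjOn f univ := fun x _ y _ h => by rw [← hgf x, h, hgf]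
  have himg : f '' univ = univ := image_univ_of_surjective fun y => ⟨g y, hfg y⟩
  have hcv := lintegral_image_eq_lintegral_abs_det_fderiv_mul volume MeasurableSet.univ
    (fun x _ => (hf x).hasFDerivWithinAt) hinj (fun y => h y ^ q)
  rw [himg, Measure.restrict_univ] at hcv
  have huΩ : ∀ᵐ x ∂volume, x ∉ Ω → u x = 0 := by
    rw [hνu, withDensity_apply _ hΩ.compl, lintegral_eq_zero_iff hu,
      Filter.EventuallyEq, ae_restrict_iff' hΩ.compl] at hνΩ
    exact hνΩ
  rw [Lq, if_pos hac]
  calc ∫⁻ x in Ω, (ν.map f).rnDeriv volume x ^ q ≤ ∫⁻ x, (ν.map f).rnDeriv volume x ^ q :=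
        setLIntegral_le_lintegral _ _
    _ = ∫⁻ x, h x ^ q := lintegral_congr_ae (hrn.mono fun x hx => by simp only [hx])
    _ = ∫⁻ x, Ω.indicator (fun x => u x ^ q * ENNReal.ofReal |(f' x).det| ^ (1 - q)) x := by
        rw [hcv]
        refine lintegral_congr_ae (huΩ.mono fun x hx => ?_)
        have h0 : ENNReal.ofReal |(f' x).det| ≠ 0 := by simpa using hdet x
        have e : ENNReal.ofReal |(f' x).det| * h (f x) ^ q
            = u x ^ q * ENNReal.ofReal |(f' x).det| ^ (1 - q) := by
          simp only [h, hgf]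
          rw [ENNReal.div_rpow_of_nonneg _ _ hq.le, ENNReal.rpow_sub _ _ h0 ENNReal.ofReal_ne_top,
            ENNReal.rpow_one, div_eq_mul_inv, div_eq_mul_inv]
          ring
        by_cases hxΩ : x ∈ Ω
        · simp only [indicator_of_mem hxΩ, e]
        · simp only [indicator_of_notMem hxΩ, e, hx hxΩ, ENNReal.zero_rpow_of_pos hq, zero_mul]
    _ = _ := lintegral_indicator hΩ _

end InternalEnergy

/-! ### Derivative of the Jacobian factor -/

section Determinant

open Filter Topology

lemma det_eq_matrix_det (A : Space d →L[ℝ] Space d) :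
    A.det = (Matrix.of fun i j : Fin d => A (EuclideanSpace.single j 1) i).det := by
  rw [ContinuousLinearMap.det, ← LinearMap.det_toMatrix (EuclideanSpace.basisFun (Fin d) ℝ).toBasis]
  congr 1

lemma contDiff_det : ContDiff ℝ ∞ fun A : Space d →L[ℝ] Space d => A.det := by
  simp_rw [det_eq_matrix_det, Matrix.det_apply]
  refine ContDiff.sum fun σ _ => ContDiff.const_smul _ (contDiff_prod fun i _ => ?_)
  exact ((EuclideanSpace.proj (𝕜 := ℝ) (σ i)).comp
    (ContinuousLinearMap.apply ℝ (Space d) (EuclideanSpace.single i (1:ℝ)))).contDiff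

/-- The factor `det (1 + A) ^ (1 - q)` by which `∫ u^q` changes under a map with derivative
`1 + A`. -/
noncomputable def detFactor (q : ℝ) (A : Space d →L[ℝ] Space d) : ℝ := (1 + A).det ^ (1 - q)

lemma det_one_clm : (1 : Space d →L[ℝ] Space d).det = 1 := by
  simp [ContinuousLinearMap.det]

lemma measurable_detFactor (q : ℝ) : Measurable (detFactor q : (Space d →L[ℝ] Space d) → ℝ) :=
  ((contDiff_det.continuous.comp (continuous_const.add continuous_id)).measurable).pow_const _

lemma detFactor_zero (q : ℝ) : detFactor q (0 : Space d →L[ℝ] Space d) = 1 := by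
  rw [detFactor, add_zero, det_one_clm, Real.one_rpow]

/-- The determinant is polynomial and equals 1 at the identity, so its power is C^1, hence
Lipschitz, near A = 0. -/
lemma exists_detFactor_lipschitz (d : ℕ) (q : ℝ) : ∃ r > 0, ∃ K : ℝ, 0 ≤ K ∧
    ∀ A A' : Space d →L[ℝ] Space d, ‖A‖ < r → ‖A'‖ < r →
      0 < (1 + A).det ∧ |detFactor q A - detFactor q A'| ≤ K * ‖A - A'‖ := by
  have hd : ContDiff ℝ 1 fun A : Space d →L[ℝ] Space d => (1 + A).det :=
    (contDiff_det.of_le (by exact_mod_cast le_top)).comp (contDiff_const.add contDiff_id)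
  have h0 : (1 + (0 : Space d →L[ℝ] Space d)).det = 1 := by rw [add_zero, det_one_clm]
  have hpos : ∀ᶠ A in 𝓝 (0 : Space d →L[ℝ] Space d), 0 < (1 + A).det :=
    hd.continuous.continuousAt.eventually_const_lt (by simp only [h0]; norm_num)
  have hk : ContDiffAt ℝ 1 (detFactor q : (Space d →L[ℝ] Space d) → ℝ) 0 :=
    hd.contDiffAt.rpow_const_of_ne (by rw [h0]; norm_num)
  obtain ⟨K, s, hs, hK⟩ := hk.exists_lipschitzOnWith
  obtain ⟨r, hr, hrs⟩ := Metric.eventually_nhds_iff.1 (hpos.and hs)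
  refine ⟨r, hr, K, K.2, fun A A' hA hA' => ?_⟩
  have h1 := hrs (y := A) (by simpa using hA)
  have h2 := hrs (y := A') (by simpa using hA')
  refine ⟨h1.1, ?_⟩
  have := hK.dist_le_mul A h1.2 A' h2.2
  rwa [Real.dist_eq, dist_eq_norm] at this

/-- From det(1 + εM) = 1 + ε tr M + O(ε²). This is the source of the factor 1 - q and, through the
trace, of the divergence. -/
lemma hasDerivAt_detFactor (q : ℝ) (A : Space d →L[ℝ] Space d) :
    HasDerivAt (fun ε : ℝ => detFactor q (ε • A))
      ((1 - q) * ∑ i, A (EuclideanSpace.single i 1) i) 0 := by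
  set M : Matrix (Fin d) (Fin d) ℝ := Matrix.of fun i j : Fin d => A (EuclideanSpace.single j 1) i
  have e : ∀ ε : ℝ, (1 + ε • A).det = (1 + ε • M).det := by
    intro ε
    rw [det_eq_matrix_det]
    congr 1
    ext i j
    simp [M, Matrix.one_apply, PiLp.single_apply]
  have h1 : HasDerivAt (fun ε : ℝ => (1 + ε • A).det) M.trace 0 := by
    set P := (Matrix.det (1 + (Polynomial.X : Polynomial ℝ) • M.map Polynomial.C)).divX.divX
    have e2 : (fun ε : ℝ => (1 + ε • A).det)
        = fun ε => 1 + M.trace * ε + P.eval ε * ε ^ 2 := by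
      funext ε; rw [e, Matrix.det_one_add_smul]
    rw [e2]
    have h2 : HasDerivAt (fun ε : ℝ => 1 + M.trace * ε + P.eval ε * ε ^ 2)
      (M.trace * 1 + (P.derivative.eval 0 * 0 ^ 2 + P.eval 0 * (2 * 0 ^ 1 * 1))) 0 :=
      ((((hasDerivAt_id (0:ℝ)).const_mul M.trace)).const_add 1).add
        ((P.hasDerivAt 0).mul ((hasDerivAt_id (0:ℝ)).pow 2))
    simpa using h2
  have h3 : ((1 : Space d →L[ℝ] Space d) + (0:ℝ) • A).det = 1 := by
    have h0 : (0:ℝ) • A = 0 := zero_smul ℝ A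
    rw [h0, add_zero, det_one_clm]
  have h4 := h1.rpow_const (p := 1 - q) (Or.inl (by rw [h3]; norm_num))
  rw [h3, Real.one_rpow] at h4
  convert! h4 using 1
  simp only [M, Matrix.trace, Matrix.diag, Matrix.of_apply]
  ring

end Determinant

/-! ### Differentiating the energy under the integral sign -/

section ParametricIntegral

open Filter Topology

variable {α : Type*} [MeasurableSpace α] {M : Measure α}

/-- Dominated differentiation; measurability of H' is not assumed, because H' is a limit of
difference quotients along a sequence. -/
lemma hasDerivAt_integral_of_abs_sub_le {H : ℝ → α → ℝ} {H' bound : α → ℝ} {ε₀ : ℝ} (hε₀ : 0 < ε₀)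
    (hmeas : ∀ ε, |ε| < ε₀ → AEStronglyMeasurable (H ε) M) (hint : Integrable (H 0) M)
    (hbound : Integrable bound M)
    (hlip : ∀ᵐ a ∂M, ∀ ε ε', |ε| < ε₀ → |ε'| < ε₀ → |H ε a - H ε' a| ≤ bound a * |ε - ε'|)
    (hdiff : ∀ᵐ a ∂M, HasDerivAt (fun ε => H ε a) (H' a) 0) :
    Integrable H' M ∧ HasDerivAt (fun ε => ∫ a, H ε a ∂M) (∫ a, H' a ∂M) 0 := by
  have hball : Metric.ball (0:ℝ) ε₀ ∈ 𝓝 (0:ℝ) := Metric.ball_mem_nhds 0 hε₀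
  have hH' : AEStronglyMeasurable H' M := by
    obtain ⟨u, -, hu, hu0⟩ := exists_seq_strictAnti_tendsto' hε₀
    refine aestronglyMeasurable_of_tendsto_ae atTop
      (f := fun n a => (u n)⁻¹ * (H (u n) a - H 0 a)) (fun n => ?_) ?_
    · have h1 : |u n| < ε₀ := by rw [abs_of_pos (hu n).1]; exact (hu n).2
      exact ((hmeas _ h1).sub hint.aestronglyMeasurable).const_mul _
    · filter_upwards [hdiff] with a ha
      have h1 := hasDerivAt_iff_tendsto_slope_zero.1 ha
      have h2 : Tendsto u atTop (𝓝[≠] 0) :=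
        tendsto_nhdsWithin_iff.2 ⟨hu0, Eventually.of_forall fun n => (hu n).1.ne'⟩
      simpa [Function.comp_def] using h1.comp h2
  refine hasDerivAt_integral_of_dominated_loc_of_lip (bound := bound) hball ?_ hint hH' ?_ hbound
    hdiff
  · filter_upwards [hball] with ε hε
    exact hmeas ε (by simpa using hε)
  · filter_upwards [hlip] with a ha
    refine LipschitzOnWith.of_dist_le_mul fun ε hε ε' hε' => ?_
    rw [Real.dist_eq, Real.dist_eq, Real.coe_nnabs]
    refine (ha ε ε' (by simpa using hε) (by simpa using hε')).trans ?_
    gcongr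
    exact le_abs_self _

lemma exists_rpow_mul_rpow_lipschitz (α β : ℝ) : ∃ L : ℝ, 0 ≤ L ∧
    ∀ x ∈ Icc (1 / 2 : ℝ) (3 / 2), ∀ y ∈ Icc (1 / 2 : ℝ) (3 / 2),
    ∀ x' ∈ Icc (1 / 2 : ℝ) (3 / 2), ∀ y' ∈ Icc (1 / 2 : ℝ) (3 / 2),
      |x ^ α * y ^ β - x' ^ α * y' ^ β| ≤ L * max |x - x'| |y - y'| := by
  have hcd : ContDiffOn ℝ 1 (fun z : ℝ × ℝ => z.1 ^ α * z.2 ^ β)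
      (Icc (1 / 2 : ℝ) (3 / 2) ×ˢ Icc (1 / 2 : ℝ) (3 / 2)) := by
    intro z hz
    have h1 : z.1 ≠ 0 := by have := hz.1.1; linarith
    have h2 : z.2 ≠ 0 := by have := hz.2.1; linarith
    exact ((contDiffAt_fst.rpow_const_of_ne h1).mul
      (contDiffAt_snd.rpow_const_of_ne h2)).contDiffWithinAt
  obtain ⟨K, hK⟩ := hcd.exists_lipschitzOnWith one_ne_zero
    ((convex_Icc _ _).prod (convex_Icc _ _)) (isCompact_Icc.prod isCompact_Icc)
  refine ⟨K, K.2, fun x hx y hy x' hx' y' hy' => ?_⟩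
  have := hK.dist_le_mul (x, y) ⟨hx, hy⟩ (x', y') ⟨hx', hy'⟩
  rwa [Real.dist_eq, Prod.dist_eq, Real.dist_eq, Real.dist_eq] at this

/-- Dividing by F and V brings all ratios into [1/2, 3/2], where x^α y^β is Lipschitz; multiplying
back gives a bound proportional to F^α V^β. If F or V vanishes, the relative bounds force the
corresponding perturbed values to vanish too. -/
lemma abs_rpow_mul_rpow_sub_le {α β : ℝ} (hα : 0 < α) (hβ : 0 < β) {L : ℝ} (hL0 : 0 ≤ L)
    (hL : ∀ x ∈ Icc (1 / 2 : ℝ) (3 / 2), ∀ y ∈ Icc (1 / 2 : ℝ) (3 / 2),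
      ∀ x' ∈ Icc (1 / 2 : ℝ) (3 / 2), ∀ y' ∈ Icc (1 / 2 : ℝ) (3 / 2),
      |x ^ α * y ^ β - x' ^ α * y' ^ β| ≤ L * max |x - x'| |y - y'|)
    {C : ℝ} {F V F₁ F₂ V₁ V₂ ε₁ ε₂ : ℝ} (hF : 0 ≤ F) (hV : 0 ≤ V)
    (h₁ : C * |ε₁| ≤ 1 / 2) (h₂ : C * |ε₂| ≤ 1 / 2)
    (hF₁ : |F₁ - F| ≤ C * F * |ε₁|) (hF₂ : |F₂ - F| ≤ C * F * |ε₂|)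
    (hV₁ : |V₁ - V| ≤ C * V * |ε₁|) (hV₂ : |V₂ - V| ≤ C * V * |ε₂|)
    (hF₃ : |F₁ - F₂| ≤ C * F * |ε₁ - ε₂|) (hV₃ : |V₁ - V₂| ≤ C * V * |ε₁ - ε₂|) :
    |F₁ ^ α * V₁ ^ β - F₂ ^ α * V₂ ^ β| ≤ L * C * (F ^ α * V ^ β) * |ε₁ - ε₂| := by
  rcases hF.eq_or_lt with rfl | hF'
  · have e1 : F₁ = 0 := by simpa using hF₁
    have e2 : F₂ = 0 := by simpa using hF₂
    simp [e1, e2, Real.zero_rpow hα.ne']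
  rcases hV.eq_or_lt with rfl | hV'
  · have e1 : V₁ = 0 := by simpa using hV₁
    have e2 : V₂ = 0 := by simpa using hV₂
    simp [e1, e2, Real.zero_rpow hβ.ne']
  have scale : ∀ {G G' e : ℝ}, 0 < G → |G' - G| ≤ C * G * |e| → C * |e| ≤ 1 / 2 →
      G' / G ∈ Icc (1 / 2 : ℝ) (3 / 2) := by
    intro G G' e hG hle he
    have h3 : |G' - G| ≤ G / 2 := by nlinarith
    rw [abs_le] at h3
    constructor
    · rw [le_div_iff₀ hG]; linarith
    · rw [div_le_iff₀ hG]; linarith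
  have scale2 : ∀ {G G' G'' : ℝ}, 0 < G → |G' - G''| ≤ C * G * |ε₁ - ε₂| →
      |G' / G - G'' / G| ≤ C * |ε₁ - ε₂| := by
    intro G G' G'' hG hle
    rw [← sub_div, abs_div, abs_of_pos hG, div_le_iff₀ hG]
    linarith
  have key := hL _ (scale hF' hF₁ h₁) _ (scale hV' hV₁ h₁) _ (scale hF' hF₂ h₂) _
    (scale hV' hV₂ h₂)
  have nonneg : ∀ {G G' e : ℝ}, 0 < G → |G' - G| ≤ C * G * |e| → C * |e| ≤ 1 / 2 → 0 ≤ G' := by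
    intro G G' e hG hle he
    have := (scale hG hle he).1
    rw [le_div_iff₀ hG] at this
    linarith
  rw [Real.div_rpow (nonneg hF' hF₁ h₁) hF, Real.div_rpow (nonneg hF' hF₂ h₂) hF,
    Real.div_rpow (nonneg hV' hV₁ h₁) hV, Real.div_rpow (nonneg hV' hV₂ h₂) hV,
    div_mul_div_comm, div_mul_div_comm, ← sub_div, abs_div,
    abs_of_pos (by positivity : 0 < F ^ α * V ^ β), div_le_iff₀ (by positivity)] at key
  refine key.trans ?_
  have := max_le (scale2 hF' hF₃) (scale2 hV' hV₃)
  calc L * max |F₁ / F - F₂ / F| |V₁ / V - V₂ / V| * (F ^ α * V ^ β)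
      ≤ L * (C * |ε₁ - ε₂|) * (F ^ α * V ^ β) := by gcongr
    _ = _ := by ring

/-- Powers with exponent below 1 are not differentiable at 0, but if F 0 = 0 the relative Lipschitz
bound forces F = 0 near ε = 0 and F' = 0, so both sides vanish; likewise for V. -/
lemma hasDerivAt_rpow_mul_rpow {α β : ℝ} (hα : 0 < α) (hβ : 0 < β) {C ε₀ : ℝ} (hε₀ : 0 < ε₀)
    {F V : ℝ → ℝ} {F' V' : ℝ}
    (hFl : ∀ ε, |ε| < ε₀ → |F ε - F 0| ≤ C * F 0 * |ε|)
    (hVl : ∀ ε, |ε| < ε₀ → |V ε - V 0| ≤ C * V 0 * |ε|)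
    (hF : HasDerivAt F F' 0) (hV : HasDerivAt V V' 0) :
    HasDerivAt (fun ε => F ε ^ α * V ε ^ β)
      (α * (F 0 ^ (α - 1) * V 0 ^ β * F') + β * (F 0 ^ α * V 0 ^ (β - 1) * V')) 0 := by
  have hev : ∀ᶠ ε in 𝓝 (0:ℝ), |ε| < ε₀ :=
    ContinuousAt.eventually_lt (by fun_prop) continuousAt_const (by simpa using hε₀)
  have hzero : ∀ {G : ℝ → ℝ} {G' : ℝ}, (∀ ε, |ε| < ε₀ → |G ε - G 0| ≤ C * G 0 * |ε|) → G 0 = 0 →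
      HasDerivAt G G' 0 → (∀ᶠ ε in 𝓝 (0:ℝ), G ε = 0) ∧ G' = 0 := by
    intro G G' hl h0 hd
    have h1 : ∀ᶠ ε in 𝓝 (0:ℝ), G ε = 0 := hev.mono fun ε hε => by simpa [h0] using hl ε hε
    have h2 : HasDerivAt G 0 0 := (hasDerivAt_const (0:ℝ) (0:ℝ)).congr_of_eventuallyEq h1
    exact ⟨h1, hd.unique h2⟩
  by_cases hF0 : F 0 = 0
  · obtain ⟨h1, rfl⟩ := hzero hFl hF0 hF
    have : (fun ε => F ε ^ α * V ε ^ β) =ᶠ[𝓝 0] fun _ => 0 :=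
      h1.mono fun ε hε => by simp [hε, Real.zero_rpow hα.ne']
    simpa [hF0, Real.zero_rpow hα.ne'] using (hasDerivAt_const (0:ℝ) (0:ℝ)).congr_of_eventuallyEq this
  by_cases hV0 : V 0 = 0
  · obtain ⟨h1, rfl⟩ := hzero hVl hV0 hV
    have : (fun ε => F ε ^ α * V ε ^ β) =ᶠ[𝓝 0] fun _ => 0 :=
      h1.mono fun ε hε => by simp [hε, Real.zero_rpow hβ.ne']
    simpa [hV0, Real.zero_rpow hβ.ne'] using (hasDerivAt_const (0:ℝ) (0:ℝ)).congr_of_eventuallyEq this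
  convert! (hF.rpow_const (p := α) (Or.inl hF0)).mul (hV.rpow_const (p := β) (Or.inl hV0)) using 1
  ring

/-- The relative Lipschitz bounds make a multiple of F_0^α V_0^β a dominating function, which is
integrable by `hint`. Integrability for small ε is recorded because the comparison of energies has
to pass from `∫⁻` to `∫`. -/
lemma hasDerivAt_integral_rpow_mul_rpow {α' β : ℝ} (hα : 0 < α') (hβ : 0 < β) {C ε₀ : ℝ}
    (hC : 0 ≤ C) (hε₀ : 0 < ε₀) {F V : ℝ → α → ℝ} {F' V' : α → ℝ}
    (hFm : ∀ ε, |ε| < ε₀ → AEStronglyMeasurable (F ε) M)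
    (hVm : ∀ ε, |ε| < ε₀ → AEStronglyMeasurable (V ε) M)
    (hF0 : ∀ᵐ a ∂M, 0 ≤ F 0 a) (hV0 : ∀ᵐ a ∂M, 0 ≤ V 0 a)
    (hFl : ∀ᵐ a ∂M, ∀ ε ε', |ε| < ε₀ → |ε'| < ε₀ → |F ε a - F ε' a| ≤ C * F 0 a * |ε - ε'|)
    (hVl : ∀ᵐ a ∂M, ∀ ε ε', |ε| < ε₀ → |ε'| < ε₀ → |V ε a - V ε' a| ≤ C * V 0 a * |ε - ε'|)
    (hFd : ∀ᵐ a ∂M, HasDerivAt (fun ε => F ε a) (F' a) 0)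
    (hVd : ∀ᵐ a ∂M, HasDerivAt (fun ε => V ε a) (V' a) 0)
    (hint : Integrable (fun a => F 0 a ^ α' * V 0 a ^ β) M) :
    Integrable (fun a => α' * (F 0 a ^ (α' - 1) * V 0 a ^ β * F' a)
      + β * (F 0 a ^ α' * V 0 a ^ (β - 1) * V' a)) M ∧
    HasDerivAt (fun ε => ∫ a, F ε a ^ α' * V ε a ^ β ∂M)
      (∫ a, (α' * (F 0 a ^ (α' - 1) * V 0 a ^ β * F' a)
        + β * (F 0 a ^ α' * V 0 a ^ (β - 1) * V' a)) ∂M) 0 ∧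
    ∀ᶠ ε in 𝓝 (0:ℝ), Integrable (fun a => F ε a ^ α' * V ε a ^ β) M := by
  obtain ⟨L, hL0, hL⟩ := exists_rpow_mul_rpow_lipschitz α' β
  -- This radius gives C|ε| ≤ 1/2, which keeps the ratios in [1/2, 3/2].
  set ε₁ := min ε₀ (1 / (2 * (C + 1)))
  have hε₁ : 0 < ε₁ := by positivity
  have hlt : ∀ {ε : ℝ}, |ε| < ε₁ → |ε| < ε₀ := fun h => h.trans_le (min_le_left _ _)
  have hhalf : ∀ {ε : ℝ}, |ε| < ε₁ → C * |ε| ≤ 1 / 2 := by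
    intro ε h
    have h1 : |ε| ≤ 1 / (2 * (C + 1)) := h.le.trans (min_le_right _ _)
    calc C * |ε| ≤ (C + 1) * (1 / (2 * (C + 1))) := by gcongr; linarith
      _ = 1 / 2 := by field_simp
  have h00 : |(0:ℝ)| < ε₀ := by simpa using hε₀
  have hmeas : ∀ ε, |ε| < ε₁ → AEStronglyMeasurable (fun a => F ε a ^ α' * V ε a ^ β) M :=
    fun ε hε => ((hFm ε (hlt hε)).aemeasurable.pow_const _).aestronglyMeasurable.mul
      ((hVm ε (hlt hε)).aemeasurable.pow_const _).aestronglyMeasurable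
  have hlip : ∀ᵐ a ∂M, ∀ ε ε', |ε| < ε₁ → |ε'| < ε₁ →
      |F ε a ^ α' * V ε a ^ β - F ε' a ^ α' * V ε' a ^ β|
        ≤ L * C * (F 0 a ^ α' * V 0 a ^ β) * |ε - ε'| := by
    filter_upwards [hF0, hV0, hFl, hVl] with a a1 a2 a3 a4 ε ε' hε hε'
    refine abs_rpow_mul_rpow_sub_le hα hβ hL0 hL a1 a2 (hhalf hε) (hhalf hε') ?_ ?_ ?_ ?_
      (a3 ε ε' (hlt hε) (hlt hε')) (a4 ε ε' (hlt hε) (hlt hε'))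
    · simpa using a3 ε 0 (hlt hε) h00
    · simpa using a3 ε' 0 (hlt hε') h00
    · simpa using a4 ε 0 (hlt hε) h00
    · simpa using a4 ε' 0 (hlt hε') h00
  have hbd : Integrable (fun a => L * C * (F 0 a ^ α' * V 0 a ^ β)) M := hint.const_mul _
  obtain ⟨i1, i2⟩ := hasDerivAt_integral_of_abs_sub_le hε₁ hmeas hint hbd hlip
    (H' := fun a => α' * (F 0 a ^ (α' - 1) * V 0 a ^ β * F' a)
        + β * (F 0 a ^ α' * V 0 a ^ (β - 1) * V' a)) (by
      filter_upwards [hFl, hVl, hFd, hVd] with a a3 a4 a5 a6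
      exact hasDerivAt_rpow_mul_rpow hα hβ hε₀
        (F := fun ε => F ε a) (V := fun ε => V ε a)
        (fun ε hε => by simpa using a3 ε 0 hε h00)
        (fun ε hε => by simpa using a4 ε 0 hε h00) a5 a6)
  refine ⟨i1, i2, ?_⟩
  have hev : ∀ᶠ ε in 𝓝 (0:ℝ), |ε| < ε₁ :=
    ContinuousAt.eventually_lt (by fun_prop) continuousAt_const (by simpa using hε₁)
  filter_upwards [hev] with ε hε
  have h1 : Integrable (fun a => F ε a ^ α' * V ε a ^ β - F 0 a ^ α' * V 0 a ^ β) M := by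
    refine Integrable.mono' (hbd.mul_const |ε|) ((hmeas ε hε).sub hint.aestronglyMeasurable) ?_
    filter_upwards [hlip] with a ha
    simpa using ha ε 0 hε (by simpa using hε₁)
  exact (h1.add hint).congr (ae_of_all _ fun a => sub_add_cancel _ _)

end ParametricIntegral

/-! ### The p-th power of the norm along a line -/

section NormPow

lemma abs_rpow_sub_rpow_le {p : ℝ} (hp : 1 < p) {M x y : ℝ} (hx : x ∈ Icc 0 M)
    (hy : y ∈ Icc 0 M) : |x ^ p - y ^ p| ≤ p * M ^ (p - 1) * |x - y| := by
  have := (convex_Icc (0:ℝ) M).norm_image_sub_le_of_norm_hasDerivWithin_le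
    (f := fun x : ℝ => x ^ p) (f' := fun x => p * x ^ (p - 1)) (C := p * M ^ (p - 1))
    (fun z _ => (Real.hasDerivAt_rpow_const (Or.inr hp.le)).hasDerivWithinAt)
    (fun z hz => by
      rw [Real.norm_of_nonneg (mul_nonneg (by linarith) (Real.rpow_nonneg hz.1 _))]
      exact mul_le_mul_of_nonneg_left (Real.rpow_le_rpow hz.1 hz.2 (by linarith)) (by linarith))
    hy hx
  simpa using this

variable {E : Type*} [NormedAddCommGroup E] [InnerProductSpace ℝ E]

/-- Both norms are at most M = (1 + B)(1 + ‖a‖), so the mean value theorem gives p M^(p-1) · M|ε -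
ε'|. The term 1 next to ‖a‖^p cannot be dropped, since z need not vanish with a. -/
lemma abs_norm_add_smul_rpow_sub_le {p : ℝ} (hp : 1 < p) {B : ℝ} (hB : 0 ≤ B) {a z : E}
    (hz : ‖z‖ ≤ B * (1 + ‖a‖)) {ε ε' : ℝ} (hε : |ε| ≤ 1) (hε' : |ε'| ≤ 1) :
    |‖a + ε • z‖ ^ p - ‖a + ε' • z‖ ^ p|
      ≤ p * ((1 + B) ^ p * 2 ^ p) * (‖a‖ ^ p + 1) * |ε - ε'| := by
  set M := (1 + B) * (1 + ‖a‖)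
  have hM : 0 < M := by positivity
  have hmem : ∀ e : ℝ, |e| ≤ 1 → ‖a + e • z‖ ∈ Icc 0 M := fun e he => by
    refine ⟨norm_nonneg _, (norm_add_le _ _).trans ?_⟩
    rw [norm_smul, Real.norm_eq_abs]
    have : |e| * ‖z‖ ≤ 1 * (B * (1 + ‖a‖)) := by gcongr
    simp only [M]; linarith
  have h1 := abs_rpow_sub_rpow_le hp (hmem ε hε) (hmem ε' hε')
  have h2 : |‖a + ε • z‖ - ‖a + ε' • z‖| ≤ |ε - ε'| * M := by
    refine (abs_norm_sub_norm_le _ _).trans ?_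
    rw [add_sub_add_left_eq_sub, ← sub_smul, norm_smul, Real.norm_eq_abs]
    gcongr
    simp only [M]; nlinarith [norm_nonneg a]
  have h3 : (1 + ‖a‖) ^ p ≤ 2 ^ p * (‖a‖ ^ p + 1) := by
    have h4 : 1 + ‖a‖ ≤ 2 * max 1 ‖a‖ := by
      have := le_max_left 1 ‖a‖; have := le_max_right 1 ‖a‖; linarith
    calc (1 + ‖a‖) ^ p ≤ (2 * max 1 ‖a‖) ^ p :=
          Real.rpow_le_rpow (by positivity) h4 (by linarith)
      _ = 2 ^ p * (max 1 ‖a‖) ^ p := Real.mul_rpow (by norm_num) (by positivity)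
      _ ≤ 2 ^ p * (‖a‖ ^ p + 1) := by
          gcongr
          rcases max_choice 1 ‖a‖ with h | h <;> rw [h]
          · rw [Real.one_rpow]; linarith [Real.rpow_nonneg (norm_nonneg a) p]
          · linarith
  calc _ ≤ p * M ^ (p - 1) * (|ε - ε'| * M) := h1.trans (by gcongr)
    _ = p * M ^ p * |ε - ε'| := by rw [Real.rpow_sub_one hM.ne']; field_simp
    _ = p * ((1 + B) ^ p * (1 + ‖a‖) ^ p) * |ε - ε'| := by
        rw [Real.mul_rpow (by positivity) (by positivity)]
    _ ≤ p * ((1 + B) ^ p * (2 ^ p * (‖a‖ ^ p + 1))) * |ε - ε'| := by gcongr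
    _ = _ := by ring

lemma hasDerivAt_norm_add_smul_rpow {p : ℝ} (hp : 1 < p) (a z : E) :
    HasDerivAt (fun ε : ℝ => ‖a + ε • z‖ ^ p) (p * (‖a‖ ^ (p - 2) * inner ℝ z a)) 0 := by
  have h1 : HasDerivAt (fun ε : ℝ => a + ε • z) z 0 := by
    simpa using ((hasDerivAt_id (0:ℝ)).smul_const z).const_add a
  have h2 := (hasFDerivAt_norm_rpow (a + (0:ℝ) • z) hp).comp_hasDerivAt 0 h1
  convert! h2 using 1
  simp [real_inner_comm, mul_assoc]

end NormPow

/-! ### Variation of the two factors at a fixed time -/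

section SliceDerivatives

open Filter Topology

lemma zero_smul_clm (A : Space d →L[ℝ] Space d) : (0 : ℝ) • A = 0 := zero_smul ℝ A

lemma sub_smul_clm (a b : ℝ) (A : Space d →L[ℝ] Space d) : (a - b) • A = a • A - b • A :=
  sub_smul a b A

lemma measurable_density (ν : Measure (Space d)) : Measurable (density ν) :=
  (Measure.measurable_rnDeriv _ _).ennreal_toReal

lemma density_nonneg (ν : Measure (Space d)) (x : Space d) : 0 ≤ density ν x :=
  ENNReal.toReal_nonneg

lemma integrableOn_density_rpow {q : ℝ} {Ω : Set (Space d)} {ν : Measure (Space d)}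
    (hν : ν ≪ volume) (hL : Lq q Ω ν ≠ ⊤) :
    IntegrableOn (fun x => density ν x ^ q) Ω ∧
      (Lq q Ω ν).toReal = ∫ x in Ω, density ν x ^ q := by
  rw [Lq, if_pos hν] at hL ⊢
  have hm : Measurable fun x => ν.rnDeriv volume x ^ q :=
    (Measure.measurable_rnDeriv _ _).pow_const q
  have h1 := integrable_toReal_of_lintegral_ne_top hm.aemeasurable hL
  have h2 := integral_toReal hm.aemeasurable (ae_lt_top hm hL)
  simp only [← ENNReal.toReal_rpow] at h1 h2
  exact ⟨h1, h2.symm⟩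

/-- `∫_Ω u^q det (1 + ε D)^(1 - q)`. -/
noncomputable def internalAlong (q : ℝ) (Ω : Set (Space d)) (ν : Measure (Space d))
    (D : Space d → Space d →L[ℝ] Space d) (ε : ℝ) : ℝ :=
  ∫ x in Ω, density ν x ^ q * detFactor q (ε • D x)

/-- `∫ |a + ε z|^p dν`. -/
noncomputable def kineticAlong (p : ℝ) (ν : Measure (Space d)) (a z : Space d → Space d)
    (ε : ℝ) : ℝ :=
  ∫ x, ‖a x + ε • z x‖ ^ p ∂ν

lemma internalAlong_zero {q : ℝ} {Ω : Set (Space d)} {ν : Measure (Space d)}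
    (hν : ν ≪ volume) (hL : Lq q Ω ν ≠ ⊤) (D : Space d → Space d →L[ℝ] Space d) :
    internalAlong q Ω ν D 0 = (Lq q Ω ν).toReal := by
  rw [(integrableOn_density_rpow hν hL).2]
  simp [internalAlong, zero_smul_clm, detFactor_zero]

section Internal

variable {q B r K ε₀ : ℝ} {Ω : Set (Space d)} {ν : Measure (Space d)}
  {D : Space d → Space d →L[ℝ] Space d}

lemma norm_smul_lt_of_abs_lt (hB : ∀ x, ‖D x‖ ≤ B) (hε₀ : ε₀ * B ≤ r) (hr : 0 < r) {ε : ℝ}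
    (hε : |ε| < ε₀) (x : Space d) : ‖ε • D x‖ < r := by
  rw [norm_smul, Real.norm_eq_abs]
  rcases (norm_nonneg (D x)).eq_or_lt with h | h
  · rw [← h, mul_zero]; exact hr
  · calc |ε| * ‖D x‖ < ε₀ * ‖D x‖ := by gcongr
      _ ≤ ε₀ * B := by
          gcongr
          · exact (abs_nonneg ε).trans hε.le
          · exact hB x
      _ ≤ r := hε₀

lemma abs_internal_integrand_sub_le (hK0 : 0 ≤ K) (hr : 0 < r)
    (hK : ∀ A A' : Space d →L[ℝ] Space d, ‖A‖ < r → ‖A'‖ < r →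
      0 < (1 + A).det ∧ |detFactor q A - detFactor q A'| ≤ K * ‖A - A'‖)
    (hB : ∀ x, ‖D x‖ ≤ B) (hε₀ : ε₀ * B ≤ r) {ε ε' : ℝ} (hε : |ε| < ε₀) (hε' : |ε'| < ε₀)
    (x : Space d) :
    |density ν x ^ q * detFactor q (ε • D x) - density ν x ^ q * detFactor q (ε' • D x)|
      ≤ K * B * density ν x ^ q * |ε - ε'| := by
  have hd : 0 ≤ density ν x ^ q := Real.rpow_nonneg (density_nonneg ν x) q
  rw [← mul_sub, abs_mul, abs_of_nonneg hd]
  have h1 := (hK _ _ (norm_smul_lt_of_abs_lt hB hε₀ hr hε x)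
    (norm_smul_lt_of_abs_lt hB hε₀ hr hε' x)).2
  rw [← sub_smul_clm, norm_smul, Real.norm_eq_abs] at h1
  calc _ ≤ density ν x ^ q * (K * (|ε - ε'| * B)) := by
        gcongr
        exact h1.trans (by gcongr; exact hB x)
    _ = _ := by ring

lemma measurable_internal_integrand (hD : Measurable D) (ε : ℝ) :
    Measurable fun x => density ν x ^ q * detFactor q (ε • D x) :=
  ((measurable_density ν).pow_const q).mul ((measurable_detFactor q).comp (hD.const_smul ε))

lemma integrableOn_internal_integrand (hK0 : 0 ≤ K) (hr : 0 < r)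
    (hK : ∀ A A' : Space d →L[ℝ] Space d, ‖A‖ < r → ‖A'‖ < r →
      0 < (1 + A).det ∧ |detFactor q A - detFactor q A'| ≤ K * ‖A - A'‖)
    (hB : ∀ x, ‖D x‖ ≤ B) (hε₀ : ε₀ * B ≤ r) (hD : Measurable D) (hν : ν ≪ volume)
    (hL : Lq q Ω ν ≠ ⊤) {ε : ℝ} (hε : |ε| < ε₀) :
    IntegrableOn (fun x => density ν x ^ q * detFactor q (ε • D x)) Ω := by
  have hI := (integrableOn_density_rpow hν hL).1
  have h1 : IntegrableOn (fun x => density ν x ^ q * detFactor q (ε • D x) - density ν x ^ q) Ω := by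
    refine Integrable.mono' ((hI.const_mul (K * B)).mul_const |ε|)
      ((measurable_internal_integrand hD ε).sub
        ((measurable_density ν).pow_const q)).aestronglyMeasurable (ae_of_all _ fun x => ?_)
    have := abs_internal_integrand_sub_le (ν := ν) hK0 hr hK hB hε₀ hε (ε' := 0)
      (by simpa using (abs_nonneg ε).trans_lt hε) x
    simpa [zero_smul_clm, detFactor_zero] using this
  exact (h1.add hI).congr (ae_of_all _ fun x => sub_add_cancel _ _)

lemma abs_internalAlong_sub_le (hK0 : 0 ≤ K) (hr : 0 < r)
    (hK : ∀ A A' : Space d →L[ℝ] Space d, ‖A‖ < r → ‖A'‖ < r →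
      0 < (1 + A).det ∧ |detFactor q A - detFactor q A'| ≤ K * ‖A - A'‖)
    (hB : ∀ x, ‖D x‖ ≤ B) (hε₀ : ε₀ * B ≤ r) (hD : Measurable D) (hν : ν ≪ volume)
    (hL : Lq q Ω ν ≠ ⊤) {ε ε' : ℝ} (hε : |ε| < ε₀) (hε' : |ε'| < ε₀) :
    |internalAlong q Ω ν D ε - internalAlong q Ω ν D ε'|
      ≤ K * B * internalAlong q Ω ν D 0 * |ε - ε'| := by
  obtain ⟨hI, hI2⟩ := integrableOn_density_rpow hν hL
  rw [internalAlong_zero hν hL, hI2, internalAlong, internalAlong,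
    ← integral_sub (integrableOn_internal_integrand hK0 hr hK hB hε₀ hD hν hL hε)
      (integrableOn_internal_integrand hK0 hr hK hB hε₀ hD hν hL hε'),
    ← integral_const_mul, ← integral_mul_const, ← Real.norm_eq_abs]
  exact norm_integral_le_of_norm_le ((hI.const_mul (K * B)).mul_const _)
    (ae_of_all _ fun x => abs_internal_integrand_sub_le hK0 hr hK hB hε₀ hε hε' x)

lemma hasDerivAt_internalAlong (hK0 : 0 ≤ K) (hr : 0 < r)
    (hK : ∀ A A' : Space d →L[ℝ] Space d, ‖A‖ < r → ‖A'‖ < r →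
      0 < (1 + A).det ∧ |detFactor q A - detFactor q A'| ≤ K * ‖A - A'‖)
    (hB : ∀ x, ‖D x‖ ≤ B) (hε₀ : ε₀ * B ≤ r) (hε₀pos : 0 < ε₀) (hD : Measurable D)
    (hν : ν ≪ volume) (hL : Lq q Ω ν ≠ ⊤) :
    IntegrableOn (fun x => density ν x ^ q
      * ((1 - q) * ∑ i, D x (EuclideanSpace.single i 1) i)) Ω ∧
    HasDerivAt (internalAlong q Ω ν D)
      (∫ x in Ω, density ν x ^ q * ((1 - q) * ∑ i, D x (EuclideanSpace.single i 1) i)) 0 := by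
  have hI := (integrableOn_density_rpow hν hL).1
  exact hasDerivAt_integral_of_abs_sub_le hε₀pos
    (fun ε _ => (measurable_internal_integrand hD ε).aestronglyMeasurable)
    (integrableOn_internal_integrand hK0 hr hK hB hε₀ hD hν hL (by simpa using hε₀pos))
    (hI.const_mul (K * B))
    (ae_of_all _ fun x ε ε' hε hε' => abs_internal_integrand_sub_le hK0 hr hK hB hε₀ hε hε' x)
    (ae_of_all _ fun x => (hasDerivAt_detFactor q (D x)).const_mul _)

lemma ofReal_internalAlong (hK0 : 0 ≤ K) (hr : 0 < r)
    (hK : ∀ A A' : Space d →L[ℝ] Space d, ‖A‖ < r → ‖A'‖ < r →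
      0 < (1 + A).det ∧ |detFactor q A - detFactor q A'| ≤ K * ‖A - A'‖)
    (hB : ∀ x, ‖D x‖ ≤ B) (hε₀ : ε₀ * B ≤ r) (hD : Measurable D) (hq : 0 < q)
    [IsFiniteMeasure ν] (hν : ν ≪ volume)
    (hL : Lq q Ω ν ≠ ⊤) {ε : ℝ} (hε : |ε| < ε₀) :
    ENNReal.ofReal (internalAlong q Ω ν D ε)
      = ∫⁻ x in Ω, ν.rnDeriv volume x ^ q * ENNReal.ofReal |(1 + ε • D x).det| ^ (1 - q) := by
  have hdet : ∀ x, 0 < (1 + ε • D x).det := fun x =>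
    (hK _ 0 (norm_smul_lt_of_abs_lt hB hε₀ hr hε x) (by simpa using hr)).1
  rw [internalAlong, ofReal_integral_eq_lintegral_ofReal
    (integrableOn_internal_integrand hK0 hr hK hB hε₀ hD hν hL hε)
    (ae_of_all _ fun x => mul_nonneg (Real.rpow_nonneg (density_nonneg ν x) q)
      (Real.rpow_nonneg (hdet x).le _))]
  refine lintegral_congr_ae (ae_restrict_of_ae ?_)
  filter_upwards [ν.rnDeriv_lt_top volume] with x hx
  rw [ENNReal.ofReal_mul (Real.rpow_nonneg (density_nonneg ν x) q), abs_of_pos (hdet x),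
    ENNReal.ofReal_rpow_of_pos (hdet x), ← ENNReal.ofReal_rpow_of_nonneg (density_nonneg ν x) hq.le,
    density, ENNReal.ofReal_toReal hx.ne]
  rfl

end Internal

section Kinetic

variable {p B : ℝ} {ν : Measure (Space d)} {a z : Space d → Space d}

lemma integrable_norm_rpow_of_memLp (hp : 1 < p) (ha : MemLp a (ENNReal.ofReal p) ν) :
    Integrable (fun x => ‖a x‖ ^ p) ν := by
  have := ha.integrable_norm_rpow (by simp; linarith) ENNReal.ofReal_ne_top
  rwa [ENNReal.toReal_ofReal (by linarith)] at this

lemma memLp_add_smul [IsFiniteMeasure ν] (ha : MemLp a (ENNReal.ofReal p) ν)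
    (hz : AEStronglyMeasurable z ν) (hzB : ∀ x, ‖z x‖ ≤ B * (1 + ‖a x‖)) (ε : ℝ) :
    MemLp (fun x => a x + ε • z x) (ENNReal.ofReal p) ν := by
  have hbd : MemLp (fun x => B * (1 + ‖a x‖)) (ENNReal.ofReal p) ν :=
    ((memLp_const (1:ℝ)).add ha.norm).const_mul B
  exact ha.add ((hbd.mono' hz (ae_of_all _ hzB)).const_smul ε)

lemma abs_kineticAlong_sub_le [IsProbabilityMeasure ν] (hp : 1 < p) (hB : 0 ≤ B)
    (ha : MemLp a (ENNReal.ofReal p) ν) (hz : AEStronglyMeasurable z ν)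
    (hzB : ∀ x, ‖z x‖ ≤ B * (1 + ‖a x‖)) {ε ε' : ℝ} (hε : |ε| ≤ 1) (hε' : |ε'| ≤ 1) :
    |kineticAlong p ν a z ε - kineticAlong p ν a z ε'|
      ≤ p * ((1 + B) ^ p * 2 ^ p) * (kineticAlong p ν a z 0 + 1) * |ε - ε'| := by
  have hI := integrable_norm_rpow_of_memLp hp ha
  have hI2 : Integrable (fun x => ‖a x‖ ^ p + 1) ν := hI.add (integrable_const 1)
  have e : kineticAlong p ν a z 0 + 1 = ∫ x, (‖a x‖ ^ p + 1) ∂ν := by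
    rw [integral_add hI (integrable_const 1)]
    simp [kineticAlong]
  rw [e, kineticAlong, kineticAlong,
    ← integral_sub (integrable_norm_rpow_of_memLp hp (memLp_add_smul ha hz hzB ε))
      (integrable_norm_rpow_of_memLp hp (memLp_add_smul ha hz hzB ε')),
    ← integral_const_mul, ← integral_mul_const, ← Real.norm_eq_abs]
  exact norm_integral_le_of_norm_le ((hI2.const_mul _).mul_const _)
    (ae_of_all _ fun x => abs_norm_add_smul_rpow_sub_le hp hB (hzB x) hε hε')

lemma hasDerivAt_kineticAlong [IsProbabilityMeasure ν] (hp : 1 < p) (hB : 0 ≤ B)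
    (ha : MemLp a (ENNReal.ofReal p) ν) (hz : AEStronglyMeasurable z ν)
    (hzB : ∀ x, ‖z x‖ ≤ B * (1 + ‖a x‖)) :
    Integrable (fun x => p * (‖a x‖ ^ (p - 2) * inner ℝ (z x) (a x))) ν ∧
    HasDerivAt (kineticAlong p ν a z)
      (∫ x, p * (‖a x‖ ^ (p - 2) * inner ℝ (z x) (a x)) ∂ν) 0 := by
  have hI := integrable_norm_rpow_of_memLp hp ha
  have hI2 : Integrable (fun x => ‖a x‖ ^ p + 1) ν := hI.add (integrable_const 1)
  exact hasDerivAt_integral_of_abs_sub_le one_pos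
    (fun ε _ => (integrable_norm_rpow_of_memLp hp (memLp_add_smul ha hz hzB ε)).aestronglyMeasurable)
    (integrable_norm_rpow_of_memLp hp (memLp_add_smul ha hz hzB 0))
    (hI2.const_mul _)
    (ae_of_all _ fun x ε ε' hε hε' => abs_norm_add_smul_rpow_sub_le hp hB (hzB x) hε.le hε'.le)
    (ae_of_all _ fun x => hasDerivAt_norm_add_smul_rpow hp (a x) (z x))

lemma ofReal_kineticAlong [IsFiniteMeasure ν] (hp : 1 < p)
    (ha : MemLp a (ENNReal.ofReal p) ν) (hz : AEStronglyMeasurable z ν)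
    (hzB : ∀ x, ‖z x‖ ≤ B * (1 + ‖a x‖)) (ε : ℝ) :
    ENNReal.ofReal (kineticAlong p ν a z ε) = ∫⁻ x, ‖a x + ε • z x‖ₑ ^ p ∂ν := by
  rw [kineticAlong, ofReal_integral_eq_lintegral_ofReal
    (integrable_norm_rpow_of_memLp hp (memLp_add_smul ha hz hzB ε))
    (ae_of_all _ fun x => by positivity)]
  refine lintegral_congr fun x => ?_
  rw [← ENNReal.ofReal_rpow_of_nonneg (norm_nonneg _) (by linarith), ofReal_norm]

end Kinetic

/-- The density vanishes a.e. outside Ω, so restricting to Ω loses nothing. -/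
lemma integral_density_mul {Ω : Set (Space d)} {ν : Measure (Space d)} [IsFiniteMeasure ν]
    (hΩ : MeasurableSet Ω) (hν : ν ≪ volume) (hνΩ : ν Ωᶜ = 0) (f : Space d → ℝ) :
    (Integrable f ν → IntegrableOn (fun x => density ν x * f x) Ω) ∧
      ∫ x in Ω, density ν x * f x = ∫ x, f x ∂ν := by
  constructor
  · intro hf
    exact ((integrable_rnDeriv_smul_iff hν).2 hf).integrableOn
  · rw [← integral_rnDeriv_smul hν]
    refine setIntegral_eq_integral_of_ae_compl_eq_zero ?_
    have h1 : ∀ᵐ x ∂volume, x ∉ Ω → ν.rnDeriv volume x = 0 := by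
      rw [← Measure.withDensity_rnDeriv_eq _ _ hν, withDensity_apply _ hΩ.compl,
        lintegral_eq_zero_iff (Measure.measurable_rnDeriv _ _),
        Filter.EventuallyEq, ae_restrict_iff' hΩ.compl] at hνΩ
      exact hνΩ
    filter_upwards [h1] with x hx hxΩ
    simp [density, hx hxΩ]

end SliceDerivatives

/-! ### Measurability in time of the two factors -/

section JointMeasurability

open ProbabilityTheory

/-- Slice densities are only fixed up to null sets, so a jointly measurable choice comes from the
Radon-Nikodym derivative of kernels. It is taken against a finite measure σ equivalent to Lebesgue
measure, then multiplied by the density of σ. -/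
lemma exists_joint_density (κ : Kernel ℝ (Space d)) [IsMarkovKernel κ] :
    ∃ U : ℝ × Space d → ℝ≥0∞, Measurable U ∧
      ∀ t, κ t ≪ volume → (fun x => U (t, x)) =ᵐ[volume] (κ t).rnDeriv volume := by
  let σ : Measure (Space d) := (volume : Measure (Space d)).toFinite
  refine ⟨fun z => Kernel.rnDeriv κ (Kernel.const ℝ σ) z.1 z.2 * σ.rnDeriv volume z.2,
    (Kernel.measurable_rnDeriv _ _).mul
      ((Measure.measurable_rnDeriv _ _).comp measurable_snd), fun t ht => ?_⟩
  have hvσ : (volume : Measure (Space d)) ≪ σ := absolutelyContinuous_toFinite volume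
  have h1 : Kernel.rnDeriv κ (Kernel.const ℝ σ) t =ᵐ[volume] (κ t).rnDeriv σ :=
    hvσ.ae_le (Kernel.rnDeriv_eq_rnDeriv_measure (κ := κ) (η := Kernel.const ℝ σ) (a := t))
  have h2 := Measure.rnDeriv_mul_rnDeriv (κ := (volume : Measure (Space d))) (ht.trans hvσ)
  filter_upwards [h1, h2] with x h3 h4
  rw [h3, ← h4]; rfl

lemma aestronglyMeasurable_internalAlong {I : Measure ℝ} {μ : ℝ → Measure (Space d)}
    (κ : Kernel ℝ (Space d)) [IsMarkovKernel κ] (hκ : ∀ᵐ t ∂I, κ t = μ t)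
    (hac : ∀ᵐ t ∂I, μ t ≪ volume) (q : ℝ) (Ω : Set (Space d))
    {D : ℝ × Space d → Space d →L[ℝ] Space d} (hD : Measurable D) (ε : ℝ) :
    AEStronglyMeasurable (fun t => internalAlong q Ω (μ t) (fun x => D (t, x)) ε) I := by
  obtain ⟨U, hU, hUe⟩ := exists_joint_density κ
  have hm : Measurable fun z : ℝ × Space d => (U z).toReal ^ q * detFactor q (ε • D z) :=
    (hU.ennreal_toReal.pow_const q).mul ((measurable_detFactor q).comp (hD.const_smul ε))
  have h1 : StronglyMeasurable fun t => ∫ x in Ω, (U (t, x)).toReal ^ q * detFactor q (ε • D (t, x)) :=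
    hm.stronglyMeasurable.integral_prod_right
  refine h1.aestronglyMeasurable.congr ?_
  filter_upwards [hκ, hac] with t h2 h3
  refine integral_congr_ae (ae_restrict_of_ae ?_)
  rw [← h2] at h3
  filter_upwards [hUe t h3] with x hx
  simp only [hx, density, h2]

lemma aestronglyMeasurable_kineticAlong {I : Measure ℝ} {μ : ℝ → Measure (Space d)}
    (κ : Kernel ℝ (Space d)) [IsMarkovKernel κ] (hκ : ∀ᵐ t ∂I, κ t = μ t) (p : ℝ)
    {v z : ℝ → Space d → Space d} (hv : Measurable (Function.uncurry v))
    (hz : Measurable (Function.uncurry z)) (ε : ℝ) :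
    AEStronglyMeasurable (fun t => kineticAlong p (μ t) (v t) (z t) ε) I := by
  have hm : Measurable fun y : ℝ × Space d =>
      ‖Function.uncurry v y + ε • Function.uncurry z y‖ ^ p :=
    (hv.add (hz.const_smul ε)).norm.pow_const p
  have h1 : StronglyMeasurable fun t => ∫ x, ‖v t x + ε • z t x‖ ^ p ∂(κ t) :=
    hm.stronglyMeasurable.integral_kernel_prod_right'
  refine h1.aestronglyMeasurable.congr ?_
  filter_upwards [hκ] with t h2
  rw [kineticAlong, h2]

end JointMeasurability

/-! ### Finiteness of the internal energy and admissibility of the variation -/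

section FirstVariation

open ProbabilityTheory Filter Topology

lemma aemeasurable_Lq {I : Measure ℝ} {μ : ℝ → Measure (Space d)}
    (κ : Kernel ℝ (Space d)) [IsMarkovKernel κ] (hκ : ∀ᵐ t ∂I, κ t = μ t) (q : ℝ)
    (Ω : Set (Space d)) : AEMeasurable (fun t => Lq q Ω (μ t)) I := by
  classical
  obtain ⟨U, hU, hUe⟩ := exists_joint_density κ
  let σ : Measure (Space d) := (volume : Measure (Space d)).toFinite
  have hS : MeasurableSet {t | κ t ≪ (volume : Measure (Space d))} := by
    have h1 := Kernel.measurableSet_absolutelyContinuous κ (Kernel.const ℝ σ)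
    have h2 : {t | κ t ≪ (volume : Measure (Space d))} = {t | κ t ≪ (Kernel.const ℝ σ) t} := by
      ext t
      exact ⟨fun h => h.trans (absolutelyContinuous_toFinite volume),
        fun h => h.trans (toFinite_absolutelyContinuous volume)⟩
    rwa [h2]
  have h1 : Measurable fun t => ∫⁻ x in Ω, U (t, x) ^ q :=
    (hU.pow_const q).lintegral_prod_right'
  refine ⟨fun t => if κ t ≪ (volume : Measure (Space d)) then ∫⁻ x in Ω, U (t, x) ^ q else ⊤,
    Measurable.ite hS h1 measurable_const, ?_⟩
  filter_upwards [hκ] with t ht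
  rw [Lq, ← ht]
  split_ifs with h
  · exact lintegral_congr_ae (ae_restrict_of_ae ((hUe t h).mono fun x hx => by simp only [hx]))
  · rfl

lemma ae_kinetic_pos {p : ℝ} {μ : ℝ → Measure (Space d)} {v : ℝ → Space d → Space d}
    (hV : ∀ a b : ℝ, 0 < a → a < b → b < 1 → ∃ V₀ : ℝ, 0 < V₀ ∧
      ∀ᵐ t ∂(volume.restrict (Icc a b)), ENNReal.ofReal V₀ ≤ kinetic p μ v t) :
    ∀ᵐ t ∂(volume.restrict (Icc (0 : ℝ) 1)), 0 < kinetic p μ v t := by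
  have h1 : ∀ n : ℕ, ∀ᵐ t ∂(volume : Measure ℝ),
      t ∈ Icc (1 / ((n : ℝ) + 3)) (1 - 1 / ((n : ℝ) + 3)) → 0 < kinetic p μ v t := by
    -- The shift by 3 keeps the interval nondegenerate for every n, since 1/3 < 2/3.
    intro n
    have hn : (0:ℝ) < 1 / ((n : ℝ) + 3) := by positivity
    have hn2 : 1 / ((n : ℝ) + 3) ≤ 1 / 3 := by
      apply one_div_le_one_div_of_le <;> norm_num
    obtain ⟨V₀, hV₀, h⟩ := hV (1 / ((n : ℝ) + 3)) (1 - 1 / ((n : ℝ) + 3)) hn (by linarith)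
      (by linarith)
    rw [ae_restrict_iff' measurableSet_Icc] at h
    filter_upwards [h] with t ht htI
    exact (ENNReal.ofReal_pos.2 hV₀).trans_le (ht htI)
  rw [← restrict_Ioo_eq_restrict_Icc, ae_restrict_iff' measurableSet_Ioo]
  filter_upwards [ae_all_iff.2 h1] with t ht htI
  obtain ⟨n, hn⟩ := exists_nat_one_div_lt (lt_min htI.1 (sub_pos.2 htI.2))
  have h2 : 1 / ((n : ℝ) + 3) ≤ 1 / ((n : ℝ) + 1) := by
    apply one_div_le_one_div_of_le <;> [positivity; linarith]
  have h3 := lt_min_iff.1 hn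
  exact ht n ⟨by linarith [h3.1], by linarith [h3.2]⟩

/-- The energy integrand is finite a.e.; where the kinetic factor is positive, an infinite `Lq`
would make the product infinite. -/
lemma ae_Lq_lt_top {p q α β : ℝ} (hα : 0 < α) (hβ : 0 < β) {Ω : Set (Space d)}
    {μ : ℝ → Measure (Space d)} {v : ℝ → Space d → Space d} (hvm : Measurable (Function.uncurry v))
    (κ : Kernel ℝ (Space d)) [IsMarkovKernel κ]
    (hκ : ∀ᵐ t ∂(volume.restrict (Icc (0 : ℝ) 1)), κ t = μ t)
    (hfin : energyOf p q α β Ω μ v < ⊤)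
    (hpos : ∀ᵐ t ∂(volume.restrict (Icc (0 : ℝ) 1)), 0 < kinetic p μ v t) :
    ∀ᵐ t ∂(volume.restrict (Icc (0 : ℝ) 1)), Lq q Ω (μ t) < ⊤ := by
  have hk : AEMeasurable (fun t => kinetic p μ v t) (volume.restrict (Icc (0 : ℝ) 1)) := by
    refine ⟨kinetic p κ v, measurable_kinetic_kernel κ p hvm, ?_⟩
    filter_upwards [hκ] with t ht
    simp only [kinetic, ht]
  have hm : AEMeasurable (fun t => Lq q Ω (μ t) ^ α * kinetic p μ v t ^ β)
      (volume.restrict (Icc (0 : ℝ) 1)) :=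
    ((aemeasurable_Lq κ hκ q Ω).pow_const α).mul (hk.pow_const β)
  filter_upwards [ae_lt_top' hm hfin.ne, hpos] with t h1 h2
  rw [lt_top_iff_ne_top]
  intro h3
  rw [h3, ENNReal.top_rpow_of_pos hα, ENNReal.top_mul
    (by rw [Ne, ENNReal.rpow_eq_zero_iff_of_pos hβ]; exact h2.ne')] at h1
  exact h1.ne rfl

lemma absolutelyContinuous_of_Lq_lt_top {q : ℝ} {Ω : Set (Space d)} {ν : Measure (Space d)}
    (h : Lq q Ω ν < ⊤) : ν ≪ volume := by
  by_contra hn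
  rw [Lq, if_neg hn] at h
  exact h.ne rfl

/-- The derivative in space of `ξ`. -/
noncomputable def spatialDeriv (ξ : ℝ × Space d → Space d) (z : ℝ × Space d) :
    Space d →L[ℝ] Space d :=
  (fderiv ℝ ξ z).comp (ContinuousLinearMap.inr ℝ ℝ (Space d))

variable {ξ : ℝ × Space d → Space d}

lemma norm_spatialDeriv_le {B : ℝ} (hB : ∀ z, ‖fderiv ℝ ξ z‖ ≤ B) (z : ℝ × Space d) :
    ‖spatialDeriv ξ z‖ ≤ B := by
  refine (ContinuousLinearMap.opNorm_comp_le _ _).trans ?_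
  have h1 := ContinuousLinearMap.norm_inr_le_one ℝ ℝ (Space d)
  have h2 := hB z
  nlinarith [norm_nonneg (fderiv ℝ ξ z)]

lemma measurable_spatialDeriv (hξ : ContDiff ℝ ∞ ξ) : Measurable (spatialDeriv ξ) :=
  (((ContinuousLinearMap.compL ℝ (Space d) (ℝ × Space d) (Space d)).flip
    (ContinuousLinearMap.inr ℝ ℝ (Space d))).continuous.comp
    (hξ.continuous_fderiv (by simp))).measurable

lemma divergence_eq (hξ : Differentiable ℝ ξ) (t : ℝ) (x : Space d) :
    divergence ξ t x = ∑ i, spatialDeriv ξ (t, x) (EuclideanSpace.single i 1) i := by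
  rw [divergence, (hasFDerivAt_slice hξ t x).fderiv]; rfl

lemma exists_time_interval (hc : HasCompactSupport ξ) {Ω : Set (Space d)}
    (hsub : tsupport ξ ⊆ Ioo (0 : ℝ) 1 ×ˢ interior Ω) :
    ∃ a b : ℝ, 0 < a ∧ a < b ∧ b < 1 ∧ ∀ t, t ∉ Icc a b → ∀ x, (t, x) ∉ tsupport ξ := by
  have hK : IsCompact (Prod.fst '' tsupport ξ) := hc.isCompact.image continuous_fst
  rcases (Prod.fst '' tsupport ξ).eq_empty_or_nonempty with h | h
  · refine ⟨1 / 3, 1 / 2, by norm_num, by norm_num, by norm_num, fun t _ x hx => ?_⟩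
    have : t ∈ Prod.fst '' tsupport ξ := ⟨_, hx, rfl⟩
    simp [h] at this
  · obtain ⟨z, hz, hza⟩ := hK.sInf_mem h
    obtain ⟨y, hy, hyb⟩ := hK.sSup_mem h
    have ha := (hsub hz).1.1
    have hb := (hsub hy).1.2
    rw [hza] at ha
    rw [hyb] at hb
    have hab : sInf (Prod.fst '' tsupport ξ) ≤ sSup (Prod.fst '' tsupport ξ) :=
      Real.sInf_le_sSup _ hK.bddBelow hK.bddAbove
    -- The right endpoint lies strictly between the last time of the support and 1, so that a < b
    -- even when the support occupies a single time.
    refine ⟨_, (sSup (Prod.fst '' tsupport ξ) + 1) / 2, ha, by linarith, by linarith,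
      fun t ht x hx => ht ⟨?_, ?_⟩⟩
    · exact csInf_le hK.bddBelow ⟨_, hx, rfl⟩
    · have : t ≤ sSup (Prod.fst '' tsupport ξ) := le_csSup hK.bddAbove ⟨_, hx, rfl⟩
      linarith

lemma transportDeriv_eq_zero (hξ : Differentiable ℝ ξ) {t : ℝ} {x : Space d}
    (h : (t, x) ∉ tsupport ξ) (w : Space d) : transportDeriv ξ t x w = 0 := by
  have h1 : fderiv ℝ ξ (t, x) = 0 :=
    image_eq_zero_of_notMem_tsupport fun h' => h (tsupport_fderiv_subset ℝ h')
  rw [transportDeriv_eq hξ, h1]; rfl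

lemma hasFDerivAt_perturb (hξ : Differentiable ℝ ξ) (ε t : ℝ) (x : Space d) :
    HasFDerivAt (perturb ξ ε t) (1 + ε • spatialDeriv ξ (t, x)) x :=
  (hasFDerivAt_id x).add ((hasFDerivAt_slice hξ t x).const_smul ε)

lemma Lq_perturbCurve_le {q B r K ε₀ : ℝ} (hq : 0 < q) (hK0 : 0 ≤ K) (hr : 0 < r)
    (hK : ∀ A A' : Space d →L[ℝ] Space d, ‖A‖ < r → ‖A'‖ < r →
      0 < (1 + A).det ∧ |detFactor q A - detFactor q A'| ≤ K * ‖A - A'‖)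
    (hε₀ : ε₀ * B ≤ r) {Ω : Set (Space d)} (hΩ : MeasurableSet Ω)
    (hξ : ContDiff ℝ ∞ ξ) (hB : ∀ z, ‖fderiv ℝ ξ z‖ ≤ B) {ε : ℝ} (hε : |ε| < ε₀)
    (hεB : |ε| * B < 1) {μ : ℝ → Measure (Space d)} {t : ℝ} [IsFiniteMeasure (μ t)]
    (hν : μ t ≪ volume) (hνΩ : μ t Ωᶜ = 0) (hL : Lq q Ω (μ t) ≠ ⊤) :
    Lq q Ω (perturbCurve ξ ε μ t)
      ≤ ENNReal.ofReal (internalAlong q Ω (μ t) (fun x => spatialDeriv ξ (t, x)) ε) := by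
  have hξd : Differentiable ℝ ξ := hξ.differentiable (by simp)
  have hDm : Measurable fun x => spatialDeriv ξ (t, x) :=
    (measurable_spatialDeriv hξ).comp measurable_prodMk_left
  have hDB : ∀ x, ‖spatialDeriv ξ (t, x)‖ ≤ B := fun x => norm_spatialDeriv_le hB _
  rw [ofReal_internalAlong hK0 hr hK hDB hε₀ hDm hq hν hL hε]
  obtain ⟨h, hh⟩ := exists_perturb_homeomorph hξd hB hεB
  have hfst : ∀ y, (h.symm (t, y)).1 = t := fun y => by
    have h1 := h.apply_symm_apply (t, y)
    rw [← Prod.mk.eta (p := h.symm (t, y)), hh] at h1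
    exact congrArg Prod.fst h1
  refine Lq_map_le hq hΩ hν hνΩ (g := fun y => (h.symm (t, y)).2)
    (f' := fun x => 1 + ε • spatialDeriv ξ (t, x)) (fun x => hasFDerivAt_perturb hξd ε t x)
    (fun x => ?_) ?_ ?_ (fun x => ?_) (fun y => ?_)
  · exact (hK _ 0 (norm_smul_lt_of_abs_lt hDB hε₀ hr hε x) (by simpa using hr)).1.ne'
  · exact contDiff_det.continuous.measurable.comp (measurable_const.add (hDm.const_smul ε))
  · exact (continuous_snd.comp (h.symm.continuous.comp (Continuous.prodMk_right t))).measurable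
  · simp only [← hh, h.symm_apply_apply]
  · have h1 := h.apply_symm_apply (t, y)
    rw [← Prod.mk.eta (p := h.symm (t, y)), hh, hfst] at h1
    exact congrArg Prod.snd h1

lemma internalAlong_nonneg {q B r ε₀ K : ℝ} (hr : 0 < r)
    (hK : ∀ A A' : Space d →L[ℝ] Space d, ‖A‖ < r → ‖A'‖ < r →
      0 < (1 + A).det ∧ |detFactor q A - detFactor q A'| ≤ K * ‖A - A'‖)
    {D : Space d → Space d →L[ℝ] Space d} (hB : ∀ x, ‖D x‖ ≤ B)
    (hε₀ : ε₀ * B ≤ r) (Ω : Set (Space d)) (ν : Measure (Space d)) {ε : ℝ} (hε : |ε| < ε₀) :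
    0 ≤ internalAlong q Ω ν D ε :=
  integral_nonneg fun x => mul_nonneg (Real.rpow_nonneg (density_nonneg ν x) q)
    (Real.rpow_nonneg (hK _ 0 (norm_smul_lt_of_abs_lt hB hε₀ hr hε x) (by simpa using hr)).1.le _)

lemma kineticAlong_nonneg (p : ℝ) (ν : Measure (Space d)) (a z : Space d → Space d) (ε : ℝ) :
    0 ≤ kineticAlong p ν a z ε := integral_nonneg fun _ => by positivity

/-- The endpoints are kept because ξ vanishes at times outside (0,1), where the perturbation is the
identity. -/
lemma IsAdmissible.perturbCurve {p : ℝ} (hp : 1 < p) {Ω : Set (Space d)} (hΩm : MeasurableSet Ω)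
    {μ₀ μ₁ : Measure (Space d)} {μ : ℝ → Measure (Space d)} (hμ : IsAdmissible p Ω μ₀ μ₁ μ)
    (hξ : Differentiable ℝ ξ) (hc : HasCompactSupport ξ)
    (hsub : tsupport ξ ⊆ Ioo (0 : ℝ) 1 ×ˢ interior Ω) {B : ℝ} (hB : ∀ z, ‖fderiv ℝ ξ z‖ ≤ B) {ε : ℝ}
    (hε : |ε| ≤ 1) (hΩ : ∀ t, ∀ x ∈ Ω, perturb ξ ε t x ∈ Ω) :
    IsAdmissible p Ω μ₀ μ₁ (perturbCurve ξ ε μ) := by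
  have key : ∀ t, t ∉ Ioo (0:ℝ) 1 → WGeod.perturbCurve ξ ε μ t = μ t := by
    intro t ht
    have : perturb ξ ε t = id := by
      funext x
      rw [perturb, image_eq_zero_of_notMem_tsupport fun h => ht (hsub h).1, smul_zero, add_zero]
      rfl
    rw [WGeod.perturbCurve, this, Measure.map_id]
  exact ⟨hμ.curve.perturbCurve hp hξ hc hB hε hΩ hΩm, (key 0 (by simp)).trans hμ.init,
    (key 1 (by simp)).trans hμ.final⟩

end FirstVariation

/-! ### The Euler-Lagrange equation -/

section MinimizerVariation

open ProbabilityTheory Filter Topology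

variable {ξ : ℝ × Space d → Space d} {p q α β : ℝ} {Ω : Set (Space d)} {μ : ℝ → Measure (Space d)}
  {v : ℝ → Space d → Space d}

lemma ofReal_kineticAlong_transport (hp : 1 < p) (hξ : ContDiff ℝ ∞ ξ) {B : ℝ}
    (hB : ∀ z, ‖fderiv ℝ ξ z‖ ≤ B) (hvm : Measurable (Function.uncurry v)) {t : ℝ}
    [IsFiniteMeasure (μ t)] (ht : MemLp (v t) (ENNReal.ofReal p) (μ t)) (ε : ℝ) :
    ENNReal.ofReal (kineticAlong p (μ t) (v t) (fun x => transportDeriv ξ t x (v t x)) ε)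
      = kinetic p μ (perturbField ξ ε v) t :=
  ofReal_kineticAlong hp ht
    ((measurable_transportDeriv hξ hvm).comp measurable_prodMk_left).aestronglyMeasurable
    (fun x => norm_transportDeriv_le (hξ.differentiable (by simp)) hB t x (v t x)) ε

lemma kineticAlong_transport_zero (hp : 1 < p) (hξ : ContDiff ℝ ∞ ξ) {B : ℝ}
    (hB : ∀ z, ‖fderiv ℝ ξ z‖ ≤ B) (hvm : Measurable (Function.uncurry v)) {t : ℝ}
    [IsFiniteMeasure (μ t)] (ht : MemLp (v t) (ENNReal.ofReal p) (μ t)) :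
    ENNReal.ofReal (kineticAlong p (μ t) (v t) (fun x => transportDeriv ξ t x (v t x)) 0)
      = kinetic p μ v t := by
  rw [ofReal_kineticAlong_transport hp hξ hB hvm ht]
  simp [kinetic, perturbField]

/-- This is where the lower bound on V makes the Lipschitz estimate relative. On [a,b], V ≥ V₀ gives
V + 1 ≤ (1 + 1/V₀)V; outside [a,b] the perturbation has no effect on the velocity and the difference
is zero. -/
lemma ae_abs_kineticAlong_sub_le (hp : 1 < p) (hμ : IsLipschitzCurve p Ω μ)
    (hv : IsVelocityField p μ v) (hξ : ContDiff ℝ ∞ ξ) {B : ℝ} (hB : ∀ z, ‖fderiv ℝ ξ z‖ ≤ B)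
    {a b V₀ : ℝ} (hab : ∀ t, t ∉ Icc a b → ∀ x, (t, x) ∉ tsupport ξ) (hV₀ : 0 < V₀)
    (hV : ∀ᵐ t ∂(volume.restrict (Icc a b)), ENNReal.ofReal V₀ ≤ kinetic p μ v t) :
    ∀ᵐ t ∂(volume.restrict (Icc (0 : ℝ) 1)), ∀ ε ε', |ε| ≤ 1 → |ε'| ≤ 1 →
      |kineticAlong p (μ t) (v t) (fun x => transportDeriv ξ t x (v t x)) ε
        - kineticAlong p (μ t) (v t) (fun x => transportDeriv ξ t x (v t x)) ε'|
      ≤ p * ((1 + B) ^ p * 2 ^ p) * (1 + 1 / V₀)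
        * kineticAlong p (μ t) (v t) (fun x => transportDeriv ξ t x (v t x)) 0 * |ε - ε'| := by
  have hB0 : 0 ≤ B := (norm_nonneg _).trans (hB (0, 0))
  have hξd : Differentiable ℝ ξ := hξ.differentiable (by simp)
  rw [ae_restrict_iff' measurableSet_Icc] at hV
  filter_upwards [ae_restrict_of_ae hV, ae_restrict_mem measurableSet_Icc, hv.memLp]
    with t h1 htI h2 ε ε' hε hε'
  have := (hμ.mem t htI).isProb
  set T := fun x => transportDeriv ξ t x (v t x)
  have hT : AEStronglyMeasurable T (μ t) :=
    ((measurable_transportDeriv hξ hv.measurable).comp measurable_prodMk_left).aestronglyMeasurable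
  have hTB : ∀ x, ‖T x‖ ≤ B * (1 + ‖v t x‖) := fun x => norm_transportDeriv_le hξd hB t x (v t x)
  have hn := kineticAlong_nonneg p (μ t) (v t) T 0
  by_cases ht : t ∈ Icc a b
  · have h3 := h1 ht
    rw [← kineticAlong_transport_zero hp hξ hB hv.measurable h2, ENNReal.ofReal_le_ofReal_iff hn] at h3
    refine (abs_kineticAlong_sub_le hp hB0 h2 hT hTB hε hε').trans ?_
    have h4 : kineticAlong p (μ t) (v t) T 0 + 1
        ≤ (1 + 1 / V₀) * kineticAlong p (μ t) (v t) T 0 := by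
      have : 1 ≤ 1 / V₀ * kineticAlong p (μ t) (v t) T 0 := by
        rw [one_div_mul_eq_div, le_div_iff₀ hV₀]; linarith
      linarith
    rw [mul_assoc _ (1 + 1 / V₀)]
    gcongr
  · have hz : T = fun _ => 0 := funext fun x => transportDeriv_eq_zero hξd (hab t ht x) _
    rw [hz]
    simp only [kineticAlong, smul_zero, sub_self, abs_zero]
    positivity

/-- The image curve has a tangent field, whose kinetic energy is at most that of the transported
field at a.e. time; `Lq_perturbCurve_le` bounds the other factor. -/
lemma energy_perturbCurve_le (hp : 1 < p) (hq : 1 < q) (hα : 0 < α) (hβ : 0 < β)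
    (hΩm : MeasurableSet Ω) (hμ : IsLipschitzCurve p Ω μ) (hv : IsVelocityField p μ v)
    (hξ : ContDiff ℝ ∞ ξ) (hc : HasCompactSupport ξ) {B : ℝ} (hB : ∀ z, ‖fderiv ℝ ξ z‖ ≤ B)
    {r K ε₀ : ℝ} (hK0 : 0 ≤ K) (hr : 0 < r)
    (hK : ∀ A A' : Space d →L[ℝ] Space d, ‖A‖ < r → ‖A'‖ < r →
      0 < (1 + A).det ∧ |detFactor q A - detFactor q A'| ≤ K * ‖A - A'‖)
    (hε₀ : ε₀ * B ≤ r) {ε : ℝ} (hε : |ε| < ε₀) (hε1 : |ε| ≤ 1) (hεB : |ε| * B < 1)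
    (hΩ : ∀ t, ∀ x ∈ Ω, perturb ξ ε t x ∈ Ω)
    (hL : ∀ᵐ t ∂(volume.restrict (Icc (0 : ℝ) 1)), Lq q Ω (μ t) < ⊤) :
    energy p q α β Ω (perturbCurve ξ ε μ) ≤ ∫⁻ t in Icc (0 : ℝ) 1, ENNReal.ofReal
      (internalAlong q Ω (μ t) (fun x => spatialDeriv ξ (t, x)) ε ^ α
        * kineticAlong p (μ t) (v t) (fun x => transportDeriv ξ t x (v t x)) ε ^ β) := by
  have hξd : Differentiable ℝ ξ := hξ.differentiable (by simp)
  have hp0 : 0 < p := by linarith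
  obtain ⟨κ, hκm, hκ⟩ := (hμ.perturbCurve hp hξd hc hB hε1 hΩ hΩm).exists_kernel hp
  obtain ⟨w, hw, hwk⟩ := hv.exists_perturbCurve hp hμ hξ hc hB hεB
  obtain ⟨w', hw'⟩ := hw.exists_isTangentField hp hκ
  rw [energy_eq hp0 q α β Ω _ _ hw', energyOf]
  refine lintegral_mono_ae ?_
  filter_upwards [hw'.minimal w hw, hL, ae_restrict_mem measurableSet_Icc, hv.memLp]
    with t h1 h2 htI h3
  have := (hμ.mem t htI).isProb
  have h4 := Lq_perturbCurve_le (by linarith) hK0 hr hK hε₀ hΩm hξ hB hε hεB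
    (absolutelyContinuous_of_Lq_lt_top h2) (hμ.mem t htI).concentrated h2.ne
  have h5 : kinetic p (perturbCurve ξ ε μ) w' t
      ≤ ENNReal.ofReal (kineticAlong p (μ t) (v t) (fun x => transportDeriv ξ t x (v t x)) ε) := by
    rw [ofReal_kineticAlong_transport hp hξ hB hv.measurable h3, ← hwk, kinetic_eq hp0,
      kinetic_eq hp0]
    gcongr
  have h6 := internalAlong_nonneg hr hK
    (D := fun x => spatialDeriv ξ (t, x)) (fun x => norm_spatialDeriv_le hB _) hε₀ Ω (μ t) hε
  rw [ENNReal.ofReal_mul (by positivity), ← ENNReal.ofReal_rpow_of_nonneg h6 hα.le,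
    ← ENNReal.ofReal_rpow_of_nonneg (kineticAlong_nonneg _ _ _ _ _) hβ.le]
  gcongr

theorem IsMinimizer.firstVariation (hp : 1 < p) (hq : 1 < q) (hα : 0 < α) (hβ : 0 < β)
    (hΩm : MeasurableSet Ω) {μ₀ μ₁ : Measure (Space d)} (hμ : IsMinimizer p q α β Ω μ₀ μ₁ μ)
    (hfin : energy p q α β Ω μ < ⊤) (hv : IsTangentField p μ v)
    (hL : ∀ᵐ t ∂(volume.restrict (Icc (0 : ℝ) 1)), Lq q Ω (μ t) < ⊤)
    (hV : ∀ a b : ℝ, 0 < a → a < b → b < 1 → ∃ V₀ : ℝ, 0 < V₀ ∧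
      ∀ᵐ t ∂(volume.restrict (Icc a b)), ENNReal.ofReal V₀ ≤ kinetic p μ v t)
    (hξ : ContDiff ℝ ∞ ξ) (hc : HasCompactSupport ξ)
    (hsub : tsupport ξ ⊆ Ioo (0 : ℝ) 1 ×ˢ interior Ω) :
    (∀ᵐ t ∂(volume.restrict (Icc (0 : ℝ) 1)),
      IntegrableOn (pressureIntegrand q μ ξ t) Ω ∧ IntegrableOn (momentumIntegrand p μ v ξ t) Ω) ∧
    IntegrableOn (pressureTerm p q α β Ω μ v ξ) (Icc (0 : ℝ) 1) ∧
    IntegrableOn (momentumTerm p q α β Ω μ v ξ) (Icc (0 : ℝ) 1) ∧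
    (α * (1 - q) * (∫ t in Icc (0 : ℝ) 1, pressureTerm p q α β Ω μ v ξ t)) +
      (p * β * (∫ t in Icc (0 : ℝ) 1, momentumTerm p q α β Ω μ v ξ t)) = 0 := by
  have hp0 : 0 < p := by linarith
  have hξd : Differentiable ℝ ξ := hξ.differentiable (by simp)
  have hcurve := hμ.admissible.curve
  have hvel := hv.velocity
  obtain ⟨κ, hκm, hκ'⟩ := hcurve.exists_kernel hp
  set I : Measure ℝ := volume.restrict (Icc (0 : ℝ) 1)
  have hmemI : ∀ᵐ t ∂I, t ∈ Icc (0:ℝ) 1 := ae_restrict_mem measurableSet_Icc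
  have hκ : ∀ᵐ t ∂I, κ t = μ t := hmemI.mono hκ'
  have hac : ∀ᵐ t ∂I, μ t ≪ volume := hL.mono fun t => absolutelyContinuous_of_Lq_lt_top
  -- constants
  obtain ⟨B, hB⟩ := (hc.fderiv ℝ).exists_bound_of_continuous (hξ.continuous_fderiv (by simp))
  have hB0 : 0 ≤ B := (norm_nonneg _).trans (hB (0, 0))
  obtain ⟨r, hr, K, hK0, hK⟩ := exists_detFactor_lipschitz d q
  obtain ⟨a, b, ha, hab, hb, hsupp⟩ := exists_time_interval hc hsub
  obtain ⟨V₀, hV₀, hVab⟩ := hV a b ha hab hb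
  -- The first bound is for the kinetic estimate, which needs |ε| ≤ 1; the second keeps ε∇ξ in the
  -- ball of radius r where the determinant is positive and `detFactor` is Lipschitz.
  set ε₀ : ℝ := min 1 (r / (B + 1))
  have hε₀ : 0 < ε₀ := by positivity
  have hε₀B : ε₀ * B ≤ r := by
    calc ε₀ * B ≤ r / (B + 1) * (B + 1) := by
          gcongr
          · exact min_le_right _ _
          · linarith
      _ = r := by field_simp
  have hlt1 : ∀ {ε : ℝ}, |ε| < ε₀ → |ε| ≤ 1 := fun h => h.le.trans (min_le_left _ _)
  set C₁ := K * B
  set C₂ := p * ((1 + B) ^ p * 2 ^ p) * (1 + 1 / V₀)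
  have hC₁ : 0 ≤ C₁ := by positivity
  have hC₂ : 0 ≤ C₂ := by positivity
  -- slices
  set D : ℝ → Space d → Space d →L[ℝ] Space d := fun t x => spatialDeriv ξ (t, x)
  have hDm : ∀ t, Measurable (D t) := fun t => (measurable_spatialDeriv hξ).comp measurable_prodMk_left
  have hDB : ∀ t x, ‖D t x‖ ≤ B := fun t x => norm_spatialDeriv_le hB _
  set T : ℝ → Space d → Space d := fun t x => transportDeriv ξ t x (v t x)
  have hTm : Measurable (Function.uncurry T) := measurable_transportDeriv hξ hvel.measurable
  have hTt : ∀ t, AEStronglyMeasurable (T t) (μ t) := fun t =>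
    (hTm.comp measurable_prodMk_left).aestronglyMeasurable
  have hTB : ∀ t x, ‖T t x‖ ≤ B * (1 + ‖v t x‖) := fun t x => norm_transportDeriv_le hξd hB t x _
  set F : ℝ → ℝ → ℝ := fun ε t => internalAlong q Ω (μ t) (D t) ε
  set V : ℝ → ℝ → ℝ := fun ε t => kineticAlong p (μ t) (v t) (T t) ε
  set P : ℝ → ℝ := fun t => ∫ x in Ω, pressureIntegrand q μ ξ t x
  set Q : ℝ → ℝ := fun t => ∫ x in Ω, momentumIntegrand p μ v ξ t x
  have h00 : |(0:ℝ)| < ε₀ := by simpa using hε₀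
  have hFnn : ∀ ε, |ε| < ε₀ → ∀ t, 0 ≤ F ε t := fun ε hε t =>
    internalAlong_nonneg hr hK (hDB t) hε₀B Ω (μ t) hε
  have hVnn : ∀ ε t, 0 ≤ V ε t := fun ε t => kineticAlong_nonneg _ _ _ _ _
  have hF0 : ∀ᵐ t ∂I, F 0 t = (Lq q Ω (μ t)).toReal := hL.mono fun t ht =>
    internalAlong_zero (absolutelyContinuous_of_Lq_lt_top ht) ht.ne _
  have hV0' : ∀ᵐ t ∂I, ENNReal.ofReal (V 0 t) = kinetic p μ v t := by
    filter_upwards [hmemI, hvel.memLp] with t htI h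
    have := (hcurve.mem t htI).isProb
    exact kineticAlong_transport_zero hp hξ hB hvel.measurable h
  have hV0 : ∀ᵐ t ∂I, V 0 t = (kinetic p μ v t).toReal := hV0'.mono fun t ht => by
    rw [← ht, ENNReal.toReal_ofReal (hVnn 0 t)]
  have hFm : ∀ ε, AEStronglyMeasurable (F ε) I := fun ε =>
    aestronglyMeasurable_internalAlong κ hκ hac q Ω (measurable_spatialDeriv hξ) ε
  have hVm : ∀ ε, AEStronglyMeasurable (V ε) I := fun ε =>
    aestronglyMeasurable_kineticAlong κ hκ p hvel.measurable hTm ε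
  have hFl : ∀ᵐ t ∂I, ∀ ε ε', |ε| < ε₀ → |ε'| < ε₀ →
      |F ε t - F ε' t| ≤ C₁ * F 0 t * |ε - ε'| := hL.mono fun t ht ε ε' hε hε' =>
    abs_internalAlong_sub_le hK0 hr hK (hDB t) hε₀B (hDm t)
      (absolutelyContinuous_of_Lq_lt_top ht) ht.ne hε hε'
  have hVl : ∀ᵐ t ∂I, ∀ ε ε', |ε| < ε₀ → |ε'| < ε₀ →
      |V ε t - V ε' t| ≤ C₂ * V 0 t * |ε - ε'| :=
    (ae_abs_kineticAlong_sub_le hp hcurve hvel hξ hB hsupp hV₀ hVab).mono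
      fun t ht ε ε' hε hε' => ht ε ε' (hlt1 hε) (hlt1 hε')
  have hpress : ∀ᵐ t ∂I, IntegrableOn (pressureIntegrand q μ ξ t) Ω ∧
      HasDerivAt (fun ε => F ε t) ((1 - q) * P t) 0 := by
    filter_upwards [hL] with t ht
    obtain ⟨i, h⟩ := hasDerivAt_internalAlong hK0 hr hK (hDB t) hε₀B hε₀ (hDm t)
      (absolutelyContinuous_of_Lq_lt_top ht) ht.ne
    have e : (fun x => density (μ t) x ^ q
        * ((1 - q) * ∑ i, D t x (EuclideanSpace.single i 1) i))
        = fun x => (1 - q) * pressureIntegrand q μ ξ t x := by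
      funext x
      rw [pressureIntegrand, divergence_eq hξd]; ring
    rw [e] at i h
    rw [integral_const_mul] at h
    refine ⟨?_, h⟩
    have hq1 : 1 - q ≠ 0 := by linarith
    exact (integrable_const_mul_iff (IsUnit.mk0 _ hq1) _).1 i
  have hmom : ∀ᵐ t ∂I, IntegrableOn (momentumIntegrand p μ v ξ t) Ω ∧
      HasDerivAt (fun ε => V ε t) (p * Q t) 0 := by
    filter_upwards [hmemI, hvel.memLp, hac] with t htI h1 h2
    have := (hcurve.mem t htI).isProb
    obtain ⟨i, h⟩ := hasDerivAt_kineticAlong hp hB0 h1 (hTt t) (hTB t)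
    have hc := (hcurve.mem t htI).concentrated
    obtain ⟨j, e⟩ := integral_density_mul hΩm h2 hc
      fun x => ‖v t x‖ ^ (p - 2) * inner ℝ (T t x) (v t x)
    have e2 : (fun x => density (μ t) x * (‖v t x‖ ^ (p - 2) * inner ℝ (T t x) (v t x)))
        = momentumIntegrand p μ v ξ t := by
      funext x
      rw [momentumIntegrand, ← mul_assoc]
    rw [e2] at j
    rw [integral_const_mul, ← e, e2] at h
    exact ⟨j ((integrable_const_mul_iff (IsUnit.mk0 _ hp0.ne') _).1 i), h⟩
  -- the energy
  have hen : energy p q α β Ω μ = ∫⁻ t, ENNReal.ofReal (F 0 t ^ α * V 0 t ^ β) ∂I := by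
    rw [energy_eq hp0 q α β Ω μ v hv, energyOf]
    refine lintegral_congr_ae ?_
    filter_upwards [hL, hF0, hV0'] with t h1 h2 h3
    rw [ENNReal.ofReal_mul (Real.rpow_nonneg (hFnn 0 h00 t) _),
      ← ENNReal.ofReal_rpow_of_nonneg (hFnn 0 h00 t) hα.le,
      ← ENNReal.ofReal_rpow_of_nonneg (hVnn 0 t) hβ.le, h3, h2, ENNReal.ofReal_toReal h1.ne]
  have hHnn : ∀ ε, |ε| < ε₀ → ∀ t, 0 ≤ F ε t ^ α * V ε t ^ β := fun ε hε t =>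
    mul_nonneg (Real.rpow_nonneg (hFnn ε hε t) _) (Real.rpow_nonneg (hVnn ε t) _)
  have hint : Integrable (fun t => F 0 t ^ α * V 0 t ^ β) I := by
    refine ⟨((hFm 0).aemeasurable.pow_const _).aestronglyMeasurable.mul
      ((hVm 0).aemeasurable.pow_const _).aestronglyMeasurable, ?_⟩
    rw [hasFiniteIntegral_iff_ofReal (ae_of_all _ (hHnn 0 h00)), ← hen]
    exact hfin
  -- derivatives
  set C := max C₁ C₂
  have hC : 0 ≤ C := hC₁.trans (le_max_left _ _)
  have hFl' : ∀ᵐ t ∂I, ∀ ε ε', |ε| < ε₀ → |ε'| < ε₀ →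
      |F ε t - F ε' t| ≤ C * F 0 t * |ε - ε'| := hFl.mono fun t ht ε ε' hε hε' =>
    (ht ε ε' hε hε').trans (by have := hFnn 0 h00 t; gcongr; exact le_max_left _ _)
  have hVl' : ∀ᵐ t ∂I, ∀ ε ε', |ε| < ε₀ → |ε'| < ε₀ →
      |V ε t - V ε' t| ≤ C * V 0 t * |ε - ε'| := hVl.mono fun t ht ε ε' hε hε' =>
    (ht ε ε' hε hε').trans (by have := hVnn 0 t; gcongr; exact le_max_right _ _)
  have hF0n : ∀ᵐ t ∂I, 0 ≤ F 0 t := ae_of_all _ (hFnn 0 h00)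
  have hV0n : ∀ᵐ t ∂I, 0 ≤ V 0 t := ae_of_all _ (hVnn 0)
  have hFd := hpress.mono fun t ht => ht.2
  have hVd := hmom.mono fun t ht => ht.2
  obtain ⟨-, hder, hintε⟩ := hasDerivAt_integral_rpow_mul_rpow hα hβ hC hε₀ (fun ε _ => hFm ε)
    (fun ε _ => hVm ε) hF0n hV0n hFl' hVl' hFd hVd hint
  have hconst : ∀ (G : ℝ → ℝ), (∀ t, 0 ≤ G t) → ∀ᵐ t ∂I, ∀ ε ε' : ℝ, |ε| < ε₀ → |ε'| < ε₀ →
      |G t - G t| ≤ C * G t * |ε - ε'| := fun G hG => ae_of_all _ fun t ε ε' _ _ => by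
    have := hG t
    rw [sub_self, abs_zero]; positivity
  -- Differentiability of J yields integrability only of the sum of the two terms. Freezing V in ε
  -- leaves the pressure term alone; freezing F next leaves the momentum term.
  obtain ⟨iP, -, -⟩ := hasDerivAt_integral_rpow_mul_rpow (V := fun _ => V 0) (V' := fun _ => 0)
    hα hβ hC hε₀ (fun ε _ => hFm ε) (fun _ _ => hVm 0) hF0n hV0n hFl' (hconst _ (hVnn 0)) hFd
    (ae_of_all _ fun t => hasDerivAt_const _ _) hint
  obtain ⟨iQ, -, -⟩ := hasDerivAt_integral_rpow_mul_rpow (F := fun _ => F 0) (F' := fun _ => 0)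
    hα hβ hC hε₀ (fun _ _ => hFm 0) (fun ε _ => hVm ε) hF0n hV0n (hconst _ (hFnn 0 h00)) hVl'
    (ae_of_all _ fun t => hasDerivAt_const _ _) hVd hint
  have eP : ∀ᵐ t ∂I, F 0 t ^ (α - 1) * V 0 t ^ β * P t = pressureTerm p q α β Ω μ v ξ t := by
    filter_upwards [hF0, hV0] with t h1 h2
    rw [pressureTerm, h1, h2]
  have eQ : ∀ᵐ t ∂I, F 0 t ^ α * V 0 t ^ (β - 1) * Q t = momentumTerm p q α β Ω μ v ξ t := by
    filter_upwards [hF0, hV0] with t h1 h2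
    rw [momentumTerm, h1, h2]
  have hcP : α * (1 - q) ≠ 0 := mul_ne_zero hα.ne' (by linarith)
  have hcQ : p * β ≠ 0 := mul_ne_zero hp0.ne' hβ.ne'
  have jP : Integrable (pressureTerm p q α β Ω μ v ξ) I := by
    refine (integrable_const_mul_iff (IsUnit.mk0 _ hcP) _).1 (iP.congr ?_)
    filter_upwards [eP] with t ht
    rw [← ht]; ring
  have jQ : Integrable (momentumTerm p q α β Ω μ v ξ) I := by
    refine (integrable_const_mul_iff (IsUnit.mk0 _ hcQ) _).1 (iQ.congr ?_)
    filter_upwards [eQ] with t ht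
    rw [← ht]; ring
  refine ⟨by filter_upwards [hpress, hmom] with t h1 h2 using ⟨h1.1, h2.1⟩, jP, jQ, ?_⟩
  -- J(0) is the energy of μ, at most the energy of the image curve by minimality, which is at most
  -- J(ε).
  have hmin : IsLocalMin (fun ε => ∫ t, F ε t ^ α * V ε t ^ β ∂I) 0 := by
    have ev1 : ∀ᶠ ε in 𝓝 (0:ℝ), |ε| < ε₀ :=
      ContinuousAt.eventually_lt (by fun_prop) continuousAt_const h00
    have ev2 : ∀ᶠ ε in 𝓝 (0:ℝ), |ε| * B < 1 :=
      ContinuousAt.eventually_lt (by fun_prop) continuousAt_const (by simp)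
    filter_upwards [ev1, ev2, eventually_perturb_mem hξ.continuous hc hsub, hintε]
      with ε h1 h2 h3 h4
    have hle := (hμ.le _ (hμ.admissible.perturbCurve hp hΩm hξd hc hsub hB (hlt1 h1) h3)).trans
      (energy_perturbCurve_le hp hq hα hβ hΩm hcurve hvel hξ hc hB hK0 hr hK hε₀B h1 (hlt1 h1) h2
        h3 hL)
    rw [hen, ← ofReal_integral_eq_lintegral_ofReal hint (ae_of_all _ (hHnn 0 h00)),
      ← ofReal_integral_eq_lintegral_ofReal h4 (ae_of_all _ (hHnn ε h1)),
      ENNReal.ofReal_le_ofReal_iff (integral_nonneg (hHnn ε h1))] at hle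
    exact hle
  rw [← hmin.hasDerivAt_eq_zero hder, ← integral_const_mul, ← integral_const_mul,
    ← integral_add (jP.const_mul _) (jQ.const_mul _)]
  refine integral_congr_ae ?_
  filter_upwards [eP, eQ] with t h1 h2
  rw [← h1, ← h2]; ring

end MinimizerVariation

end WGeod

/-- The local lower bounds give V > 0 a.e., so finite energy forces L_q(μ_t) < ∞ and hence absolute
continuity a.e.; the equation is then the first variation. -/
theorem mainTheorem2 (d : ℕ) (p q α β : ℝ) (hp : 1 < p) (hq : 1 < q) (hα : 0 < α) (hβ : 0 < β)
    (Ω : Set (WGeod.Space d)) (hΩ_closed : IsClosed Ω) (hΩ_convex : Convex ℝ Ω)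
    (μ₀ μ₁ : Measure (WGeod.Space d)) (μ : ℝ → Measure (WGeod.Space d))
    (hμ : WGeod.IsMinimizer p q α β Ω μ₀ μ₁ μ)
    (hfin : WGeod.energy p q α β Ω μ < ⊤)
    (v : ℝ → WGeod.Space d → WGeod.Space d) (hv : WGeod.IsTangentField p μ v)
    (hV : ∀ a b : ℝ, 0 < a → a < b → b < 1 → ∃ V₀ : ℝ, 0 < V₀ ∧
      ∀ᵐ t ∂(volume.restrict (Icc a b)), ENNReal.ofReal V₀ ≤ WGeod.kinetic p μ v t) :
    (∀ᵐ t ∂(volume.restrict (Icc (0 : ℝ) 1)), μ t ≪ volume) ∧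
    ∀ ξ : ℝ × WGeod.Space d → WGeod.Space d, ContDiff ℝ ∞ ξ → HasCompactSupport ξ →
      tsupport ξ ⊆ Ioo (0 : ℝ) 1 ×ˢ interior Ω →
      (∀ᵐ t ∂(volume.restrict (Icc (0 : ℝ) 1)),
        IntegrableOn (WGeod.pressureIntegrand q μ ξ t) Ω ∧
        IntegrableOn (WGeod.momentumIntegrand p μ v ξ t) Ω) ∧
      IntegrableOn (WGeod.pressureTerm p q α β Ω μ v ξ) (Icc (0 : ℝ) 1) ∧
      IntegrableOn (WGeod.momentumTerm p q α β Ω μ v ξ) (Icc (0 : ℝ) 1) ∧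
      (α * (1 - q) * (∫ t in Icc (0 : ℝ) 1, WGeod.pressureTerm p q α β Ω μ v ξ t)) +
        (p * β * (∫ t in Icc (0 : ℝ) 1, WGeod.momentumTerm p q α β Ω μ v ξ t)) = 0 := by

  obtain ⟨κ, hκm, hκ⟩ := hμ.admissible.curve.exists_kernel hp
  have hfin' := hfin
  rw [WGeod.energy_eq (by linarith) q α β Ω μ v hv] at hfin'
  have hL := WGeod.ae_Lq_lt_top hα hβ hv.velocity.measurable κ
    ((ae_restrict_mem measurableSet_Icc).mono hκ) hfin' (WGeod.ae_kinetic_pos hV)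
  exact ⟨hL.mono fun t => WGeod.absolutelyContinuous_of_Lq_lt_top, fun ξ hξ hc hsub =>
    hμ.firstVariation hp hq hα hβ hΩ_closed.measurableSet hfin hv hL hV hξ hc hsub⟩
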